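/- Let $\mathsf A$ be an abelian category and $(\mathcal T,\mathcal F)$ a torsion pair in $\mathsf A$: two full subcategories closed under isomorphism with $\operatorname{Hom}(T,F)=0$ for $T\in\mathcal T$, $F\in\mathcal F$, such that every object $X$ sits in a short exact sequence $0\to X'\to X\to X''\to 0$ with $X'\in\mathcal T$, $X''\in\mathcal F$. **The category $\mathsf B$.** Objects are morphisms $\mathbb X=[X^{-1}\xrightarrow{d}X^0]$ of $\mathsf A$ with $\ker d\in\mathcal F$ and $\operatorname{coker} d\in\mathcal T$. A butterfly from $\mathbb X$ to $\mathbb Y$ is an object $E$ with maps $\kappa\colon X^{-1}\to E$, $\iota\colon Y^{-1}\to E$, $\sigma\colon E\to X^0$, $\rho\colon E\to Y^0$ such that $\sigma\kappa=d_X$, $\rho\iota=d_Y$, $\rho\kappa=0$ and $0\to Y^{-1}\xrightarrow{\iota}E\xrightarrow{\sigma}X^0\to 0$ is exact. Morphisms of $\mathsf B$ are isomorphism classes of butterflies; the composite of $E\colon\mathbb X\to\mathbb Y$ and $F\colon\mathbb Y\to\mathbb Z$ has middle object $\operatorname{coker}\bigl(Y^{-1}\xrightarrow{(\iota,\kappa)}E\times_{Y^0}F\bigr)$.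 A chain map $(f^{-1},f^0)\colon\mathbb X\to\mathbb Y$ gives the split butterfly with $E=X^0\oplus Y^{-1}$, $\kappa=(d_X,-f^{-1})$, $\rho=(f^0,d_Y)$. **Strict maps of complexes.** $\mathsf{Ch}^{st}(\mathsf B)$ has as objects the cochain complexes $\mathbf X=(\cdots\to{}^{n}\mathbb X\to{}^{n+1}\mathbb X\to\cdots)$, $n\in\mathbb Z$, in $\mathsf B$, and as morphisms the families of chain maps $f_n=(f_n^{-1},f_n^0)\colon{}^n\mathbb X\to{}^n\mathbb Y$ which commute with the differentials in $\mathsf B$. Let $\mathsf{Ch}^{st,*}(\mathsf B)$, $*=-,+,b$, be the full subcategory of complexes with ${}^n\mathbb X=[0\to0]$ for $n\gg0$, for $n\ll0$, or both. **Decorated complexes.** A decorated complex $(E^\bullet,M^\bullet)$ is a cochain complex in $\mathsf A$ with subobjects $M^n\subseteq E^n$ (not necessarily preserved by the differential); morphisms are chain maps carrying $M^n$ into the decoration of the target. $\mathsf{Ch}(\mathsf A,\mathcal T,\mathcal F)$ is the full subcategory of those for which, for all $n$, the map $M^n\to E^{n+1}/M^{n+1}$ has kernel in $\mathcal F$ and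 cokernel in $\mathcal T$, and $\mathsf{Ch}^*(\mathsf A,\mathcal T,\mathcal F)$, $*=-,+,b$, consists of those with $E^\bullet$ bounded above, below, on both sides. The shift is $(E[1],M[1])$. The cone of a morphism is the usual cone with the direct sum decoration, and a homotopy of morphisms is a chain homotopy that carries the decoration of the source into that of the target. Let $\mathcal S_{qis}$ be the class of morphisms that induce isomorphisms on all $H^n(E^\bullet)$. **The functor $\operatorname{Tot}$.** $\operatorname{Tot}\colon\mathsf{Ch}^{st}(\mathsf B)\to\mathsf{Ch}(\mathsf A,\mathcal T,\mathcal F)$ sends $\mathbf X$ to $(E^\bullet,M^\bullet)$, where $E^n$ is the middle object of a butterfly $(E^n,\kappa_n,\iota_n,\sigma_n,\rho_n)$ representing ${}^{n-1}\mathbb X\to{}^n\mathbb X$, where $M^n=\iota_n({}^nX^{-1})$, and where the differentials $\delta$ of the complex $E^\bullet$ satisfy $\delta\iota_n=\kappa_{n+1}$ and $\sigma_{n+1}\delta=\rho_n$. It sends $f\colon\mathbf X\to\mathbf Y$ to the chain map $g$ with $g_n\iota_n=\iota_nf_n^{-1}$ and $\sigma_ng_n=f_{n-1}^0\sigma_n$.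 **Theorem.** The category $\mathsf B$ is abelian, a functor $\operatorname{Tot}$ as described exists, and for every such functor the following holds. 1. In $\mathcal S_{qis}^{-1}\mathsf{Ch}(\mathsf A,\mathcal T,\mathcal F)$ homotopic morphisms become equal, and this category is triangulated, with the induced shift and with the triangles isomorphic to images of the triangles $D\to D'\to\operatorname{cone}(f)\to D[1]$ of decorated cones as distinguished triangles. $\operatorname{Tot}$ induces a triangle equivalence $$\mathcal D(\mathsf B)\xrightarrow{\ \sim\ }\mathcal S_{qis}^{-1}\mathsf{Ch}(\mathsf A,\mathcal T,\mathcal F),$$ that is, there is a triangle equivalence whose composite with $\mathsf{Ch}^{st}(\mathsf B)\to\mathcal D(\mathsf B)$ is isomorphic to $\operatorname{Tot}$ followed by the localization functor. 2. For $*=-,+,b$ the same holds for the restriction $\operatorname{Tot}\colon\mathsf{Ch}^{st,*}(\mathsf B)\to\mathsf{Ch}^*(\mathsf A,\mathcal T,\mathcal F)$: it induces a triangle equivalence $$\mathcal D^*(\mathsf B)\xrightarrow{\ \sim\ }\mathcal S_{qis}^{-1}\mathsf{Ch}^*(\mathsf A,\mathcal T,\mathcal F),$$ where $\mathcal D^*(\mathsf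 B)\subseteq\mathcal D(\mathsf B)$ is the full subcategory of complexes with cohomology bounded above, below, on both sides. -/

import Mathlib

open CategoryTheory Limits
universe w v u
namespace HRS

/-- A torsion pair `(T, F)` in an abelian category. -/
structure TorsionPair (A : Type u) [Category.{v} A] [Abelian A] where
  T : ObjectProperty A
  F : ObjectProperty A
  T_iso : T.IsClosedUnderIsomorphisms
  F_iso : F.IsClosedUnderIsomorphisms
  hom_eq_zero : ∀ {X Y : A}, T X → F Y → ∀ f : X ⟶ Y, f = 0
  exists_shortExact : ∀ X : A, ∃ (X' X'' : A) (i : X' ⟶ X) (p : X ⟶ X'') (h : i ≫ p = 0),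
    T X' ∧ F X'' ∧ (ShortComplex.mk i p h).ShortExact

variable {A : Type u} [Category.{v} A] [Abelian A]

/-- The objects `[X⁻¹ ⟶ X⁰]` with kernel in `F` and cokernel in `T`. -/
structure Tilt (τ : TorsionPair A) where
  Xm : A
  X0 : A
  d : Xm ⟶ X0
  ker_mem : τ.F (kernel d)
  coker_mem : τ.T (cokernel d)

variable {τ : TorsionPair A}

/-- A butterfly from `X` to `Y`. Both diagonals are complexes and the diagonal
`Y⁻¹ ⟶ E ⟶ X⁰` is short exact. -/
structure Butterfly (X Y : Tilt τ) where
  E : A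
  κ : X.Xm ⟶ E
  ι : Y.Xm ⟶ E
  σ : E ⟶ X.X0
  ρ : E ⟶ Y.X0
  κ_σ : κ ≫ σ = X.d
  ι_ρ : ι ≫ ρ = Y.d
  κ_ρ : κ ≫ ρ = 0
  ι_σ : ι ≫ σ = 0
  exact : (ShortComplex.mk ι σ ι_σ).ShortExact

namespace Butterfly

attribute [simp] κ_σ ι_ρ κ_ρ ι_σ

variable {X Y Z W : Tilt τ}

section
variable (P : Butterfly X Y) {U : A}
@[simp] lemma κ_σ_assoc (h : X.X0 ⟶ U) : P.κ ≫ P.σ ≫ h = X.d ≫ h := by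
  rw [← Category.assoc, κ_σ]
@[simp] lemma ι_ρ_assoc (h : Y.X0 ⟶ U) : P.ι ≫ P.ρ ≫ h = Y.d ≫ h := by
  rw [← Category.assoc, ι_ρ]
@[simp] lemma κ_ρ_assoc (h : Y.X0 ⟶ U) : P.κ ≫ P.ρ ≫ h = 0 := by
  rw [← Category.assoc, κ_ρ, zero_comp]
@[simp] lemma ι_σ_assoc (h : X.X0 ⟶ U) : P.ι ≫ P.σ ≫ h = 0 := by
  rw [← Category.assoc, ι_σ, zero_comp]
end

instance (P : Butterfly X Y) : Mono P.ι := P.exact.mono_f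
instance (P : Butterfly X Y) : Epi P.σ := P.exact.epi_g

/-- Factorization through `ι` of a map killed by `σ` -/
lemma exists_lift (P : Butterfly X Y) {U : A} (t : U ⟶ P.E) (h : t ≫ P.σ = 0) :
    ∃ y : U ⟶ Y.Xm, y ≫ P.ι = t :=
  ⟨P.exact.exact.lift t h, P.exact.exact.lift_f t h⟩

/-- Morphisms of butterflies. -/
structure IsHom (P Q : Butterfly X Y) (φ : P.E ⟶ Q.E) : Prop where
  κ : P.κ ≫ φ = Q.κ
  ι : P.ι ≫ φ = Q.ι
  σ : φ ≫ Q.σ = P.σ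
  ρ : φ ≫ Q.ρ = P.ρ

/-- Two butterflies are isomorphic. -/
def Rel (P Q : Butterfly X Y) : Prop := ∃ φ : P.E ≅ Q.E, IsHom P Q φ.hom

lemma IsHom.rel {P Q : Butterfly X Y} {φ : P.E ⟶ Q.E} (h : IsHom P Q φ) : Rel P Q := by
  let S : ShortComplex.mk P.ι P.σ P.ι_σ ⟶ ShortComplex.mk Q.ι Q.σ Q.ι_σ :=
    { τ₁ := 𝟙 _, τ₂ := φ, τ₃ := 𝟙 _, comm₁₂ := by simp [h.ι], comm₂₃ := by simp [h.σ] }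
  have h1 : IsIso S.τ₁ := inferInstanceAs (IsIso (𝟙 _))
  have h3 : IsIso S.τ₃ := inferInstanceAs (IsIso (𝟙 _))
  have : IsIso φ := ShortComplex.isIso₂_of_shortExact_of_isIso₁₃' S P.exact Q.exact h1 h3
  exact ⟨asIso φ, h⟩

lemma Rel.refl (P : Butterfly X Y) : Rel P P :=
  ⟨Iso.refl _, ⟨by simp, by simp, by simp, by simp⟩⟩

lemma Rel.symm {P Q : Butterfly X Y} : Rel P Q → Rel Q P := by
  rintro ⟨φ, h⟩
  exact ⟨φ.symm, ⟨by simp [← h.κ], by simp [← h.ι], by simp [← h.σ], by simp [← h.ρ]⟩⟩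

lemma Rel.trans {P Q R : Butterfly X Y} : Rel P Q → Rel Q R → Rel P R := by
  rintro ⟨φ, h⟩ ⟨ψ, k⟩
  exact ⟨φ ≪≫ ψ, ⟨by simp [← k.κ, ← h.κ], by simp [← k.ι, ← h.ι],
    by simp [k.σ, h.σ], by simp [k.ρ, h.ρ]⟩⟩

variable (X Y) in
/-- The isomorphism relation on butterflies. -/
def setoid : Setoid (Butterfly X Y) := ⟨Rel, Rel.refl, Rel.symm, Rel.trans⟩

/-- `(ι, κ') : Y⁻¹ ⟶ E ×_{Y⁰} F`. -/
noncomputable def diag (P : Butterfly X Y) (Q : Butterfly Y Z) : Y.Xm ⟶ pullback P.ρ Q.σ :=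
  pullback.lift P.ι Q.κ (by simp)

section
variable (P : Butterfly X Y) (Q : Butterfly Y Z)

@[simp] lemma diag_fst : diag P Q ≫ pullback.fst _ _ = P.ι := pullback.lift_fst ..
@[simp] lemma diag_fst_assoc {U : A} (h : P.E ⟶ U) :
    diag P Q ≫ pullback.fst _ _ ≫ h = P.ι ≫ h := by
  rw [← Category.assoc, diag_fst]
@[simp] lemma diag_snd : diag P Q ≫ pullback.snd _ _ = Q.κ := pullback.lift_snd ..
@[simp] lemma diag_snd_assoc {U : A} (h : Q.E ⟶ U) :
    diag P Q ≫ pullback.snd _ _ ≫ h = Q.κ ≫ h := by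
  rw [← Category.assoc, diag_snd]

/-- `(κ, 0)` -/
noncomputable def left : X.Xm ⟶ pullback P.ρ Q.σ := pullback.lift P.κ 0 (by simp)
/-- `(0, ι)` -/
noncomputable def right : Z.Xm ⟶ pullback P.ρ Q.σ := pullback.lift 0 Q.ι (by simp)

@[simp] lemma left_fst : left P Q ≫ pullback.fst _ _ = P.κ := pullback.lift_fst ..
@[simp] lemma left_fst_assoc {U : A} (h : P.E ⟶ U) :
    left P Q ≫ pullback.fst _ _ ≫ h = P.κ ≫ h := by
  rw [← Category.assoc, left_fst]
@[simp] lemma left_snd : left P Q ≫ pullback.snd _ _ = 0 := pullback.lift_snd ..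
@[simp] lemma left_snd_assoc {U : A} (h : Q.E ⟶ U) :
    left P Q ≫ pullback.snd _ _ ≫ h = 0 := by
  rw [← Category.assoc, left_snd, zero_comp]
@[simp] lemma right_fst : right P Q ≫ pullback.fst _ _ = 0 := pullback.lift_fst ..
@[simp] lemma right_fst_assoc {U : A} (h : P.E ⟶ U) :
    right P Q ≫ pullback.fst _ _ ≫ h = 0 := by
  rw [← Category.assoc, right_fst, zero_comp]
@[simp] lemma right_snd : right P Q ≫ pullback.snd _ _ = Q.ι := pullback.lift_snd ..
@[simp] lemma right_snd_assoc {U : A} (h : Q.E ⟶ U) :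
    right P Q ≫ pullback.snd _ _ ≫ h = Q.ι ≫ h := by
  rw [← Category.assoc, right_snd]

instance : Mono (diag P Q) := by
  have : Mono (diag P Q ≫ pullback.fst _ _) := by rw [diag_fst]; infer_instance
  exact mono_of_mono (diag P Q) (pullback.fst _ _)

lemma exists_of_fst_σ {U : A} (x : U ⟶ pullback P.ρ Q.σ) (hx : x ≫ pullback.fst _ _ ≫ P.σ = 0) :
    ∃ (y : U ⟶ Y.Xm) (z : U ⟶ Z.Xm), x = y ≫ diag P Q + z ≫ right P Q := by
  obtain ⟨y, hy⟩ := P.exists_lift (x ≫ pullback.fst _ _) (by simpa using hx)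
  obtain ⟨z, hz⟩ := Q.exists_lift ((x - y ≫ diag P Q) ≫ pullback.snd _ _) (by
    have h1 := congr($hy ≫ P.ρ)
    simp only [Category.assoc, ι_ρ] at h1
    simp only [Category.assoc, ← pullback.condition, Preadditive.sub_comp, ← h1, diag_fst_assoc,
      ι_ρ, sub_self])
  refine ⟨y, z, ?_⟩
  apply pullback.hom_ext
  · simp [hy]
  · simp [hz]

lemma exists_of_π_eq_zero {U : A} (x : U ⟶ pullback P.ρ Q.σ)
    (hx : x ≫ cokernel.π (diag P Q) = 0) : ∃ y : U ⟶ Y.Xm, x = y ≫ diag P Q := by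
  have h : (ShortComplex.mk (diag P Q) (cokernel.π (diag P Q)) (by simp)).Exact :=
    ShortComplex.exact_cokernel _
  have : Mono (ShortComplex.mk (diag P Q) (cokernel.π (diag P Q)) (by simp)).f := by
    dsimp; infer_instance
  exact ⟨h.lift x hx, (h.lift_f x hx).symm⟩

/-- The composite butterfly, with middle object `E ×_{Y⁰} F / Y⁻¹`. -/
noncomputable def comp : Butterfly X Z where
  E := cokernel (diag P Q)
  κ := left P Q ≫ cokernel.π _
  ι := right P Q ≫ cokernel.π _
  σ := cokernel.desc _ (pullback.fst _ _ ≫ P.σ) (by simp)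
  ρ := cokernel.desc _ (pullback.snd _ _ ≫ Q.ρ) (by simp)
  κ_σ := by simp
  ι_ρ := by simp
  κ_ρ := by simp
  ι_σ := by simp
  exact := by
    have hepi : Epi (pullback.fst P.ρ Q.σ ≫ P.σ) := epi_comp _ _
    have hm : Mono (right P Q ≫ cokernel.π (diag P Q)) := by
      refine Preadditive.mono_of_cancel_zero _ fun {U} t ht => ?_
      obtain ⟨y, hy⟩ := exists_of_π_eq_zero P Q (t ≫ right P Q) (by simpa using ht)
      have h1 : y ≫ P.ι = 0 := by
        simpa using (congr($hy ≫ pullback.fst _ _)).symm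
      have h2 : y = 0 := by rwa [← cancel_mono P.ι, zero_comp]
      have h3 : t ≫ Q.ι = 0 := by
        simpa [h2] using (congr($hy ≫ pullback.snd _ _))
      rwa [← cancel_mono Q.ι, zero_comp]
    refine { exact := ?_, mono_f := hm, epi_g := ?_ }
    · rw [ShortComplex.exact_iff_exact_up_to_refinements]
      intro U t ht
      obtain ⟨U', p, hp, x, hx⟩ := surjective_up_to_refinements_of_epi (cokernel.π (diag P Q)) t
      obtain ⟨y, z, rfl⟩ := exists_of_fst_σ P Q x (by
        have := congr(p ≫ $ht)
        dsimp at this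
        rw [← Category.assoc, hx] at this
        simpa using this)
      exact ⟨U', p, hp, z, by simp [hx]⟩
    · exact epi_of_epi_fac (cokernel.π_desc (diag P Q) (pullback.fst _ _ ≫ P.σ) (by simp))

/-- The quotient map `E ×_{Y⁰} F ⟶ E ×_{Y⁰} F / Y⁻¹`. -/
noncomputable def π : pullback P.ρ Q.σ ⟶ (comp P Q).E := cokernel.π (diag P Q)

instance : Epi (π P Q) := inferInstanceAs (Epi (cokernel.π (diag P Q)))

@[simp] lemma diag_π : diag P Q ≫ π P Q = 0 := cokernel.condition _
lemma comp_κ : (comp P Q).κ = left P Q ≫ π P Q := rfl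
lemma comp_ι : (comp P Q).ι = right P Q ≫ π P Q := rfl
@[simp] lemma π_σ : π P Q ≫ (comp P Q).σ = pullback.fst _ _ ≫ P.σ := cokernel.π_desc ..
@[simp] lemma π_ρ : π P Q ≫ (comp P Q).ρ = pullback.snd _ _ ≫ Q.ρ := cokernel.π_desc ..

lemma exists_of_π {U : A} (x : U ⟶ pullback P.ρ Q.σ) (hx : x ≫ π P Q = 0) :
    ∃ y : U ⟶ Y.Xm, x = y ≫ diag P Q := exists_of_π_eq_zero P Q x hx

lemma exists_desc {U : A} (b : pullback P.ρ Q.σ ⟶ U) (h : diag P Q ≫ b = 0) :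
    ∃ φ : (comp P Q).E ⟶ U, π P Q ≫ φ = b := ⟨cokernel.desc _ b h, cokernel.π_desc ..⟩

/-- A map out of the fibre product gives a map of butterflies out of the composite. -/
lemma comp_rel_of (R : Butterfly X Z) (b : pullback P.ρ Q.σ ⟶ R.E) (h : diag P Q ≫ b = 0)
    (hκ : left P Q ≫ b = R.κ) (hι : right P Q ≫ b = R.ι)
    (hσ : b ≫ R.σ = pullback.fst _ _ ≫ P.σ) (hρ : b ≫ R.ρ = pullback.snd _ _ ≫ Q.ρ) :
    Rel (comp P Q) R := by
  obtain ⟨φ, hφ⟩ := exists_desc P Q b h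
  refine IsHom.rel (φ := φ) ⟨?_, ?_, ?_, ?_⟩
  · rw [comp_κ, Category.assoc, hφ, hκ]
  · rw [comp_ι, Category.assoc, hφ, hι]
  · rw [← cancel_epi (π P Q), ← Category.assoc, hφ, hσ, π_σ]
  · rw [← cancel_epi (π P Q), ← Category.assoc, hφ, hρ, π_ρ]

end

lemma comp_rel {P P' : Butterfly X Y} {Q Q' : Butterfly Y Z} (h : Rel P P') (k : Rel Q Q') :
    Rel (comp P Q) (comp P' Q') := by
  obtain ⟨φ, h⟩ := h
  obtain ⟨ψ, k⟩ := k
  obtain ⟨b, b1, b2⟩ : ∃ b : pullback P.ρ Q.σ ⟶ pullback P'.ρ Q'.σ,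
      b ≫ pullback.fst _ _ = pullback.fst _ _ ≫ φ.hom ∧
      b ≫ pullback.snd _ _ = pullback.snd _ _ ≫ ψ.hom :=
    ⟨pullback.lift (pullback.fst _ _ ≫ φ.hom) (pullback.snd _ _ ≫ ψ.hom)
      (by rw [Category.assoc, Category.assoc, h.ρ, k.σ, pullback.condition]),
      pullback.lift_fst .., pullback.lift_snd ..⟩
  refine comp_rel_of P Q _ (b ≫ π P' Q') ?_ ?_ ?_ ?_ ?_
  · have : diag P Q ≫ b = diag P' Q' := by
      apply pullback.hom_ext <;> simp [b1, b2, h.ι, k.κ]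
    rw [← Category.assoc, this, diag_π]
  · have : left P Q ≫ b = left P' Q' := by
      apply pullback.hom_ext <;> simp [b1, b2, h.κ]
    rw [← Category.assoc, this, comp_κ]
  · have : right P Q ≫ b = right P' Q' := by
      apply pullback.hom_ext <;> simp [b1, b2, k.ι]
    rw [← Category.assoc, this, comp_ι]
  · rw [Category.assoc, π_σ, ← Category.assoc, b1, Category.assoc, h.σ]
  · rw [Category.assoc, π_ρ, ← Category.assoc, b2, Category.assoc, k.ρ]

lemma comp_assoc_rel (P : Butterfly X Y) (Q : Butterfly Y Z) (R : Butterfly Z W) :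
    Rel (comp (comp P Q) R) (comp P (comp Q R)) := by
  -- `V = E ×_{Y⁰} F ×_{Z⁰} G` with its two quotient maps
  let V := pullback (pullback.snd P.ρ Q.σ) (pullback.fst Q.ρ R.σ)
  let a : V ⟶ pullback P.ρ Q.σ := pullback.fst _ _
  let b : V ⟶ pullback Q.ρ R.σ := pullback.snd _ _
  have hab : a ≫ pullback.snd _ _ = b ≫ pullback.fst _ _ := pullback.condition
  have Vlift {U : A} (s : U ⟶ pullback P.ρ Q.σ) (t : U ⟶ pullback Q.ρ R.σ)
      (h : s ≫ pullback.snd _ _ = t ≫ pullback.fst _ _) : ∃ l : U ⟶ V, l ≫ a = s ∧ l ≫ b = t :=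
    ⟨pullback.lift s t h, pullback.lift_fst .., pullback.lift_snd ..⟩
  clear_value a b V
  -- the map to the left bracketing
  obtain ⟨p, p1, p2⟩ : ∃ p : V ⟶ pullback (comp P Q).ρ R.σ,
      p ≫ pullback.fst _ _ = a ≫ π P Q ∧ p ≫ pullback.snd _ _ = b ≫ pullback.snd _ _ :=
    ⟨pullback.lift (a ≫ π P Q) (b ≫ pullback.snd _ _) (by
      simp only [Category.assoc, π_ρ, ← pullback.condition]
      rw [← Category.assoc, hab, Category.assoc]), pullback.lift_fst .., pullback.lift_snd ..⟩
  obtain ⟨q, q1, q2⟩ : ∃ q : V ⟶ pullback P.ρ (comp Q R).σ,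
      q ≫ pullback.fst _ _ = a ≫ pullback.fst _ _ ∧ q ≫ pullback.snd _ _ = b ≫ π Q R :=
    ⟨pullback.lift (a ≫ pullback.fst _ _) (b ≫ π Q R) (by
      simp only [Category.assoc, π_σ, pullback.condition]
      rw [← Category.assoc, hab, Category.assoc]), pullback.lift_fst .., pullback.lift_snd ..⟩
  have hp : Epi p := by
    rw [epi_iff_surjective_up_to_refinements]
    intro U u
    obtain ⟨U', e, he, x, hx⟩ := surjective_up_to_refinements_of_epi (π P Q) (u ≫ pullback.fst _ _)
    have hy : (x ≫ pullback.snd _ _) ≫ Q.ρ = (e ≫ u ≫ pullback.snd _ _) ≫ R.σ := by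
      have := congr($hx ≫ (comp P Q).ρ)
      simp only [Category.assoc, π_ρ] at this
      simp only [Category.assoc, ← this, pullback.condition]
    obtain ⟨l, l1, l2⟩ := Vlift x (pullback.lift _ _ hy) (pullback.lift_fst ..).symm
    refine ⟨U', e, he, l, ?_⟩
    apply pullback.hom_ext
    · rw [Category.assoc, Category.assoc, hx, p1, ← Category.assoc, l1]
    · rw [Category.assoc, Category.assoc, p2, ← Category.assoc l, l2, pullback.lift_snd]
  have hker : kernel.ι p ≫ q ≫ π P (comp Q R) = 0 := by
    have hk := kernel.condition p
    generalize kernel.ι p = k at hk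
    have k1 : (k ≫ a) ≫ π P Q = 0 := by
      rw [Category.assoc, ← p1, ← Category.assoc, hk, zero_comp]
    have k2 : k ≫ b ≫ pullback.snd _ _ = 0 := by
      rw [← p2, ← Category.assoc, hk, zero_comp]
    obtain ⟨y, hy⟩ := exists_of_π P Q _ k1
    have hb : k ≫ b = y ≫ left Q R := by
      apply pullback.hom_ext
      · rw [Category.assoc, ← hab, ← Category.assoc, hy]; simp
      · rw [Category.assoc, k2]; simp
    have hq : k ≫ q = y ≫ diag P (comp Q R) := by
      apply pullback.hom_ext
      · rw [Category.assoc, q1, ← Category.assoc, hy]; simp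
      · rw [Category.assoc, q2, ← Category.assoc, hb]; simp [comp_κ]
    rw [← Category.assoc, hq, Category.assoc, diag_π, comp_zero]
  obtain ⟨φ, hφ⟩ : ∃ φ, p ≫ φ = q ≫ π P (comp Q R) :=
    ⟨Abelian.epiDesc p _ hker, Abelian.comp_epiDesc p _ hker⟩
  have key {U : A} (l : U ⟶ V) : (l ≫ p) ≫ φ = (l ≫ q) ≫ π P (comp Q R) := by
    rw [Category.assoc, hφ, Category.assoc]
  refine comp_rel_of (comp P Q) R _ φ ?_ ?_ ?_ ?_ ?_
  · obtain ⟨l, l1, l2⟩ := Vlift (right P Q) (diag Q R) (by simp)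
    have h1 : diag (comp P Q) R = l ≫ p := by
      apply pullback.hom_ext
      · rw [Category.assoc, p1, ← Category.assoc, l1, diag_fst, comp_ι]
      · rw [Category.assoc, p2, ← Category.assoc, l2, diag_snd, diag_snd]
    have h2 : l ≫ q = 0 := by
      apply pullback.hom_ext
      · rw [Category.assoc, q1, ← Category.assoc, l1, right_fst, zero_comp]
      · rw [Category.assoc, q2, ← Category.assoc, l2, diag_π, zero_comp]
    rw [h1, key, h2, zero_comp]
  · obtain ⟨l, l1, l2⟩ := Vlift (left P Q) (0 : _ ⟶ pullback Q.ρ R.σ) (by simp)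
    have h1 : left (comp P Q) R = l ≫ p := by
      apply pullback.hom_ext
      · rw [Category.assoc, p1, ← Category.assoc, l1, left_fst, comp_κ]
      · rw [Category.assoc, p2, ← Category.assoc, l2, left_snd, zero_comp]
    have h2 : l ≫ q = left P (comp Q R) := by
      apply pullback.hom_ext
      · rw [Category.assoc, q1, ← Category.assoc, l1, left_fst, left_fst]
      · rw [Category.assoc, q2, ← Category.assoc, l2, left_snd, zero_comp]
    rw [h1, key, h2, comp_κ]
  · obtain ⟨l, l1, l2⟩ := Vlift (0 : _ ⟶ pullback P.ρ Q.σ) (right Q R) (by simp)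
    have h1 : right (comp P Q) R = l ≫ p := by
      apply pullback.hom_ext
      · rw [Category.assoc, p1, ← Category.assoc, l1, right_fst, zero_comp]
      · rw [Category.assoc, p2, ← Category.assoc, l2, right_snd, right_snd]
    have h2 : l ≫ q = right P (comp Q R) := by
      apply pullback.hom_ext
      · rw [Category.assoc, q1, ← Category.assoc, l1, right_fst, zero_comp]
      · rw [Category.assoc, q2, ← Category.assoc, l2, right_snd, comp_ι]
    rw [h1, key, h2, comp_ι P (comp Q R)]
  · rw [← cancel_epi p, ← Category.assoc, hφ, Category.assoc, π_σ, ← Category.assoc, q1,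
      ← Category.assoc, p1, Category.assoc, Category.assoc, π_σ]
  · rw [← cancel_epi p, ← Category.assoc, hφ, Category.assoc, π_ρ, ← Category.assoc, q2,
      ← Category.assoc, p2, Category.assoc, Category.assoc, π_ρ]

end Butterfly

/-- A chain map `(f⁻¹, f⁰)`. -/
@[ext]
structure StrictHom (X Y : Tilt τ) where
  fm : X.Xm ⟶ Y.Xm
  f0 : X.X0 ⟶ Y.X0
  comm : X.d ≫ f0 = fm ≫ Y.d

namespace StrictHom
variable {X Y Z : Tilt τ}
lemma comm_assoc (f : StrictHom X Y) {U : A} (h : Y.X0 ⟶ U) :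
    X.d ≫ f.f0 ≫ h = f.fm ≫ Y.d ≫ h := by
  rw [← Category.assoc, f.comm, Category.assoc]
/-- The identity. -/
@[simps] def id (X : Tilt τ) : StrictHom X X := ⟨𝟙 _, 𝟙 _, by simp⟩
/-- The composition of chain maps. -/
@[simps] def comp (f : StrictHom X Y) (g : StrictHom Y Z) : StrictHom X Z :=
  ⟨f.fm ≫ g.fm, f.f0 ≫ g.f0, by simp [f.comm_assoc, g.comm]⟩

/-- The split butterfly attached to a chain map. -/
@[simps]
noncomputable def butterfly (f : StrictHom X Y) : Butterfly X Y where
  E := X.X0 ⊞ Y.Xm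
  κ := biprod.lift X.d (-f.fm)
  ι := biprod.inr
  σ := biprod.fst
  ρ := biprod.desc f.f0 Y.d
  κ_σ := by simp
  ι_ρ := by simp
  κ_ρ := by simp [biprod.lift_desc, f.comm]
  ι_σ := by simp
  exact := (ShortComplex.Splitting.mk (S := ShortComplex.mk (biprod.inr : Y.Xm ⟶ X.X0 ⊞ Y.Xm)
    biprod.fst (by simp)) biprod.snd biprod.inl (by simp) (by simp)
    (by dsimp; rw [add_comm]; exact biprod.total)).shortExact

end StrictHom

namespace Butterfly
variable {X Y Z W : Tilt τ}

/-- A splitting of the extension underlying a butterfly, inducing the chain map `f`. -/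
structure Splits (P : Butterfly X Y) (f : StrictHom X Y) (r : P.E ⟶ Y.Xm) (s : X.X0 ⟶ P.E) :
    Prop where
  ι_r : P.ι ≫ r = 𝟙 _
  s_σ : s ≫ P.σ = 𝟙 _
  total : P.σ ≫ s + r ≫ P.ι = 𝟙 _
  κ_r : P.κ ≫ r = -f.fm
  ρ_eq : P.ρ = P.σ ≫ f.f0 + r ≫ Y.d

lemma exists_splits (f : StrictHom X Y) : ∃ r s, Splits f.butterfly f r s :=
  ⟨biprod.snd, biprod.inl, ⟨biprod.inr_snd, biprod.inl_fst, biprod.total, biprod.lift_snd ..,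
    biprod.desc_eq⟩⟩

lemma Splits.s_r {P : Butterfly X Y} {f : StrictHom X Y} {r : P.E ⟶ Y.Xm} {s : X.X0 ⟶ P.E}
    (h : Splits P f r s) : s ≫ r = 0 := by
  have h1 := congr(s ≫ $(h.total) ≫ r)
  simp only [Preadditive.add_comp, Preadditive.comp_add, Category.assoc, h.ι_r, Category.comp_id,
    Category.id_comp] at h1
  rw [← Category.assoc, h.s_σ, Category.id_comp] at h1
  simpa using h1

lemma id_comp_rel (P : Butterfly X Y) : Rel (comp (StrictHom.id X).butterfly P) P := by
  obtain ⟨r, s, h⟩ := exists_splits (StrictHom.id X)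
  generalize (StrictHom.id X).butterfly = I at r s h
  refine comp_rel_of I P P (pullback.snd _ _ - (pullback.fst _ _ ≫ r) ≫ P.κ) ?_ ?_ ?_ ?_ ?_
  · simp [reassoc_of% h.ι_r]
  · simp [reassoc_of% h.κ_r]
  · simp
  · have := pullback.condition (f := I.ρ) (g := P.σ)
    simp [← this, h.ρ_eq]
  · simp

lemma comp_id_rel (P : Butterfly X Y) : Rel (comp P (StrictHom.id Y).butterfly) P := by
  obtain ⟨r, s, h⟩ := exists_splits (StrictHom.id Y)
  generalize (StrictHom.id Y).butterfly = I at r s h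
  refine comp_rel_of P I P (pullback.fst _ _ + (pullback.snd _ _ ≫ r) ≫ P.ι) ?_ ?_ ?_ ?_ ?_
  · simp [reassoc_of% h.κ_r]
  · simp
  · simp [reassoc_of% h.ι_r]
  · simp
  · have := pullback.condition (f := P.ρ) (g := I.σ)
    simp [this, h.ρ_eq]

lemma strict_comp_rel (f : StrictHom X Y) (g : StrictHom Y Z) :
    Rel (comp f.butterfly g.butterfly) (f.comp g).butterfly := by
  obtain ⟨r, s, h⟩ := exists_splits f
  obtain ⟨r', s', h'⟩ := exists_splits g
  obtain ⟨r'', s'', h''⟩ := exists_splits (f.comp g)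
  generalize f.butterfly = P at r s h
  generalize g.butterfly = Q at r' s' h'
  generalize (f.comp g).butterfly = R at r'' s'' h''
  have hκ : R.κ = X.d ≫ s'' - (f.fm ≫ g.fm) ≫ R.ι := by
    have := congr(R.κ ≫ $(h''.total))
    simp only [Preadditive.comp_add, κ_σ_assoc, reassoc_of% h''.κ_r] at this
    simpa [sub_eq_add_neg] using this.symm
  have hc := pullback.condition (f := P.ρ) (g := Q.σ)
  refine comp_rel_of P Q R ((pullback.fst _ _ ≫ P.σ) ≫ s'' +
    (pullback.snd _ _ ≫ r' + (pullback.fst _ _ ≫ r) ≫ g.fm) ≫ R.ι) ?_ ?_ ?_ ?_ ?_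
  · simp [reassoc_of% h'.κ_r, reassoc_of% h.ι_r]
  · simp [reassoc_of% h.κ_r, hκ, sub_eq_add_neg]
  · simp [reassoc_of% h'.ι_r]
  · simp [h''.s_σ]
  · have e1 : s'' ≫ R.ρ = f.f0 ≫ g.f0 := by
      rw [h''.ρ_eq]
      simp [reassoc_of% h''.s_σ, reassoc_of% h''.s_r]
    have e2 := congr($hc ≫ g.f0)
    simp only [h.ρ_eq, Preadditive.add_comp, Preadditive.comp_add, Category.assoc, g.comm] at e2
    simp only [h'.ρ_eq, Preadditive.add_comp, Preadditive.comp_add, Category.assoc, e1, ι_ρ, ← e2]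
    abel

end Butterfly

/-- The tilted category: morphisms are isomorphism classes of butterflies. -/
noncomputable instance : Category (Tilt τ) where
  Hom X Y := Quotient (Butterfly.setoid X Y)
  id X := Quotient.mk _ (StrictHom.id X).butterfly
  comp {X Y Z} f g := Quotient.map₂ (sa := Butterfly.setoid X Y) (sb := Butterfly.setoid Y Z)
    (sc := Butterfly.setoid X Z) Butterfly.comp
    (fun _ _ h _ _ k => Butterfly.comp_rel h k) f g
  id_comp := by
    rintro X Y ⟨P⟩
    exact Quotient.sound (Butterfly.id_comp_rel P)
  comp_id := by
    rintro X Y ⟨P⟩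
    exact Quotient.sound (Butterfly.comp_id_rel P)
  assoc := by
    rintro X Y Z W ⟨P⟩ ⟨Q⟩ ⟨R⟩
    exact Quotient.sound (Butterfly.comp_assoc_rel P Q R)

/-- The morphism of `Tilt τ` represented by a butterfly. -/
def Butterfly.toHom {X Y : Tilt τ} (P : Butterfly X Y) : X ⟶ Y := Quotient.mk (Butterfly.setoid X Y) P

/-- The morphism of `Tilt τ` given by a chain map. -/
noncomputable def StrictHom.toHom {X Y : Tilt τ} (f : StrictHom X Y) : X ⟶ Y := f.butterfly.toHom

lemma StrictHom.id_toHom (X : Tilt τ) : (StrictHom.id X).toHom = 𝟙 X := rfl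
lemma StrictHom.comp_toHom {X Y Z : Tilt τ} (f : StrictHom X Y) (g : StrictHom Y Z) :
    (f.comp g).toHom = f.toHom ≫ g.toHom :=
  (Quotient.sound (Butterfly.strict_comp_rel f g)).symm


namespace TorsionPair

variable (τ)

lemma F_iff (Y : A) : τ.F Y ↔ ∀ X : A, τ.T X → ∀ f : X ⟶ Y, f = 0 := by
  refine ⟨fun h X hX f => τ.hom_eq_zero hX h f, fun h => ?_⟩
  obtain ⟨X', X'', i, p, w, hT, hF, hS⟩ := τ.exists_shortExact Y
  have hp : IsIso p := by
    have : Mono p := hS.exact.mono_g (h _ hT i)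
    have : Epi p := hS.epi_g
    exact isIso_of_mono_of_epi p
  exact τ.F_iso.of_iso (asIso p).symm hF

lemma T_iff (X : A) : τ.T X ↔ ∀ Y : A, τ.F Y → ∀ f : X ⟶ Y, f = 0 := by
  refine ⟨fun h Y hY f => τ.hom_eq_zero h hY f, fun h => ?_⟩
  obtain ⟨X', X'', i, p, w, hT, hF, hS⟩ := τ.exists_shortExact X
  have hi : IsIso i := by
    have : Epi i := hS.exact.epi_f (h _ hF p)
    have : Mono i := hS.mono_f
    exact isIso_of_mono_of_epi i
  exact τ.T_iso.of_iso (asIso i) hT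

end TorsionPair

variable (A) in
/-- A decorated complex: a complex `E` with subobjects `Mⁿ ⊆ Eⁿ`. -/
structure Dec where
  E : CochainComplex A ℤ
  M : ∀ n : ℤ, Subobject (E.X n)

namespace Dec

/-- A chain map which respects the decorations. -/
@[ext]
structure Hom (D D' : Dec A) where
  hom : D.E ⟶ D'.E
  factors : ∀ n : ℤ, (D'.M n).Factors ((D.M n).arrow ≫ hom.f n)

lemma factors_comp {A : Type u} [Category.{v} A] {X Y : A} {M : Subobject X} {N : Subobject Y} {f : X ⟶ Y}
    (h : N.Factors (M.arrow ≫ f)) {U : A} {t : U ⟶ X} (ht : M.Factors t) : N.Factors (t ≫ f) := by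
  rw [← M.factorThru_arrow t ht, Category.assoc]
  exact Subobject.factors_of_factors_right _ h

@[simps]
instance : Category (Dec A) where
  Hom := Hom
  id D := ⟨𝟙 _, fun n => by
    rw [HomologicalComplex.id_f, Category.comp_id]; exact Subobject.factors_self _⟩
  comp f g := ⟨f.hom ≫ g.hom, fun n => by
    rw [HomologicalComplex.comp_f, ← Category.assoc]
    exact factors_comp (g.factors n) (f.factors n)⟩

@[ext]
lemma hom_ext {D D' : Dec A} {f g : D ⟶ D'} (h : f.hom = g.hom) : f = g := Hom.ext h

variable (A) in
/-- Forget the decoration. -/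
@[simps]
def forget : Dec A ⥤ CochainComplex A ℤ where
  obj D := D.E
  map f := f.hom

instance : (forget A).Faithful where
  map_injective h := hom_ext h

/-- An isomorphism of the complexes which respects the decorations in both directions. -/
@[simps]
def mkIso {D D' : Dec A} (e : D.E ≅ D'.E)
    (h : ∀ n, (D'.M n).Factors ((D.M n).arrow ≫ e.hom.f n))
    (h' : ∀ n, (D.M n).Factors ((D'.M n).arrow ≫ e.inv.f n)) : D ≅ D' where
  hom := ⟨e.hom, h⟩
  inv := ⟨e.inv, h'⟩
  hom_inv_id := hom_ext e.hom_inv_id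
  inv_hom_id := hom_ext e.inv_hom_id

/-- The shift `(E[a], M[a])`. -/
@[simps]
noncomputable def shiftObj (D : Dec A) (a : ℤ) : Dec A where
  E := (shiftFunctor (CochainComplex A ℤ) a).obj D.E
  M n := D.M (n + a)

variable (A) in
/-- The shift functor. -/
@[simps]
noncomputable def shiftBy (a : ℤ) : Dec A ⥤ Dec A where
  obj D := D.shiftObj a
  map f := ⟨f.hom⟦a⟧', fun n => f.factors (n + a)⟩
  map_id _ := hom_ext ((shiftFunctor (CochainComplex A ℤ) a).map_id _)
  map_comp _ _ := hom_ext ((shiftFunctor (CochainComplex A ℤ) a).map_comp _ _)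

lemma factors_XIsoOfEq (D : Dec A) {p q : ℤ} (h : p = q) :
    (D.M q).Factors ((D.M p).arrow ≫ (D.E.XIsoOfEq h).hom) := by
  subst h
  simpa using Subobject.factors_self _

variable (A) in
/-- The shift by zero is the identity. -/
noncomputable def shiftZero : shiftBy A 0 ≅ 𝟭 (Dec A) :=
  NatIso.ofComponents
    (fun D => mkIso ((shiftFunctorZero (CochainComplex A ℤ) ℤ).app D.E)
      (fun n => by
        have := CochainComplex.shiftFunctorZero_hom_app_f D.E n
        dsimp at this ⊢
        rw [this]
        exact D.factors_XIsoOfEq (by simp))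
      (fun n => by
        have := CochainComplex.shiftFunctorZero_inv_app_f D.E n
        dsimp at this ⊢
        rw [this]
        exact D.factors_XIsoOfEq (by simp)))
    (fun f => hom_ext ((shiftFunctorZero (CochainComplex A ℤ) ℤ).hom.naturality f.hom))

variable (A) in
/-- The additivity of the shift. -/
noncomputable def shiftAdd (a b : ℤ) : shiftBy A (a + b) ≅ shiftBy A a ⋙ shiftBy A b :=
  NatIso.ofComponents
    (fun D => mkIso ((shiftFunctorAdd (CochainComplex A ℤ) a b).app D.E)
      (fun n => by
        have := CochainComplex.shiftFunctorAdd_hom_app_f D.E a b n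
        dsimp at this ⊢
        rw [this]
        exact D.factors_XIsoOfEq (by ring))
      (fun n => by
        have := CochainComplex.shiftFunctorAdd_inv_app_f D.E a b n
        dsimp at this ⊢
        rw [this]
        exact D.factors_XIsoOfEq (by ring)))
    (fun f => hom_ext ((shiftFunctorAdd (CochainComplex A ℤ) a b).hom.naturality f.hom))

noncomputable instance : HasShift (Dec A) ℤ := hasShiftMk _ _
  { F := shiftBy A
    zero := shiftZero A
    add := shiftAdd A
    assoc_hom_app := fun a b c D => by
      apply (forget A).map_injective
      have := shiftFunctorAdd_assoc_hom_app a b c D.E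
      simp only [shiftFunctorAdd', Iso.trans_hom, NatTrans.comp_app, eqToIso.hom, eqToHom_app,
        Category.assoc] at this
      simp only [Functor.map_comp, eqToHom_map]
      exact this
    zero_add_hom_app := fun a D => by
      apply (forget A).map_injective
      have := shiftFunctorAdd_zero_add_hom_app a D.E
      simp only [Functor.map_comp, eqToHom_map]
      exact this
    add_zero_hom_app := fun a D => by
      apply (forget A).map_injective
      have := shiftFunctorAdd_add_zero_hom_app a D.E
      simp only [Functor.map_comp, eqToHom_map]
      exact this }


section Compatible

/-- The map `Mⁿ ⟶ Eⁿ⁺¹ / Mⁿ⁺¹` induced by the differential; `H⁻¹ⁿ` is its kernel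
and `H⁰ⁿ` is its cokernel. -/
noncomputable def mid (D : Dec A) (n : ℤ) :
    (D.M n : A) ⟶ cokernel (D.M (n + 1)).arrow :=
  (D.M n).arrow ≫ D.E.d n (n + 1) ≫ cokernel.π (D.M (n + 1)).arrow

/-- The decorated complexes compatible with the torsion pair: `H⁻¹ⁿ` is in `F` and `H⁰ⁿ` is in
`T`. -/
def compat (τ : TorsionPair A) : ObjectProperty (Dec A) := fun D =>
  ∀ n : ℤ, τ.F (kernel (D.mid n)) ∧ τ.T (cokernel (D.mid n))

lemma factors_iff_π {X U : A} (M : Subobject X) (t : U ⟶ X) :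
    M.Factors t ↔ t ≫ cokernel.π M.arrow = 0 := by
  constructor
  · intro h
    rw [← M.factorThru_arrow t h, Category.assoc, cokernel.condition, comp_zero]
  · intro h
    have := Abelian.monoLift_comp M.arrow t h
    rw [← this]
    exact Subobject.factors_comp_arrow _

lemma kernel_mid_iff (τ : TorsionPair A) (D : Dec A) (n : ℤ) :
    τ.F (kernel (D.mid n)) ↔ ∀ U : A, τ.T U → ∀ t : U ⟶ D.E.X n, (D.M n).Factors t →
      (D.M (n + 1)).Factors (t ≫ D.E.d n (n + 1)) → t = 0 := by
  rw [τ.F_iff]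
  refine forall₂_congr fun U hU => ⟨fun h t h1 h2 => ?_, fun h f => ?_⟩
  · rw [factors_iff_π, Category.assoc] at h2
    have h3 := h (kernel.lift (D.mid n) ((D.M n).factorThru t h1) (by
      rw [mid, Subobject.factorThru_arrow_assoc, h2]))
    rw [← (D.M n).factorThru_arrow t h1, ← kernel.lift_ι (D.mid n) ((D.M n).factorThru t h1) (by
      rw [mid, Subobject.factorThru_arrow_assoc, h2]), h3]
    simp
  · have := h (f ≫ kernel.ι (D.mid n) ≫ (D.M n).arrow)
      (by rw [← Category.assoc]; exact Subobject.factors_comp_arrow _) (by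
        rw [factors_iff_π]
        have : kernel.ι (D.mid n) ≫ (D.M n).arrow ≫ D.E.d n (n + 1) ≫
          cokernel.π (D.M (n + 1)).arrow = 0 := kernel.condition (D.mid n)
        simp only [Category.assoc]
        rw [this, comp_zero])
    rwa [← cancel_mono (kernel.ι (D.mid n) ≫ (D.M n).arrow), zero_comp]

lemma cokernel_mid_iff (τ : TorsionPair A) (D : Dec A) (n : ℤ) :
    τ.T (cokernel (D.mid n)) ↔ ∀ G : A, τ.F G → ∀ s : D.E.X (n + 1) ⟶ G,
      (D.M (n + 1)).arrow ≫ s = 0 → (D.M n).arrow ≫ D.E.d n (n + 1) ≫ s = 0 → s = 0 := by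
  rw [τ.T_iff]
  refine forall₂_congr fun G hG => ⟨fun h s h1 h2 => ?_, fun h f => ?_⟩
  · have e : D.mid n ≫ cokernel.desc _ s h1 = 0 := by
      rw [mid, Category.assoc, Category.assoc, cokernel.π_desc, h2]
    have h3 := h (cokernel.desc (D.mid n) (cokernel.desc _ s h1) e)
    rw [← cokernel.π_desc _ s h1, ← cokernel.π_desc (D.mid n) (cokernel.desc _ s h1) e, h3]
    simp
  · have := h (cokernel.π (D.M (n + 1)).arrow ≫ cokernel.π (D.mid n) ≫ f)
      (by rw [← Category.assoc, cokernel.condition, zero_comp]) (by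
        have : ((D.M n).arrow ≫ D.E.d n (n + 1) ≫ cokernel.π (D.M (n + 1)).arrow) ≫
          cokernel.π (D.mid n) = 0 := cokernel.condition (D.mid n)
        simp only [Category.assoc] at this
        simp only [reassoc_of% this, zero_comp])
    rwa [← cancel_epi (cokernel.π (D.mid n)), comp_zero,
      ← cancel_epi (cokernel.π (D.M (n + 1)).arrow), comp_zero]

variable {D D' : Dec A}

lemma compat.eq_zero_left (h : compat τ D) {i j : ℤ} (hij : i + 1 = j) {U : A} (hU : τ.T U)
    (t : U ⟶ D.E.X i) (h1 : (D.M i).Factors t) (h2 : (D.M j).Factors (t ≫ D.E.d i j)) : t = 0 := by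
  subst hij
  exact (kernel_mid_iff τ D i).1 (h i).1 U hU t h1 h2

lemma compat.eq_zero_right (h : compat τ D) {i j : ℤ} (hij : i + 1 = j) {G : A} (hG : τ.F G)
    (s : D.E.X j ⟶ G) (h1 : (D.M j).arrow ≫ s = 0)
    (h2 : (D.M i).arrow ≫ D.E.d i j ≫ s = 0) : s = 0 := by
  subst hij
  exact (cokernel_mid_iff τ D i).1 (h i).2 G hG s h1 h2

lemma factors_neg {A : Type u} [Category.{v} A] [Preadditive A] {U X : A} {M : Subobject X}
    {t : U ⟶ X} (h : M.Factors t) : M.Factors (-t) := by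
  have := Subobject.factors_of_factors_right (-𝟙 U) h
  simpa using this

lemma factors_comp_units_smul {A : Type u} [Category.{v} A] [Preadditive A] {U X Y : A}
    {M : Subobject Y} (t : U ⟶ X) (d : X ⟶ Y) (e : ℤˣ) (h : M.Factors (t ≫ (e • d))) :
    M.Factors (t ≫ d) := by
  obtain rfl | rfl := Int.units_eq_one_or e
  · simpa using h
  · simpa [Units.smul_def] using factors_neg h

lemma comp_units_smul_comp_eq_zero {A : Type u} [Category.{v} A] [Preadditive A] {U X Y Z : A}
    (t : U ⟶ X) (d : X ⟶ Y) (s : Y ⟶ Z) (e : ℤˣ) (h : t ≫ (e • d) ≫ s = 0) : t ≫ d ≫ s = 0 := by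
  obtain rfl | rfl := Int.units_eq_one_or e
  · simpa using h
  · simpa [Units.smul_def] using h

lemma compat_shift (h : compat τ D) (a : ℤ) : compat τ (D.shiftObj a) := by
  intro n
  rw [kernel_mid_iff, cokernel_mid_iff]
  constructor
  · intro U hU t h1 h2
    exact h.eq_zero_left (j := n + 1 + a) (by ring) hU t h1
      (factors_comp_units_smul (X := D.E.X (n + a)) t _ a.negOnePow h2)
  · intro G hG s h1 h2
    exact h.eq_zero_right (i := n + a) (by ring) hG s h1
      (comp_units_smul_comp_eq_zero (X := D.E.X (n + a)) (Y := D.E.X (n + 1 + a)) _ _ s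
        a.negOnePow h2)

instance (τ : TorsionPair A) : (compat τ).IsStableUnderShift ℤ where
  isStableUnderShiftBy a := ⟨fun _ h => compat_shift h a⟩

end Compatible

section Cone

open CochainComplex HomComplex

section
variable {K L : CochainComplex A ℤ} (φ : K ⟶ L) (M : ∀ n, Subobject (K.X n))
  (N : ∀ n, Subobject (L.X n))

/-- The direct sum decoration `Mⁿ⁺¹ ⊕ Nⁿ ⊆ Kⁿ⁺¹ ⊕ Lⁿ` on the mapping cone: the subobject of those
elements whose first coordinate is in `Mⁿ⁺¹` and whose second coordinate is in `Nⁿ`. -/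
noncomputable def coneDecoration (n : ℤ) : Subobject ((mappingCone φ).X n) :=
  (Subobject.pullback ((mappingCone.fst φ).1.v n (n + 1) rfl)).obj (M (n + 1)) ⊓
    (Subobject.pullback ((mappingCone.snd φ).v n n (add_zero n))).obj (N n)

lemma coneDecoration_factors_iff (n m : ℤ) (h : n + 1 = m) {U : A}
    (t : U ⟶ (mappingCone φ).X n) :
    (coneDecoration φ M N n).Factors t ↔
      (M m).Factors (t ≫ (mappingCone.fst φ).1.v n m h) ∧
      (N n).Factors (t ≫ (mappingCone.snd φ).v n n (add_zero n)) := by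
  subst h
  rw [coneDecoration, Subobject.inf_factors, pullback_factors_iff, pullback_factors_iff]

lemma inr_factors (n : ℤ) :
    (coneDecoration φ M N n).Factors ((N n).arrow ≫ (mappingCone.inr φ).f n) := by
  rw [coneDecoration_factors_iff φ M N n _ rfl]
  simpa [Subobject.factors_zero] using Subobject.factors_self _

lemma inl_factors (n m : ℤ) (h : m + (-1) = n) :
    (coneDecoration φ M N n).Factors ((M m).arrow ≫ (mappingCone.inl φ).v m n h) := by
  rw [coneDecoration_factors_iff φ M N n m (by lia)]
  simpa [Subobject.factors_zero] using Subobject.factors_self _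

lemma mor₃_factors (n : ℤ) : (M (n + 1)).Factors
    ((coneDecoration φ M N n).arrow ≫ (mappingCone.triangle φ).mor₃.f n) := by
  have h : (mappingCone.triangle φ).mor₃.f n =
      -(mappingCone.fst φ).1.v n (n + 1) rfl := by
    have e1 : (mappingCone.inl φ).v (n + 1) n (by lia) ≫
        (-(mappingCone.fst φ).1.v n (n + 1) rfl) = -𝟙 _ := by simp
    have e2 : (mappingCone.inr φ).f n ≫ (-(mappingCone.fst φ).1.v n (n + 1) rfl) = 0 := by simp
    apply (mappingCone.ext_from_iff φ (n + 1) n rfl _ _).2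
    constructor
    · refine (mappingCone.inl_v_triangle_mor₃_f φ (n + 1) n (by lia)).trans ?_
      simp only [shiftFunctorObjXIso, HomologicalComplex.XIsoOfEq_rfl, Iso.refl_inv]
      exact e1.symm
    · exact (mappingCone.inr_f_triangle_mor₃_f φ n).trans e2.symm
  rw [h]
  have := factors_neg (((coneDecoration_factors_iff φ M N n _ rfl _).1 (Subobject.factors_self _)).1)
  rwa [← Preadditive.comp_neg] at this

end

/-- The decorated cone. -/
noncomputable def cone {D D' : Dec A} (f : D ⟶ D') : Dec A where
  E := mappingCone f.hom
  M := coneDecoration f.hom D.M D'.M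

/-- The inclusion of the target into the decorated cone. -/
noncomputable def coneInr {D D' : Dec A} (f : D ⟶ D') : D' ⟶ cone f where
  hom := mappingCone.inr f.hom
  factors := inr_factors f.hom D.M D'.M

/-- The map from the decorated cone to the shift of the source. -/
noncomputable def coneδ {D D' : Dec A} (f : D ⟶ D') : cone f ⟶ D⟦(1 : ℤ)⟧ where
  hom := (mappingCone.triangle f.hom).mor₃
  factors := mor₃_factors f.hom D.M D'.M

lemma compat_cone {D D' : Dec A} (f : D ⟶ D') (h : compat τ D) (h' : compat τ D') :
    compat τ (cone f) := by
  intro n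
  rw [kernel_mid_iff, cokernel_mid_iff]
  constructor
  · intro U hU t h1 h2
    change U ⟶ (mappingCone f.hom).X n at t
    change (coneDecoration f.hom D.M D'.M n).Factors t at h1
    change (coneDecoration f.hom D.M D'.M (n + 1)).Factors
      (t ≫ (mappingCone f.hom).d n (n + 1)) at h2
    change t = 0
    rw [coneDecoration_factors_iff _ _ _ n (n + 1) rfl] at h1
    rw [coneDecoration_factors_iff _ _ _ (n + 1) (n + 2) (by lia)] at h2
    have e1 : t ≫ (mappingCone.fst f.hom).1.v n (n + 1) rfl = 0 := by
      refine h.eq_zero_left (j := n + 2) (by lia) hU _ h1.1 ?_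
      have := factors_neg h2.1
      rw [Category.assoc, mappingCone.d_fst_v f.hom n (n + 1) (n + 2) rfl (by lia)] at this
      simpa using this
    have e2 : t ≫ (mappingCone.snd f.hom).v n n (add_zero n) = 0 := by
      refine h'.eq_zero_left (j := n + 1) rfl hU _ h1.2 ?_
      have := h2.2
      rw [Category.assoc, mappingCone.d_snd_v f.hom n (n + 1) rfl, Preadditive.comp_add,
        ← Category.assoc, e1, zero_comp, zero_add] at this
      simpa using this
    rw [mappingCone.ext_to_iff _ n (n + 1) rfl, e1, e2]
    simp
  · intro G hG s h1 h2
    change (mappingCone f.hom).X (n + 1) ⟶ G at s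
    change (coneDecoration f.hom D.M D'.M (n + 1)).arrow ≫ s = 0 at h1
    change (coneDecoration f.hom D.M D'.M n).arrow ≫ (mappingCone f.hom).d n (n + 1) ≫ s = 0 at h2
    change s = 0
    have g1 {U : A} (t : U ⟶ _) (ht : (coneDecoration f.hom D.M D'.M (n + 1)).Factors t) :
        t ≫ s = 0 := by
      rw [← Subobject.factorThru_arrow _ t ht, Category.assoc, h1, comp_zero]
    have g2 {U : A} (t : U ⟶ _) (ht : (coneDecoration f.hom D.M D'.M n).Factors t) :
        t ≫ (mappingCone f.hom).d n (n + 1) ≫ s = 0 := by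
      rw [← Subobject.factorThru_arrow _ t ht, Category.assoc, h2, comp_zero]
    have e2 : (mappingCone.inr f.hom).f (n + 1) ≫ s = 0 := by
      refine h'.eq_zero_right (i := n) rfl hG _ ?_ ?_
      · have := g1 _ (inr_factors f.hom D.M D'.M (n + 1))
        simpa using this
      · have := g2 _ (inr_factors f.hom D.M D'.M n)
        simpa using this
    have e1 : (mappingCone.inl f.hom).v (n + 2) (n + 1) (by lia) ≫ s = 0 := by
      refine h.eq_zero_right (i := n + 1) (by lia) hG _ ?_ ?_
      · have := g1 _ (inl_factors f.hom D.M D'.M (n + 1) (n + 2) (by lia))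
        simpa using this
      · have := g2 _ (inl_factors f.hom D.M D'.M n (n + 1) (by lia))
        rw [Category.assoc, ← Category.assoc _ _ s,
          mappingCone.inl_v_d f.hom (n + 1) n (n + 2) (by lia) (by lia)] at this
        simpa [e2] using this
    rw [mappingCone.ext_from_iff _ (n + 2) (n + 1) (by lia), e1, e2]
    simp

end Cone

end Dec

/-- The three boundedness conditions: above, below, on both sides. -/
inductive Bdd | minus | plus | bounded

/-- A property of degrees holds far out on the respective side(s). -/
def Bdd.Holds (b : Bdd) (p : ℤ → Prop) : Prop :=
  match b with
  | minus => ∃ N : ℤ, ∀ n, N < n → p n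
  | plus => ∃ N : ℤ, ∀ n, n < N → p n
  | bounded => (∃ N : ℤ, ∀ n, N < n → p n) ∧ ∃ N : ℤ, ∀ n, n < N → p n

lemma Bdd.Holds.mono {b : Bdd} {p q r : ℤ → Prop} (hp : b.Holds p) (hq : b.Holds q) (a c : ℤ)
    (h : ∀ n, p (n + a) → q (n + c) → r n) : b.Holds r := by
  have above : (∃ N : ℤ, ∀ n, N < n → p n) → (∃ N : ℤ, ∀ n, N < n → q n) →
      ∃ N : ℤ, ∀ n, N < n → r n := by
    rintro ⟨N, hN⟩ ⟨N', hN'⟩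
    exact ⟨max (N - a) (N' - c), fun n hn => h n (hN _ (by omega)) (hN' _ (by omega))⟩
  have below : (∃ N : ℤ, ∀ n, n < N → p n) → (∃ N : ℤ, ∀ n, n < N → q n) →
      ∃ N : ℤ, ∀ n, n < N → r n := by
    rintro ⟨N, hN⟩ ⟨N', hN'⟩
    exact ⟨min (N - a) (N' - c), fun n hn => h n (hN _ (by omega)) (hN' _ (by omega))⟩
  cases b with
  | minus => exact above hp hq
  | plus => exact below hp hq
  | bounded => exact ⟨above hp.1 hq.1, below hp.2 hq.2⟩

namespace Dec

variable (A) in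
/-- The decorated complexes which are bounded (above, below, on both sides). -/
def isBdd (b : Bdd) : ObjectProperty (Dec A) := fun D => b.Holds fun n => IsZero (D.E.X n)

instance (b : Bdd) : (isBdd A b).IsStableUnderShift ℤ where
  isStableUnderShiftBy a := ⟨fun _ h => Bdd.Holds.mono (b := b) h h a a fun _ h _ => h⟩

/-- A class of decorated complexes is closed under decorated cones. -/
class ConeClosed (P : ObjectProperty (Dec A)) : Prop where
  cone_mem : ∀ {D D' : Dec A} (f : D ⟶ D'), P D → P D' → P (cone f)

instance (τ : TorsionPair A) : ConeClosed (compat τ) := ⟨compat_cone⟩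

instance (b : Bdd) : ConeClosed (isBdd A b) where
  cone_mem f h h' := Bdd.Holds.mono (b := b) h h' 1 0 fun n h h' =>
    (CochainComplex.mappingCone.isZero_X_iff f.hom n).2 ⟨h, by simpa using h'⟩

instance (P P' : ObjectProperty (Dec A)) [ConeClosed P] [ConeClosed P'] :
    ConeClosed (P ⊓ P') where
  cone_mem f h h' := ⟨ConeClosed.cone_mem f h.1 h'.1, ConeClosed.cone_mem f h.2 h'.2⟩

/-- A homotopy between maps of decorated complexes which respects the decorations. -/
def Homotopic {D D' : Dec A} (f g : D ⟶ D') : Prop :=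
  ∃ h : Homotopy f.hom g.hom, ∀ i j : ℤ, (D'.M j).Factors ((D.M i).arrow ≫ h.hom i j)

section Localization

variable (P : ObjectProperty (Dec A))

/-- The quasi-isomorphisms: the maps which are quasi-isomorphisms of the complexes in `A`. -/
def qis : MorphismProperty P.FullSubcategory :=
  (HomologicalComplex.quasiIso A (ComplexShape.up ℤ)).inverseImage (P.ι ⋙ forget A)

variable [P.IsStableUnderShift ℤ]

instance : (qis P).IsCompatibleWithShift ℤ where
  condition a := by
    ext X Y f
    have e : Arrow.mk ((P.ι ⋙ forget A).map (f⟦a⟧')) ≅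
        Arrow.mk (((P.ι ⋙ forget A).map f)⟦a⟧') :=
      Arrow.isoMk ((forget A).mapIso ((P.ι.commShiftIso a).app X))
        ((forget A).mapIso ((P.ι.commShiftIso a).app Y))
        (congr((forget A).map $((P.ι.commShiftIso a).hom.naturality f)).symm)
    exact ((HomologicalComplex.quasiIso A (ComplexShape.up ℤ)).arrow_mk_iso_iff e).trans
      (CochainComplex.quasiIso_shift_iff _ a)

/-- The localization of a category of decorated complexes at the quasi-isomorphisms. -/
abbrev Loc : Type _ := (qis P).Localization

/-- The localization functor. -/
noncomputable abbrev locQ : P.FullSubcategory ⥤ Loc P := (qis P).Q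

variable [ConeClosed P]

/-- The triangle `X ⟶ Y ⟶ cone f ⟶ X⟦1⟧`. -/
@[simps!]
noncomputable def coneTriangle {X Y : P.FullSubcategory} (f : X ⟶ Y) :
    Pretriangulated.Triangle P.FullSubcategory :=
  Pretriangulated.Triangle.mk (Z := ⟨cone f.hom, ConeClosed.cone_mem _ X.2 Y.2⟩) f
    (ObjectProperty.homMk (coneInr f.hom))
    (ObjectProperty.homMk (coneδ f.hom ≫ (P.ι.commShiftIso (1 : ℤ)).inv.app X))

/-- The triangles in the localization which are isomorphic to images of triangles
attached to decorated cones. -/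
def coneTriangles : Set (Pretriangulated.Triangle (Loc P)) :=
  {T | ∃ (X Y : P.FullSubcategory) (f : X ⟶ Y),
    Nonempty (T ≅ (locQ P).mapTriangle.obj (coneTriangle P f))}

end Localization

end Dec

/-- The structure of a triangulated category on a category with shift, with `Δ` as the class of
distinguished triangles. -/
structure TriangulatedStructure (C : Type*) [Category C] [HasShift C ℤ]
    (Δ : Set (Pretriangulated.Triangle C)) where
  preadditive : Preadditive C
  hasZeroObject : HasZeroObject C
  shift_additive : ∀ n : ℤ, (shiftFunctor C n).Additive
  pretriangulated : Pretriangulated C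
  isTriangulated : IsTriangulated C
  distinguished_eq : pretriangulated.distinguishedTriangles = Δ

/-- Let `ℓ : S ⥤ D` be a functor to a triangulated category `D` and let `T` be a functor from `S`
to a category of decorated complexes. The functor `T` induces a triangle equivalence between `D`
and the localization at the quasi-isomorphisms: homotopic maps become equal in the localization,
the decorated cones make the localization a triangulated category, and there is a triangle
equivalence `Φ` such that the square formed by `ℓ`, `Φ`, `T` and the localization functor
commutes. -/
def InducesTriangleEquivalence {S D : Type*} [Category S] [Category D] [HasShift D ℤ]
    [Preadditive D] [HasZeroObject D] [∀ n : ℤ, (shiftFunctor D n).Additive] [Pretriangulated D]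
    (ℓ : S ⥤ D) (P : ObjectProperty (Dec A)) [P.IsStableUnderShift ℤ] [Dec.ConeClosed P]
    (T : S ⥤ P.FullSubcategory) : Prop :=
  (∀ {X Y : P.FullSubcategory} (f g : X ⟶ Y), Dec.Homotopic f.hom g.hom →
    (Dec.locQ P).map f = (Dec.locQ P).map g) ∧
  ∃ (t : TriangulatedStructure (Dec.Loc P) (Dec.coneTriangles P)) (Φ : D ⥤ Dec.Loc P),
    Φ.IsEquivalence ∧ Nonempty (ℓ ⋙ Φ ≅ T ⋙ Dec.locQ P) ∧
    letI := t.preadditive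
    letI := t.hasZeroObject
    letI := t.shift_additive
    letI := t.pretriangulated
    ∃ _ : Φ.CommShift ℤ, Φ.IsTriangulated

/-- An object both of whose components are zero in `A`. -/
def Tilt.IsStrictlyZero (X : Tilt τ) : Prop := IsZero X.Xm ∧ IsZero X.X0

lemma Butterfly.isZero_E {X Y : Tilt τ} (P : Butterfly X Y) (hX : IsZero X.X0)
    (hY : IsZero Y.Xm) : IsZero P.E := by
  rw [IsZero.iff_id_eq_zero]
  obtain ⟨y, hy⟩ := P.exists_lift (𝟙 P.E) (hX.eq_of_tgt _ _)
  rw [← hy, hY.eq_of_tgt y 0, zero_comp]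

lemma Tilt.IsStrictlyZero.isZero [HasZeroMorphisms (Tilt τ)] {X : Tilt τ}
    (h : X.IsStrictlyZero) : IsZero X := by
  rw [IsZero.iff_id_eq_zero]
  have key : ∀ f g : X ⟶ X, f = g := by
    rintro ⟨P⟩ ⟨Q⟩
    have hP := P.isZero_E h.2 h.1
    have hQ := Q.isZero_E h.2 h.1
    exact Quotient.sound (Butterfly.IsHom.rel (φ := 0)
      ⟨hQ.eq_of_tgt _ _, hQ.eq_of_tgt _ _, hP.eq_of_src _ _, hP.eq_of_src _ _⟩)
  exact key _ _

section Strict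

variable (τ) [Abelian (Tilt τ)]

/-- Complexes over `Tilt τ` with strict maps. -/
structure ChSt where
  /-- the complex over `Tilt τ` -/
  cx : CochainComplex (Tilt τ) ℤ

namespace ChSt

variable {τ}

/-- A strict map: chain maps between the components which commute with the differentials
in the category `Tilt τ`. -/
@[ext]
structure Hom (X Y : ChSt τ) where
  f : ∀ n : ℤ, StrictHom (X.cx.X n) (Y.cx.X n)
  comm : ∀ i j : ℤ, (f i).toHom ≫ Y.cx.d i j = X.cx.d i j ≫ (f j).toHom

instance : Category (ChSt τ) where
  Hom := Hom
  id X := ⟨fun n => StrictHom.id _, fun i j => by simp [StrictHom.id_toHom]⟩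
  comp f g := ⟨fun n => (f.f n).comp (g.f n), fun i j => by
    simp only [StrictHom.comp_toHom, Category.assoc, g.comm]
    rw [← Category.assoc, f.comm, Category.assoc]⟩
  id_comp f := Hom.ext (funext fun n => StrictHom.ext (Category.id_comp _) (Category.id_comp _))
  comp_id f := Hom.ext (funext fun n => StrictHom.ext (Category.comp_id _) (Category.comp_id _))
  assoc f g h := Hom.ext (funext fun n =>
    StrictHom.ext (Category.assoc _ _ _) (Category.assoc _ _ _))

variable (τ) in
/-- The functor from strict maps to all maps of complexes over `Tilt τ`. -/
noncomputable def toCh : ChSt τ ⥤ CochainComplex (Tilt τ) ℤ where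
  obj X := X.cx
  map f := { f := fun n => (f.f n).toHom, comm' := fun i j _ => f.comm i j }
  map_id X := by ext n; rfl
  map_comp f g := by ext n; exact StrictHom.comp_toHom _ _

variable (τ) in
/-- The complexes which have (literally) zero components far out on the respective side(s). -/
def isBdd (b : Bdd) : ObjectProperty (ChSt τ) := fun X =>
  b.Holds fun n => (X.cx.X n).IsStrictlyZero

variable (τ) [HasDerivedCategory.{w} (Tilt τ)]

/-- The functor to the derived category. -/
noncomputable def toDerived : ChSt τ ⥤ DerivedCategory (Tilt τ) := toCh τ ⋙ DerivedCategory.Q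

/-- The objects of `D⁻`, `D⁺` and `Dᵇ`. -/
def derivedBdd (b : Bdd) : ObjectProperty (DerivedCategory (Tilt τ)) :=
  match b with
  | .minus => DerivedCategory.TStructure.t.minus
  | .plus => DerivedCategory.TStructure.t.plus
  | .bounded => DerivedCategory.TStructure.t.bounded

instance (b : Bdd) : (derivedBdd τ b).IsTriangulated := by
  cases b
  · exact inferInstanceAs DerivedCategory.TStructure.t.minus.IsTriangulated
  · exact inferInstanceAs DerivedCategory.TStructure.t.plus.IsTriangulated
  · exact inferInstanceAs DerivedCategory.TStructure.t.bounded.IsTriangulated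

lemma toDerived_mem (b : Bdd) (X : ChSt τ) (h : isBdd τ b X) :
    derivedBdd τ b ((toDerived τ).obj X) := by
  have above : (∃ N : ℤ, ∀ n, N < n → (X.cx.X n).IsStrictlyZero) →
      DerivedCategory.TStructure.t.minus ((toDerived τ).obj X) := by
    rintro ⟨N, hN⟩
    have : X.cx.IsStrictlyLE N := by
      rw [CochainComplex.isStrictlyLE_iff]
      exact fun n hn => (hN n hn).isZero
    exact ⟨N, inferInstanceAs ((DerivedCategory.Q.obj X.cx).IsLE N)⟩
  have below : (∃ N : ℤ, ∀ n, n < N → (X.cx.X n).IsStrictlyZero) →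
      DerivedCategory.TStructure.t.plus ((toDerived τ).obj X) := by
    rintro ⟨N, hN⟩
    have : X.cx.IsStrictlyGE N := by
      rw [CochainComplex.isStrictlyGE_iff]
      exact fun n hn => (hN n hn).isZero
    exact ⟨N, inferInstanceAs ((DerivedCategory.Q.obj X.cx).IsGE N)⟩
  cases b with
  | minus => exact above h
  | plus => exact below h
  | bounded => exact ⟨below h.2, above h.1⟩

/-- The functors to `D⁻`, `D⁺` and `Dᵇ`. -/
noncomputable def toDerivedBdd (b : Bdd) :
    (isBdd τ b).FullSubcategory ⥤ (derivedBdd τ b).FullSubcategory :=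
  (derivedBdd τ b).lift ((isBdd τ b).ι ⋙ toDerived τ) fun X => toDerived_mem τ b X.obj X.property

end ChSt

variable {τ}

/-- `D` is a decorated complex `Tot X`: in degree `n + 1` its object is the middle object of a
butterfly representing the differential `ⁿX ⟶ ⁿ⁺¹X`, decorated by `ι`, and its differentials are
the links between consecutive butterflies. -/
structure TotObj (X : CochainComplex (Tilt τ) ℤ) (D : Dec A) where
  b : ∀ n : ℤ, Butterfly (X.X n) (X.X (n + 1))
  toHom_b : ∀ n, (b n).toHom = X.d n (n + 1)
  e : ∀ n, (b n).E ≅ D.E.X (n + 1)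
  decoration : ∀ n, D.M (n + 1) = Subobject.mk ((b n).ι ≫ (e n).hom)
  ι_d : ∀ n, (b n).ι ≫ (e n).hom ≫ D.E.d (n + 1) (n + 1 + 1) = (b (n + 1)).κ ≫ (e (n + 1)).hom
  d_σ : ∀ n, (e n).hom ≫ D.E.d (n + 1) (n + 1 + 1) ≫ (e (n + 1)).inv ≫ (b (n + 1)).σ = (b n).ρ

/-- `Tot` is the totalization functor. A strict map `f` acts on `ι` through `fⁿ⁺¹` in degree `-1`
and on `σ` through `fⁿ` in degree `0`. -/
structure TotData (Tot : ChSt τ ⥤ (Dec.compat τ).FullSubcategory) where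
  obj : ∀ X : ChSt τ, TotObj X.cx (Tot.obj X).obj
  ι_map : ∀ {X Y : ChSt τ} (f : X ⟶ Y) (n : ℤ),
    ((obj X).b n).ι ≫ ((obj X).e n).hom ≫ (Tot.map f).hom.hom.f (n + 1) =
      (f.f (n + 1)).fm ≫ ((obj Y).b n).ι ≫ ((obj Y).e n).hom
  map_σ : ∀ {X Y : ChSt τ} (f : X ⟶ Y) (n : ℤ),
    ((obj X).e n).hom ≫ (Tot.map f).hom.hom.f (n + 1) ≫ ((obj Y).e n).inv ≫ ((obj Y).b n).σ =
      ((obj X).b n).σ ≫ (f.f n).f0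

lemma TotData.isBdd {Tot : ChSt τ ⥤ (Dec.compat τ).FullSubcategory} (h : TotData Tot) (b : Bdd)
    (X : ChSt τ) (hX : ChSt.isBdd τ b X) : Dec.isBdd A b (Tot.obj X).obj := by
  refine Bdd.Holds.mono (b := b) hX hX (-1) 0 fun n h1 h2 => ?_
  obtain ⟨m, rfl⟩ : ∃ m, n = m + 1 := ⟨n - 1, by ring⟩
  rw [add_neg_cancel_right] at h1
  rw [add_zero] at h2
  exact (((h.obj X).b m).isZero_E h1.2 h2.1).of_iso ((h.obj X).e m).symm

/-- The restriction of `Tot` to bounded complexes. -/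
noncomputable def TotData.restrict {Tot : ChSt τ ⥤ (Dec.compat τ).FullSubcategory}
    (h : TotData Tot) (b : Bdd) :
    (ChSt.isBdd τ b).FullSubcategory ⥤ (Dec.compat τ ⊓ Dec.isBdd A b).FullSubcategory :=
  ObjectProperty.lift _ ((ChSt.isBdd τ b).ι ⋙ Tot ⋙ (Dec.compat τ).ι)
    fun X => ⟨(Tot.obj X.obj).property, h.isBdd b X.obj X.property⟩

end Strict

end HRS

open HRS

open scoped ZeroObject

/-! ### Vanishing criteria for the torsion pair, and the rigidity of maps between butterflies. -/

namespace HRS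

variable {A : Type u} [Category.{v} A] [Abelian A] {τ : TorsionPair A}

namespace TorsionPair

/-! Everything rests on one vanishing: if a map `X⁰ ⟶ Y⁻¹` is zero on the image of `d_X` and is
killed by `d_Y`, then it factors as `coker d_X ⟶ ker d_Y`, from `T` to `F`, and is zero. Hence a map
between the middle objects of two butterflies is determined by its compatibility with the four legs
(`Butterfly.eq_zero`). Squares that commute in the tilted category over chain maps are therefore the
same as maps of middle objects (`IsSq.comm`, `exists_isSq`), and zero composites are the same as
connecting maps `δ` (`IsLink.comp_eq_zero`, `exists_isLink`). Rigidity gives `δδ = 0`, so a complex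
of butterflies has a totalization, on which strict maps act in exactly one way.

The tilted category is abelian because of `exists_imageFac`. For a butterfly with middle object `E`,
cut the middle cohomology `ker ρ / im κ` by the torsion pair and let `R ⊆ ker ρ` be the preimage of
its torsion part, `C = E / R`. The kernel, coimage, image and cokernel are `[X⁻¹ ⟶ R]`, `[R ⟶ X⁰]`,
`[Y⁻¹ ⟶ C]`, `[C ⟶ Y⁰]`. The same `E`, with both diagonals short exact, is an invertible butterfly
from the coimage to the image.

Conversely, a decorated complex yields the complex of the objects `[Mⁿ ⟶ Eⁿ⁺¹ / Mⁿ⁺¹]`, whose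
differentials are butterflies with middle objects the `Eⁿ` (`toCx`); up to isomorphism this undoes
`Tot`. The functor `toCx` is not claimed to be full, but each map between its values is a right
fraction, and there is a terminal such fraction (`exists_terminal_roof`). Terminality forces maps
with equal image to agree in the localization, so `toCx` is a localization at the maps it inverts.

Decorated cones become mapping cones (`coneComparison`). Two consecutive butterflies are exact if
and only if the map `C ⟶ R'` induced by `δ` is invertible; splicing the sequences `R ⟶ E ⟶ C` shows
that `E` is acyclic if and only if the complex over the tilted category is (`acyclic_of_cx`,
`cx_acyclic`). So `toCx` preserves and reflects quasi-isomorphisms, and followed by `Q` it is a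
localization at the quasi-isomorphisms. The localization is thus equivalent to the derived category,
and the triangulation is transported. Every arrow of the derived category lifts up to isomorphism to
a map of decorated complexes, so the distinguished triangles are exactly those of decorated cones.
In the bounded cases, truncations of complexes over the tilted category replace arbitrary fractions
by bounded ones. -/

lemma F_kernel_iff (τ : TorsionPair A) {X Y : A} (d : X ⟶ Y) :
    τ.F (kernel d) ↔ ∀ U : A, τ.T U → ∀ t : U ⟶ X, t ≫ d = 0 → t = 0 := by
  rw [τ.F_iff]
  refine forall₂_congr fun U _ => ⟨fun h t ht => ?_, fun h f => ?_⟩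
  · rw [← kernel.lift_ι d t ht, h (kernel.lift d t ht), zero_comp]
  · rw [← cancel_mono (kernel.ι d), zero_comp]
    exact h _ (by simp)

lemma T_cokernel_iff (τ : TorsionPair A) {X Y : A} (d : X ⟶ Y) :
    τ.T (cokernel d) ↔ ∀ G : A, τ.F G → ∀ s : Y ⟶ G, d ≫ s = 0 → s = 0 := by
  rw [τ.T_iff]
  refine forall₂_congr fun G _ => ⟨fun h s hs => ?_, fun h f => ?_⟩
  · rw [← cokernel.π_desc d s hs, h (cokernel.desc d s hs), comp_zero]
  · rw [← cancel_epi (cokernel.π d), comp_zero]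
    exact h _ (by simp)

end TorsionPair

namespace Tilt

lemma eq_zero_of_T (Y : Tilt τ) {U : A} (hU : τ.T U) (t : U ⟶ Y.Xm) (h : t ≫ Y.d = 0) : t = 0 :=
  (τ.F_kernel_iff Y.d).1 Y.ker_mem U hU t h

lemma eq_zero_of_F (X : Tilt τ) {G : A} (hG : τ.F G) (s : X.X0 ⟶ G) (h : X.d ≫ s = 0) : s = 0 :=
  (τ.T_cokernel_iff X.d).1 X.coker_mem G hG s h

/-- There is no nonzero map from the cokernel of one object to a kernel. -/
lemma comp_eq_zero (X : Tilt τ) {V W : A} (d : V ⟶ W) (hd : τ.F (kernel d)) (h : X.X0 ⟶ V)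
    (h1 : X.d ≫ h = 0) (h2 : h ≫ d = 0) : h = 0 := by
  have := X.eq_zero_of_F hd (kernel.lift d h h2)
    (by rw [← cancel_mono (kernel.ι d)]; simp [h1])
  rw [← kernel.lift_ι d h h2, this, zero_comp]

end Tilt

namespace Butterfly

variable {X Y Z X' Y' : Tilt τ}

lemma exists_desc_σ (P : Butterfly X Y) {U : A} (t : P.E ⟶ U) (h : P.ι ≫ t = 0) :
    ∃ s : X.X0 ⟶ U, P.σ ≫ s = t :=
  ⟨P.exact.exact.desc t h, P.exact.exact.g_desc t h⟩

/-- Maps between the middle objects are determined by their compatibilities. -/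
lemma eq_zero (P : Butterfly X Y) (P' : Butterfly X' Y') (ψ : P.E ⟶ P'.E) (hκ : P.κ ≫ ψ = 0)
    (hι : P.ι ≫ ψ = 0) (hσ : ψ ≫ P'.σ = 0) (hρ : ψ ≫ P'.ρ = 0) : ψ = 0 := by
  -- The conditions on `ι` and `σ` reduce `ψ` to a map `y : X⁰ ⟶ Y'⁻¹`. Those on `κ` and `ρ` say
  -- that `y` kills `d_X` and is killed by `d_Y'`.
  obtain ⟨s, rfl⟩ := P.exists_desc_σ ψ hι
  obtain ⟨y, rfl⟩ := P'.exists_lift s (by rw [← cancel_epi P.σ]; simpa using hσ)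
  have : y = 0 := X.comp_eq_zero Y'.d Y'.ker_mem y
    (by rw [← cancel_mono P'.ι]; simpa using hκ)
    (by rw [← cancel_epi P.σ]; simpa using hρ)
  simp [this]

/-- A map between the middle objects of two butterflies over a pair of chain maps. -/
structure IsSq (P : Butterfly X Y) (P' : Butterfly X' Y') (f : StrictHom X X')
    (g : StrictHom Y Y') (φ : P.E ⟶ P'.E) : Prop where
  κ : P.κ ≫ φ = f.fm ≫ P'.κ
  ι : P.ι ≫ φ = g.fm ≫ P'.ι
  σ : φ ≫ P'.σ = P.σ ≫ f.f0
  ρ : φ ≫ P'.ρ = P.ρ ≫ g.f0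

lemma IsSq.unique {P : Butterfly X Y} {P' : Butterfly X' Y'} {f : StrictHom X X'}
    {g : StrictHom Y Y'} {φ ψ : P.E ⟶ P'.E} (h : IsSq P P' f g φ) (h' : IsSq P P' f g ψ) :
    φ = ψ := by
  rw [← sub_eq_zero]
  apply eq_zero P P'
  · simp [h.κ, h'.κ]
  · simp [h.ι, h'.ι]
  · simp [h.σ, h'.σ]
  · simp [h.ρ, h'.ρ]

lemma toHom_eq_iff {P Q : Butterfly X Y} : P.toHom = Q.toHom ↔ Rel P Q :=
  ⟨fun h => Quotient.exact (s := setoid X Y) h, fun h => Quotient.sound (s := setoid X Y) h⟩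

lemma toHom_comp (P : Butterfly X Y) (Q : Butterfly Y Z) :
    (comp P Q).toHom = P.toHom ≫ Q.toHom := rfl

lemma exists_toHom (f : X ⟶ Y) : ∃ P : Butterfly X Y, P.toHom = f := by
  obtain ⟨P, rfl⟩ := Quotient.exists_rep f
  exact ⟨P, rfl⟩

lemma Splits.κ_eq {P : Butterfly X Y} {f : StrictHom X Y} {r : P.E ⟶ Y.Xm} {s : X.X0 ⟶ P.E}
    (h : Splits P f r s) : P.κ = X.d ≫ s - f.fm ≫ P.ι := by
  have := congr(P.κ ≫ $(h.total))
  simp only [Preadditive.comp_add, κ_σ_assoc, reassoc_of% h.κ_r] at this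
  simpa [sub_eq_add_neg] using this.symm

lemma Splits.s_ρ {P : Butterfly X Y} {f : StrictHom X Y} {r : P.E ⟶ Y.Xm} {s : X.X0 ⟶ P.E}
    (h : Splits P f r s) : s ≫ P.ρ = f.f0 := by
  rw [h.ρ_eq]
  simp [reassoc_of% h.s_σ, reassoc_of% h.s_r]

/-- Any compatible map of butterflies is invertible, so a map from one composite to the other is
enough. It is written on the fibre products by means of `φ` and the splittings of the two split
butterflies. -/
lemma IsSq.comm {P : Butterfly X Y} {P' : Butterfly X' Y'} {f : StrictHom X X'}
    {g : StrictHom Y Y'} {φ : P.E ⟶ P'.E} (h : IsSq P P' f g φ) :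
    P.toHom ≫ g.toHom = f.toHom ≫ P'.toHom := by
  obtain ⟨r, s, hg⟩ := exists_splits g
  obtain ⟨r', s', hf⟩ := exists_splits f
  change P.toHom ≫ g.butterfly.toHom = f.butterfly.toHom ≫ P'.toHom
  generalize g.butterfly = G at r s hg ⊢
  generalize f.butterfly = F at r' s' hf ⊢
  rw [← toHom_comp, ← toHom_comp, toHom_eq_iff]
  obtain ⟨b, b1, b2⟩ : ∃ b : pullback P.ρ G.σ ⟶ pullback F.ρ P'.σ,
      b ≫ pullback.fst _ _ = pullback.fst _ _ ≫ P.σ ≫ s' ∧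
      b ≫ pullback.snd _ _ = pullback.fst _ _ ≫ φ + pullback.snd _ _ ≫ r ≫ P'.ι :=
    ⟨pullback.lift (pullback.fst _ _ ≫ P.σ ≫ s')
      (pullback.fst _ _ ≫ φ + pullback.snd _ _ ≫ r ≫ P'.ι)
      (by simp [hf.s_ρ, h.σ]), pullback.lift_fst .., pullback.lift_snd ..⟩
  refine comp_rel_of P G _ (b ≫ π F P') ?_ ?_ ?_ ?_ ?_
  · have : diag P G ≫ b = 0 := by
      apply pullback.hom_ext
      · simp [b1]
      · simp [b2, h.ι, reassoc_of% hg.κ_r]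
    rw [← Category.assoc, this, zero_comp]
  -- The left leg is respected only modulo the diagonal, which dies in the composite.
  · have : left P G ≫ b = left F P' + f.fm ≫ diag F P' := by
      apply pullback.hom_ext
      · simp [b1, hf.κ_eq]
      · simp [b2, h.κ]
    rw [← Category.assoc, this, comp_κ]
    simp
  · have : right P G ≫ b = right F P' := by
      apply pullback.hom_ext
      · simp [b1]
      · simp [b2, reassoc_of% hg.ι_r]
    rw [← Category.assoc, this, comp_ι]
  · rw [Category.assoc, π_σ, ← Category.assoc, b1]
    simp [hf.s_σ]
  · rw [Category.assoc, π_ρ, ← Category.assoc, b2]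
    have := pullback.condition (f := P.ρ) (g := G.σ)
    simp only [Preadditive.add_comp, Category.assoc, h.ρ, ι_ρ, hg.ρ_eq, Preadditive.comp_add]
    rw [reassoc_of% this]

/-- The map `φ` is the composite of the given isomorphism of composites with a map `P.E ⟶ (P ∘
g).E`, pushing out along `g⁻¹`, and a map `(f ∘ P').E ⟶ P'.E`, pulling back along `f⁰`. Both outer
maps exist because one factor is split. -/
lemma exists_isSq {P : Butterfly X Y} {P' : Butterfly X' Y'} {f : StrictHom X X'}
    {g : StrictHom Y Y'} (h : P.toHom ≫ g.toHom = f.toHom ≫ P'.toHom) :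
    ∃ φ, IsSq P P' f g φ := by
  obtain ⟨r, s, hg⟩ := exists_splits g
  obtain ⟨r', s', hf⟩ := exists_splits f
  change P.toHom ≫ g.butterfly.toHom = f.butterfly.toHom ≫ P'.toHom at h
  generalize g.butterfly = G at r s hg h
  generalize f.butterfly = F at r' s' hf h
  rw [← toHom_comp, ← toHom_comp, toHom_eq_iff] at h
  obtain ⟨θ, hθ⟩ := h
  obtain ⟨a, a1, a2⟩ : ∃ a : P.E ⟶ pullback P.ρ G.σ,
      a ≫ pullback.fst _ _ = 𝟙 _ ∧ a ≫ pullback.snd _ _ = P.ρ ≫ s :=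
    ⟨pullback.lift (𝟙 _) (P.ρ ≫ s) (by simp [hg.s_σ]), pullback.lift_fst .., pullback.lift_snd ..⟩
  -- The correction `r' ≫ κ` is what makes the second projection vanish on the diagonal.
  obtain ⟨c, hc⟩ := exists_desc F P' (pullback.snd _ _ - pullback.fst _ _ ≫ r' ≫ P'.κ)
    (by simp [reassoc_of% hf.ι_r])
  have hcσ : c ≫ P'.σ = (comp F P').σ ≫ f.f0 := by
    have := pullback.condition (f := F.ρ) (g := P'.σ)
    rw [← cancel_epi (π F P'), reassoc_of% hc, reassoc_of% (π_σ F P')]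
    simp [← this, hf.ρ_eq]
  have hcρ : c ≫ P'.ρ = (comp F P').ρ := by
    rw [← cancel_epi (π F P'), reassoc_of% hc, π_ρ F P']
    simp
  have haκ : P.κ ≫ a ≫ π P G = (comp P G).κ := by
    have : P.κ ≫ a = left P G := by
      apply pullback.hom_ext <;> simp [a1, a2]
    rw [← Category.assoc, this, comp_κ]
  have haι : P.ι ≫ a ≫ π P G = g.fm ≫ (comp P G).ι := by
    have : P.ι ≫ a = g.fm ≫ right P G + diag P G := by
      apply pullback.hom_ext <;> simp [a1, a2, hg.κ_eq]
    rw [← Category.assoc, this, comp_ι]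
    simp
  have hcκ : (comp F P').κ ≫ c = f.fm ≫ P'.κ := by
    rw [comp_κ, Category.assoc, hc]
    simp [reassoc_of% hf.κ_r]
  have hcι : (comp F P').ι ≫ c = P'.ι := by
    rw [comp_ι, Category.assoc, hc]
    simp
  refine ⟨a ≫ π P G ≫ θ.hom ≫ c, ⟨?_, ?_, ?_, ?_⟩⟩
  · rw [reassoc_of% haκ, reassoc_of% hθ.κ, hcκ]
  · rw [reassoc_of% haι, reassoc_of% hθ.ι, hcι]
  · simp only [Category.assoc, hcσ, reassoc_of% hθ.σ, reassoc_of% (π_σ P G), reassoc_of% a1]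
  · simp only [Category.assoc, hcρ, hθ.ρ, π_ρ, reassoc_of% a2, hg.s_ρ]

/-- The case of `IsSq.comm` with an identity on the source. This and its dual compute composites
with chain maps without touching fibre products. -/
lemma comp_toHom_eq {P : Butterfly X Y} {g : StrictHom Y Y'} {R : Butterfly X Y'}
    (φ : P.E ⟶ R.E) (hκ : P.κ ≫ φ = R.κ) (hι : P.ι ≫ φ = g.fm ≫ R.ι) (hσ : φ ≫ R.σ = P.σ)
    (hρ : φ ≫ R.ρ = P.ρ ≫ g.f0) : P.toHom ≫ g.toHom = R.toHom := by
  have := IsSq.comm (P := P) (P' := R) (f := StrictHom.id X) (g := g) (φ := φ)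
    ⟨by simp [hκ], hι, by simp [hσ], hρ⟩
  rwa [StrictHom.id_toHom, Category.id_comp] at this

lemma toHom_comp_eq {P : Butterfly X' Y} {f : StrictHom X X'} {R : Butterfly X Y}
    (φ : R.E ⟶ P.E) (hκ : R.κ ≫ φ = f.fm ≫ P.κ) (hι : R.ι ≫ φ = P.ι)
    (hσ : φ ≫ P.σ = R.σ ≫ f.f0) (hρ : φ ≫ P.ρ = R.ρ) : f.toHom ≫ P.toHom = R.toHom := by
  have := IsSq.comm (P := R) (P' := P) (f := f) (g := StrictHom.id Y) (φ := φ)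
    ⟨hκ, by simp [hι], hσ, by simp [hρ]⟩
  rw [StrictHom.id_toHom, Category.comp_id] at this
  exact this.symm

end Butterfly

/-! ### Chain maps up to homotopy, zero morphisms and null composites. -/

namespace StrictHom

variable {X Y Z : Tilt τ}

variable (X Y) in
/-- The zero chain map. -/
@[simps] def zero : StrictHom X Y := ⟨0, 0, by simp⟩

/-- An isomorphism of split extensions that respects `ι` and `σ` is unipotent, with a single
off-diagonal entry `X⁰ ⟶ Y⁻¹`. Compatibility with `κ` and `ρ` makes this entry, up to sign, a chain
homotopy. -/
lemma toHom_eq_iff {f g : StrictHom X Y} : f.toHom = g.toHom ↔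
    ∃ h : X.X0 ⟶ Y.Xm, g.fm = f.fm + X.d ≫ h ∧ g.f0 = f.f0 + h ≫ Y.d := by
  change f.butterfly.toHom = g.butterfly.toHom ↔ _
  rw [Butterfly.toHom_eq_iff]
  obtain ⟨r, s, hf⟩ := Butterfly.exists_splits f
  obtain ⟨r', s', hg⟩ := Butterfly.exists_splits g
  generalize f.butterfly = F at r s hf ⊢
  generalize g.butterfly = G at r' s' hg ⊢
  constructor
  · rintro ⟨φ, h⟩
    have h1 := congr(s ≫ $(h.ρ))
    have h2 := congr($(h.κ) ≫ r')
    refine ⟨-(s ≫ φ.hom ≫ r'), ?_, ?_⟩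
    · rw [hf.κ_eq, hg.κ_r, Preadditive.sub_comp, Preadditive.sub_comp, Category.assoc,
        Category.assoc, Category.assoc, Category.assoc, reassoc_of% h.ι, hg.ι_r] at h2
      rw [← neg_inj, ← h2, sub_eq_add_neg]
      simp
    · rw [hf.s_ρ, hg.ρ_eq, Preadditive.comp_add, Preadditive.comp_add, reassoc_of% h.σ,
        reassoc_of% hf.s_σ] at h1
      rw [← h1]
      simp
  · rintro ⟨h, h1, h2⟩
    refine Butterfly.IsHom.rel (φ := F.σ ≫ s' + (r - F.σ ≫ h) ≫ G.ι) ⟨?_, ?_, ?_, ?_⟩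
    · rw [hg.κ_eq]
      simp [reassoc_of% hf.κ_r, h1]
      abel
    · simp [reassoc_of% hf.ι_r]
    · simp [hg.s_σ]
    · simp [hg.s_ρ, h2, hf.ρ_eq]

end StrictHom

/-- The zero morphisms of the tilted category. -/
noncomputable abbrev Tilt.hasZeroMorphisms : HasZeroMorphisms (Tilt τ) where
  zero X Y := ⟨(StrictHom.zero X Y).toHom⟩
  comp_zero {X Y} f Z := by
    obtain ⟨P, rfl⟩ := Butterfly.exists_toHom f
    -- The zero map of middle objects is a square over two zero chain maps, so `P` followed by zero
    -- equals zero followed by `Q`; then `Q` is taken to be the identity.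
    have (Q : Butterfly Z Z) := Butterfly.IsSq.comm (P := P) (P' := Q)
      (f := StrictHom.zero X Z) (g := StrictHom.zero Y Z) (φ := 0)
      ⟨by simp, by simp, by simp, by simp⟩
    exact (this (StrictHom.id Z).butterfly).trans (Category.comp_id _)
  zero_comp X Y Z f := by
    obtain ⟨P, rfl⟩ := Butterfly.exists_toHom f
    have (Q : Butterfly X X) := Butterfly.IsSq.comm (P := Q) (P' := P)
      (f := StrictHom.zero X Y) (g := StrictHom.zero X Z) (φ := 0)
      ⟨by simp, by simp, by simp, by simp⟩
    exact (this (StrictHom.id X).butterfly).symm.trans (Category.id_comp _)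

lemma StrictHom.zero_toHom [h : HasZeroMorphisms (Tilt τ)] (X Y : Tilt τ) :
    (StrictHom.zero X Y).toHom = 0 := by
  obtain rfl := Subsingleton.elim h Tilt.hasZeroMorphisms
  rfl

namespace Butterfly

variable {X Y Z X' Y' : Tilt τ}

/-- A null composition of two butterflies. -/
structure IsLink (P : Butterfly X Y) (Q : Butterfly Y Z) (δ : P.E ⟶ Q.E) : Prop where
  ι : P.ι ≫ δ = Q.κ
  σ : δ ≫ Q.σ = P.ρ
  κ : P.κ ≫ δ = 0
  ρ : δ ≫ Q.ρ = 0

/-- On the fibre product, the second projection minus `δ` of the first is killed by `σ`, so it lands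
in `Z⁻¹`. This gives a retraction that splits the composite butterfly compatibly with the zero chain
map. -/
lemma IsLink.comp_eq_zero {P : Butterfly X Y} {Q : Butterfly Y Z} {δ : P.E ⟶ Q.E}
    (h : IsLink P Q δ) : P.toHom ≫ Q.toHom = (StrictHom.zero X Z).toHom := by
  rw [← toHom_comp]
  change _ = (StrictHom.zero X Z).butterfly.toHom
  obtain ⟨r, s, hf⟩ := exists_splits (StrictHom.zero X Z)
  generalize (StrictHom.zero X Z).butterfly = R at r s hf ⊢
  rw [toHom_eq_iff]
  obtain ⟨y, hy⟩ := Q.exists_lift (pullback.snd P.ρ Q.σ - pullback.fst _ _ ≫ δ)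
    (by simp [h.σ, pullback.condition])
  have hR : R.κ = X.d ≫ s := by rw [hf.κ_eq]; simp
  have y1 : diag P Q ≫ y = 0 := by
    rw [← cancel_mono Q.ι]; simp [hy, h.ι]
  have y2 : left P Q ≫ y = 0 := by
    rw [← cancel_mono Q.ι]; simp [hy, h.κ]
  have y3 : right P Q ≫ y = 𝟙 _ := by
    rw [← cancel_mono Q.ι]; simp [hy]
  refine comp_rel_of P Q R (pullback.fst _ _ ≫ P.σ ≫ s + y ≫ R.ι) ?_ ?_ ?_ ?_ ?_
  · simp [reassoc_of% y1]
  · simp [reassoc_of% y2, hR]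
  · simp [reassoc_of% y3]
  · simp [hf.s_σ]
  · have := congr($hy ≫ Q.ρ)
    simp only [Category.assoc, Preadditive.sub_comp, h.ρ, comp_zero, sub_zero, ι_ρ] at this
    simp [hf.s_ρ, this]

/-- A splitting of the composite over the zero chain map is a retraction onto `Z⁻¹`. Subtracting it
from the second projection gives a map that depends only on the first projection, and this is `δ`.
-/
lemma exists_isLink {P : Butterfly X Y} {Q : Butterfly Y Z}
    (h : P.toHom ≫ Q.toHom = (StrictHom.zero X Z).toHom) : ∃ δ, IsLink P Q δ := by
  rw [← toHom_comp] at h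
  change _ = (StrictHom.zero X Z).butterfly.toHom at h
  obtain ⟨r, s, hf⟩ := exists_splits (StrictHom.zero X Z)
  generalize (StrictHom.zero X Z).butterfly = R at r s hf h
  rw [toHom_eq_iff] at h
  obtain ⟨θ, hθ⟩ := h
  have e1 : (comp P Q).ι ≫ θ.hom ≫ r = 𝟙 _ := by rw [reassoc_of% hθ.ι, hf.ι_r]
  have e2 : (comp P Q).κ ≫ θ.hom ≫ r = 0 := by rw [reassoc_of% hθ.κ, hf.κ_r]; simp
  have e3 : θ.hom ≫ r ≫ Z.d = (comp P Q).ρ := by rw [← hθ.ρ, hf.ρ_eq]; simp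
  -- The first projection is epi as a base change of `σ`, and its kernel consists of the pairs `(0,
  -- ι z)`, on which the two terms cancel.
  have hker : kernel.ι (pullback.fst P.ρ Q.σ) ≫
      (pullback.snd _ _ - π P Q ≫ θ.hom ≫ r ≫ Q.ι) = 0 := by
    have hk := kernel.condition (pullback.fst P.ρ Q.σ)
    generalize kernel.ι (pullback.fst P.ρ Q.σ) = k at hk ⊢
    obtain ⟨z, hz⟩ := Q.exists_lift (k ≫ pullback.snd P.ρ Q.σ)
      (by rw [Category.assoc, ← pullback.condition, reassoc_of% hk, zero_comp])
    have : k = z ≫ right P Q := by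
      apply pullback.hom_ext <;> simp [hk, hz]
    rw [this]
    rw [comp_ι, Category.assoc] at e1
    simp [reassoc_of% e1]
  let δ := Abelian.epiDesc (pullback.fst P.ρ Q.σ) _ hker
  have hδ : pullback.fst P.ρ Q.σ ≫ δ = pullback.snd _ _ - π P Q ≫ θ.hom ≫ r ≫ Q.ι :=
    Abelian.comp_epiDesc _ _ _
  refine ⟨δ, ⟨?_, ?_, ?_, ?_⟩⟩
  · rw [← diag_fst P Q, Category.assoc, hδ]
    simp [reassoc_of% (diag_π P Q)]
  · rw [← cancel_epi (pullback.fst P.ρ Q.σ), reassoc_of% hδ]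
    simp [pullback.condition]
  · rw [← left_fst P Q, Category.assoc, hδ]
    rw [comp_κ, Category.assoc] at e2
    simp [reassoc_of% e2]
  · rw [← cancel_epi (pullback.fst P.ρ Q.σ), reassoc_of% hδ]
    simp [e3]

end Butterfly

end HRS

/-! ### Invertible butterflies, fractions of chain maps, and direct sums. -/

namespace HRS

variable {A : Type u} [Category.{v} A] [Abelian A] {τ : TorsionPair A}

namespace Butterfly

variable {X Y Z : Tilt τ}

/-- The butterfly with the two diagonals interchanged. -/
@[simps] abbrev flip (P : Butterfly X Y) (h : (ShortComplex.mk P.κ P.ρ P.κ_ρ).ShortExact) :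
    Butterfly Y X where
  E := P.E
  κ := P.ι
  ι := P.κ
  σ := P.ρ
  ρ := P.σ
  κ_σ := P.ι_ρ
  ι_ρ := P.κ_σ
  κ_ρ := P.ι_σ
  ι_σ := P.κ_ρ
  exact := h

/-- Two points of `E` over the same point of `Y⁰` differ by an element of `X⁻¹`, since the second
diagonal is exact. The difference is a retraction that identifies the composite with the split
butterfly of the identity. -/
lemma toHom_comp_flip (P : Butterfly X Y) (h : (ShortComplex.mk P.κ P.ρ P.κ_ρ).ShortExact) :
    P.toHom ≫ (P.flip h).toHom = 𝟙 X := by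
  rw [← toHom_comp, ← StrictHom.id_toHom]
  change _ = (StrictHom.id X).butterfly.toHom
  obtain ⟨r, s, hI⟩ := exists_splits (StrictHom.id X)
  generalize (StrictHom.id X).butterfly = I at r s hI ⊢
  rw [toHom_eq_iff]
  -- The flipped butterfly is replaced by a variable `Q` with a comparison map `φ`, so that the two
  -- copies of the legs on `E` stay apart.
  have key : ∀ (Q : Butterfly Y X) (φ : Q.E ⟶ P.E), Q.κ ≫ φ = P.ι → Q.ι ≫ φ = P.κ →
      φ ≫ P.ρ = Q.σ → φ ≫ P.σ = Q.ρ → Rel (comp P Q) I := by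
    intro Q φ h1 h2 h3 h4
    have hm : Mono P.κ := h.mono_f
    obtain ⟨x, hx⟩ : ∃ x : pullback P.ρ Q.σ ⟶ X.Xm,
        x ≫ P.κ = pullback.snd _ _ ≫ φ - pullback.fst _ _ :=
      ⟨h.exact.lift _ (by simp [h3, pullback.condition]), h.exact.lift_f _ _⟩
    have x1 : diag P Q ≫ x = 0 := by rw [← cancel_mono P.κ]; simp [hx, h1]
    have x2 : left P Q ≫ x = -𝟙 _ := by rw [← cancel_mono P.κ]; simp [hx]
    have x3 : right P Q ≫ x = 𝟙 _ := by rw [← cancel_mono P.κ]; simp [hx, h2]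
    refine comp_rel_of P Q I (pullback.fst _ _ ≫ P.σ ≫ s + x ≫ I.ι) ?_ ?_ ?_ ?_ ?_
    · simp [reassoc_of% x1]
    · simp [reassoc_of% x2, hI.κ_eq, sub_eq_add_neg]
    · simp [reassoc_of% x3]
    · simp [hI.s_σ]
    · have := congr($hx ≫ P.σ)
      simp only [Category.assoc, κ_σ, Preadditive.sub_comp, h4] at this
      simp [hI.s_ρ, this]
  exact key (P.flip h) (𝟙 P.E) (by simp) (by simp) (by simp) (by simp)

lemma isIso_toHom (P : Butterfly X Y) (h : (ShortComplex.mk P.κ P.ρ P.κ_ρ).ShortExact) :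
    IsIso P.toHom :=
  ⟨(P.flip h).toHom, P.toHom_comp_flip h, (P.flip h).toHom_comp_flip P.exact⟩

end Butterfly

namespace StrictHom

variable {X Y Z : Tilt τ}

/-- The second diagonal of the split butterfly is the mapping cone `X⁻¹ ⟶ X⁰ ⊕ Y⁻¹ ⟶ Y⁰`. The
hypotheses express its exactness, that is, that `f` is a quasi-isomorphism. -/
lemma isIso_toHom (f : StrictHom X Y)
    (h1 : ∀ {U : A} (t : U ⟶ X.Xm), t ≫ X.d = 0 → t ≫ f.fm = 0 → t = 0)
    (h2 : ∀ {U : A} (a : U ⟶ X.X0) (b : U ⟶ Y.Xm), a ≫ f.f0 + b ≫ Y.d = 0 →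
      ∃ x : U ⟶ X.Xm, x ≫ X.d = a ∧ x ≫ f.fm = -b)
    (h3 : ∀ {U : A} (t : Y.X0 ⟶ U), f.f0 ≫ t = 0 → Y.d ≫ t = 0 → t = 0) :
    IsIso f.toHom := by
  change IsIso f.butterfly.toHom
  obtain ⟨r, s, h⟩ := Butterfly.exists_splits f
  generalize f.butterfly = F at r s h ⊢
  refine F.isIso_toHom { exact := ?_, mono_f := ?_, epi_g := ?_ }
  · rw [ShortComplex.exact_iff_exact_up_to_refinements]
    intro U t ht
    dsimp at t ht
    obtain ⟨x, hx, hx'⟩ := h2 (t ≫ F.σ) (t ≫ r) (by simpa [h.ρ_eq] using ht)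
    refine ⟨U, 𝟙 _, inferInstance, x, ?_⟩
    dsimp
    have := congr(t ≫ $(h.total))
    simp only [Preadditive.comp_add, Category.comp_id] at this
    simp only [h.κ_eq, Preadditive.comp_sub, reassoc_of% hx, reassoc_of% hx', Category.id_comp,
      Preadditive.neg_comp, sub_neg_eq_add, Category.assoc]
    exact this.symm
  · refine Preadditive.mono_of_cancel_zero _ fun {U} t ht => h1 t ?_ ?_
    · simpa using congr($ht ≫ F.σ)
    · simpa [h.κ_r] using congr($ht ≫ r)
  · refine Preadditive.epi_of_cancel_zero _ fun {U} t ht => h3 t ?_ ?_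
    · simpa [reassoc_of% h.s_ρ] using congr(s ≫ $ht)
    · simpa using congr(F.ι ≫ $ht)

end StrictHom

namespace Butterfly

variable {X Y Z : Tilt τ}

/-- The object `[X⁻¹ ⊕ Y⁻¹ ⟶ E]`, which is isomorphic to `X`. -/
@[simps]
noncomputable abbrev roof (P : Butterfly X Y) : Tilt τ where
  Xm := X.Xm ⊞ Y.Xm
  X0 := P.E
  d := biprod.desc P.κ P.ι
  ker_mem := by
    rw [τ.F_kernel_iff]
    intro U hU t ht
    have h1 : t ≫ biprod.fst = 0 := X.eq_zero_of_T hU _ (by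
      have := congr($ht ≫ P.σ)
      simpa [biprod.desc_eq] using this)
    refine biprod.hom_ext _ _ (by simpa using h1) ?_
    rw [← cancel_mono P.ι]
    simpa [biprod.desc_eq, reassoc_of% h1] using ht
  coker_mem := by
    rw [τ.T_cokernel_iff]
    intro G hG s hs
    obtain ⟨s', rfl⟩ := P.exists_desc_σ s (by simpa using congr(biprod.inr ≫ $hs))
    rw [X.eq_zero_of_F hG s' (by simpa using congr(biprod.inl ≫ $hs)), comp_zero]

/-- The projection of the roof to the source. -/
@[simps] noncomputable def roofFst (P : Butterfly X Y) : StrictHom P.roof X where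
  fm := biprod.fst
  f0 := P.σ
  comm := by dsimp; ext <;> simp

/-- The projection of the roof to the target. -/
@[simps] noncomputable def roofSnd (P : Butterfly X Y) : StrictHom P.roof Y where
  fm := biprod.snd
  f0 := P.ρ
  comm := by dsimp; ext <;> simp

/-- With the invertibility of `roofFst` this presents every morphism as a right fraction of chain
maps, so that identities between morphisms can be checked on chain maps up to homotopy. -/
lemma roofFst_comp (P : Butterfly X Y) : P.roofFst.toHom ≫ P.toHom = P.roofSnd.toHom := by
  change _ = P.roofSnd.butterfly.toHom
  obtain ⟨r, s, h⟩ := exists_splits P.roofSnd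
  generalize P.roofSnd.butterfly = R at r s h ⊢
  have hr := h.ρ_eq
  dsimp at s hr
  refine toHom_comp_eq (R.σ + r ≫ P.ι) ?_ ?_ ?_ ?_
  · simp [reassoc_of% h.κ_r, biprod.desc_eq]
  · have := R.ι_σ
    dsimp at this
    simp [reassoc_of% h.ι_r]
  · simp
  · simp [h.ρ_eq]

instance (P : Butterfly X Y) : IsIso P.roofFst.toHom := by
  apply StrictHom.isIso_toHom
  · intro U t h1 h2
    rw [roofFst_fm] at h2
    refine biprod.hom_ext _ _ (by simpa using h2) ?_
    rw [← cancel_mono P.ι]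
    simpa [biprod.desc_eq, reassoc_of% h2] using h1
  · intro U a b h
    rw [roofFst_f0] at h
    obtain ⟨y, hy⟩ := P.exists_lift (a + b ≫ P.κ) (by simpa using h)
    exact ⟨biprod.lift (-b) y, by simp [biprod.lift_desc, hy], by simp⟩
  · intro U t h1 _
    rwa [← cancel_epi P.σ, comp_zero]

/-- The object `[E ⟶ X⁰ ⊕ Y⁰]`, which is isomorphic to `Y`. -/
@[simps]
noncomputable abbrev coroof (P : Butterfly X Y) : Tilt τ where
  Xm := P.E
  X0 := X.X0 ⊞ Y.X0
  d := biprod.lift P.σ P.ρ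
  ker_mem := by
    rw [τ.F_kernel_iff]
    intro U hU t ht
    obtain ⟨y, rfl⟩ := P.exists_lift t (by simpa using congr($ht ≫ biprod.fst))
    rw [Y.eq_zero_of_T hU y (by simpa using congr($ht ≫ biprod.snd)), zero_comp]
  coker_mem := by
    rw [τ.T_cokernel_iff]
    intro G hG s hs
    have h1 : biprod.inr ≫ s = 0 := Y.eq_zero_of_F hG _ (by
      have := congr(P.ι ≫ $hs)
      simpa [biprod.lift_eq] using this)
    refine biprod.hom_ext' _ _ ?_ (by simpa using h1)
    rw [← cancel_epi P.σ]
    simpa [biprod.lift_eq, h1] using hs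

/-- The inclusion of the source into the coroof. -/
@[simps] noncomputable def coroofInl (P : Butterfly X Y) : StrictHom X P.coroof where
  fm := -P.κ
  f0 := -biprod.inl
  comm := by dsimp; ext <;> simp

/-- The inclusion of the target into the coroof. -/
@[simps] noncomputable def coroofInr (P : Butterfly X Y) : StrictHom Y P.coroof where
  fm := P.ι
  f0 := biprod.inr
  comm := by dsimp; ext <;> simp

/-- The dual presentation as a left fraction. The signs in `coroofInl` make `σ` followed by the
component on `X⁰` cancel the first component of the differential `(σ, ρ)`. -/
lemma comp_coroofInr (P : Butterfly X Y) : P.toHom ≫ P.coroofInr.toHom = P.coroofInl.toHom := by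
  change _ = P.coroofInl.butterfly.toHom
  obtain ⟨r, s, h⟩ := exists_splits P.coroofInl
  generalize P.coroofInl.butterfly = R at r s h ⊢
  have e1 := h.κ_eq
  have e2 := h.s_ρ
  have e3 := R.ι_ρ
  dsimp at e1 e2 e3
  -- The source of `R.ι` is `P.E` only after unfolding the coroof; the variable `i` carries the
  -- unfolded type.
  have key : ∀ i : P.E ⟶ R.E, i = R.ι → P.toHom ≫ P.coroofInr.toHom = R.toHom := by
    rintro i hi
    refine comp_toHom_eq (P.σ ≫ s + i) ?_ ?_ ?_ ?_
    · simp [e1, hi]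
    · simp [hi]
    · rw [hi]
      simp [h.s_σ]
    · rw [hi]
      simp only [Preadditive.add_comp, Category.assoc, e2]
      erw [e3]
      ext <;> simp
  exact key R.ι rfl

instance (P : Butterfly X Y) : IsIso P.coroofInr.toHom := by
  apply StrictHom.isIso_toHom
  · intro U t _ h2
    rwa [← cancel_mono P.ι, zero_comp]
  · intro U a b h
    rw [coroofInr_f0] at h
    obtain ⟨y, rfl⟩ := P.exists_lift b (by simpa using congr($h ≫ biprod.fst))
    refine ⟨-y, ?_, by simp⟩
    have := congr($h ≫ biprod.snd)
    simp only [Preadditive.add_comp, Category.assoc, biprod.inr_snd, Category.comp_id,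
      biprod.lift_snd, ι_ρ, zero_comp] at this
    rw [Preadditive.neg_comp, eq_comm, eq_neg_iff_add_eq_zero, this]
  · intro U t h1 h2
    rw [coroofInr_f0] at h1
    refine biprod.hom_ext' _ _ ?_ (by simpa using h1)
    rw [← cancel_epi P.σ]
    simpa [biprod.lift_eq, h1] using h2

end Butterfly

namespace Tilt

variable {X Y Z : Tilt τ}

lemma exists_roof (f : X ⟶ Y) : ∃ (X' : Tilt τ) (p : StrictHom X' X) (_ : IsIso p.toHom)
    (a : StrictHom X' Y), p.toHom ≫ f = a.toHom := by
  obtain ⟨P, rfl⟩ := Butterfly.exists_toHom f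
  exact ⟨_, P.roofFst, inferInstance, P.roofSnd, P.roofFst_comp⟩

lemma exists_roof₂ (f : X ⟶ Y) (g : X ⟶ Z) : ∃ (X' : Tilt τ) (p : StrictHom X' X)
    (_ : IsIso p.toHom) (a : StrictHom X' Y) (b : StrictHom X' Z),
    p.toHom ≫ f = a.toHom ∧ p.toHom ≫ g = b.toHom := by
  obtain ⟨X', p, _, a, ha⟩ := exists_roof f
  obtain ⟨X'', p', _, b, hb⟩ := exists_roof (p.toHom ≫ g)
  refine ⟨X'', p'.comp p, ?_, p'.comp a, b, ?_, ?_⟩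
  · rw [StrictHom.comp_toHom]; infer_instance
  · rw [StrictHom.comp_toHom, StrictHom.comp_toHom, Category.assoc, ha]
  · rw [StrictHom.comp_toHom, Category.assoc, hb]

lemma exists_coroof (f : X ⟶ Y) : ∃ (Y' : Tilt τ) (q : StrictHom Y Y') (_ : IsIso q.toHom)
    (a : StrictHom X Y'), f ≫ q.toHom = a.toHom := by
  obtain ⟨P, rfl⟩ := Butterfly.exists_toHom f
  exact ⟨_, P.coroofInr, inferInstance, P.coroofInl, P.comp_coroofInr⟩

lemma exists_coroof₂ (f : X ⟶ Z) (g : Y ⟶ Z) : ∃ (Z' : Tilt τ) (q : StrictHom Z Z')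
    (_ : IsIso q.toHom) (a : StrictHom X Z') (b : StrictHom Y Z'),
    f ≫ q.toHom = a.toHom ∧ g ≫ q.toHom = b.toHom := by
  obtain ⟨Z', q, _, a, ha⟩ := exists_coroof f
  obtain ⟨Z'', q', _, b, hb⟩ := exists_coroof (g ≫ q.toHom)
  refine ⟨Z'', q.comp q', ?_, a.comp q', b, ?_, ?_⟩
  · rw [StrictHom.comp_toHom]; infer_instance
  · rw [StrictHom.comp_toHom, StrictHom.comp_toHom, ← Category.assoc, ha]
  · rw [StrictHom.comp_toHom, ← Category.assoc, hb]

variable (X Y) in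
/-- The direct sum of two objects, formed in each degree. -/
@[simps]
noncomputable abbrev sum : Tilt τ where
  Xm := X.Xm ⊞ Y.Xm
  X0 := X.X0 ⊞ Y.X0
  d := biprod.map X.d Y.d
  ker_mem := by
    rw [τ.F_kernel_iff]
    intro U hU t ht
    refine biprod.hom_ext _ _ ?_ ?_
    · simpa using X.eq_zero_of_T hU _ (by simpa using congr($ht ≫ biprod.fst))
    · simpa using Y.eq_zero_of_T hU _ (by simpa using congr($ht ≫ biprod.snd))
  coker_mem := by
    rw [τ.T_cokernel_iff]
    intro G hG s hs
    refine biprod.hom_ext' _ _ ?_ ?_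
    · simpa using X.eq_zero_of_F hG _ (by simpa using congr(biprod.inl ≫ $hs))
    · simpa using Y.eq_zero_of_F hG _ (by simpa using congr(biprod.inr ≫ $hs))

end Tilt

namespace StrictHom

variable (X Y : Tilt τ) {Z : Tilt τ}

/-- The first projection from the direct sum. -/
@[simps] noncomputable def fst : StrictHom (X.sum Y) X := ⟨biprod.fst, biprod.fst, by simp⟩
/-- The second projection from the direct sum. -/
@[simps] noncomputable def snd : StrictHom (X.sum Y) Y := ⟨biprod.snd, biprod.snd, by simp⟩
/-- The first inclusion into the direct sum. -/
@[simps] noncomputable def inl : StrictHom X (X.sum Y) := ⟨biprod.inl, biprod.inl, by simp⟩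
/-- The second inclusion into the direct sum. -/
@[simps] noncomputable def inr : StrictHom Y (X.sum Y) := ⟨biprod.inr, biprod.inr, by simp⟩

variable {X Y}

/-- The chain map to the direct sum with the given components. -/
@[simps] noncomputable def lift (f : StrictHom Z X) (g : StrictHom Z Y) :
    StrictHom Z (X.sum Y) :=
  ⟨biprod.lift f.fm g.fm, biprod.lift f.f0 g.f0, by dsimp; ext <;> simp [f.comm, g.comm]⟩

/-- The chain map from the direct sum with the given components. -/
@[simps] noncomputable def desc (f : StrictHom X Z) (g : StrictHom Y Z) :
    StrictHom (X.sum Y) Z :=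
  ⟨biprod.desc f.fm g.fm, biprod.desc f.f0 g.f0, by dsimp; ext <;> simp [f.comm, g.comm]⟩

lemma lift_fst (f : StrictHom Z X) (g : StrictHom Z Y) : (lift f g).comp (fst X Y) = f := by
  ext <;> simp
lemma lift_snd (f : StrictHom Z X) (g : StrictHom Z Y) : (lift f g).comp (snd X Y) = g := by
  ext <;> simp
lemma inl_desc (f : StrictHom X Z) (g : StrictHom Y Z) : (inl X Y).comp (desc f g) = f := by
  ext <;> simp
lemma inr_desc (f : StrictHom X Z) (g : StrictHom Y Z) : (inr X Y).comp (desc f g) = g := by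
  ext <;> simp

end StrictHom

namespace Tilt

variable {X Y Z : Tilt τ}

/-- After passing to a common roof both maps are chain maps. The equalities of components are two
homotopies, which combine into one with values in the direct sum. -/
lemma sum_hom_ext {f g : Z ⟶ X.sum Y}
    (h1 : f ≫ (StrictHom.fst X Y).toHom = g ≫ (StrictHom.fst X Y).toHom)
    (h2 : f ≫ (StrictHom.snd X Y).toHom = g ≫ (StrictHom.snd X Y).toHom) : f = g := by
  obtain ⟨Z', p, _, a, b, ha, hb⟩ := exists_roof₂ f g
  rw [← cancel_epi p.toHom, ← Category.assoc, ← Category.assoc, ha, hb, ← StrictHom.comp_toHom,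
    ← StrictHom.comp_toHom, StrictHom.toHom_eq_iff] at h1 h2
  rw [← cancel_epi p.toHom, ha, hb, StrictHom.toHom_eq_iff]
  obtain ⟨h, h1, h1'⟩ := h1
  obtain ⟨k, h2, h2'⟩ := h2
  simp only [StrictHom.comp_fm, StrictHom.comp_f0, StrictHom.fst_fm, StrictHom.fst_f0,
    StrictHom.snd_fm, StrictHom.snd_f0] at h1 h1' h2 h2'
  refine ⟨biprod.lift h k, ?_, ?_⟩
  · refine biprod.hom_ext _ _ ?_ ?_ <;> simp [h1, h2]
  · refine biprod.hom_ext _ _ ?_ ?_ <;> simp [h1', h2']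

lemma sum_hom_ext' {f g : X.sum Y ⟶ Z}
    (h1 : (StrictHom.inl X Y).toHom ≫ f = (StrictHom.inl X Y).toHom ≫ g)
    (h2 : (StrictHom.inr X Y).toHom ≫ f = (StrictHom.inr X Y).toHom ≫ g) : f = g := by
  obtain ⟨Z', q, _, a, b, ha, hb⟩ := exists_coroof₂ f g
  rw [← cancel_mono q.toHom, Category.assoc, Category.assoc, ha, hb, ← StrictHom.comp_toHom,
    ← StrictHom.comp_toHom, StrictHom.toHom_eq_iff] at h1 h2
  rw [← cancel_mono q.toHom, ha, hb, StrictHom.toHom_eq_iff]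
  obtain ⟨h, h1, h1'⟩ := h1
  obtain ⟨k, h2, h2'⟩ := h2
  simp only [StrictHom.comp_fm, StrictHom.comp_f0, StrictHom.inl_fm, StrictHom.inl_f0,
    StrictHom.inr_fm, StrictHom.inr_f0] at h1 h1' h2 h2'
  refine ⟨biprod.desc h k, ?_, ?_⟩
  · refine biprod.hom_ext' _ _ ?_ ?_ <;> simp [h1, h2]
  · refine biprod.hom_ext' _ _ ?_ ?_ <;> simp [h1', h2']

lemma exists_lift_sum (f : Z ⟶ X) (g : Z ⟶ Y) : ∃ l : Z ⟶ X.sum Y,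
    l ≫ (StrictHom.fst X Y).toHom = f ∧ l ≫ (StrictHom.snd X Y).toHom = g := by
  obtain ⟨Z', p, _, a, b, ha, hb⟩ := exists_roof₂ f g
  refine ⟨inv p.toHom ≫ (StrictHom.lift a b).toHom, ?_, ?_⟩
  · rw [Category.assoc, ← StrictHom.comp_toHom, StrictHom.lift_fst, ← ha, IsIso.inv_hom_id_assoc]
  · rw [Category.assoc, ← StrictHom.comp_toHom, StrictHom.lift_snd, ← hb, IsIso.inv_hom_id_assoc]

lemma exists_desc_sum (f : X ⟶ Z) (g : Y ⟶ Z) : ∃ l : X.sum Y ⟶ Z,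
    (StrictHom.inl X Y).toHom ≫ l = f ∧ (StrictHom.inr X Y).toHom ≫ l = g := by
  obtain ⟨Z', q, _, a, b, ha, hb⟩ := exists_coroof₂ f g
  refine ⟨(StrictHom.desc a b).toHom ≫ inv q.toHom, ?_, ?_⟩
  · rw [← Category.assoc, ← StrictHom.comp_toHom, StrictHom.inl_desc, ← ha, Category.assoc,
      IsIso.hom_inv_id, Category.comp_id]
  · rw [← Category.assoc, ← StrictHom.comp_toHom, StrictHom.inr_desc, ← hb, Category.assoc,
      IsIso.hom_inv_id, Category.comp_id]

instance : HasBinaryProducts (Tilt τ) := by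
  have (X Y : Tilt τ) : HasLimit (pair X Y) := by
    refine ⟨⟨⟨BinaryFan.mk (StrictHom.fst X Y).toHom (StrictHom.snd X Y).toHom, ?_⟩⟩⟩
    refine BinaryFan.IsLimit.mk _ (fun f g => (exists_lift_sum f g).choose)
      (fun f g => (exists_lift_sum f g).choose_spec.1)
      (fun f g => (exists_lift_sum f g).choose_spec.2) (fun f g m h1 h2 => sum_hom_ext ?_ ?_)
    · exact h1.trans (exists_lift_sum f g).choose_spec.1.symm
    · exact h2.trans (exists_lift_sum f g).choose_spec.2.symm
  exact hasBinaryProducts_of_hasLimit_pair _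

instance : HasBinaryCoproducts (Tilt τ) := by
  have (X Y : Tilt τ) : HasColimit (pair X Y) := by
    refine ⟨⟨⟨BinaryCofan.mk (StrictHom.inl X Y).toHom (StrictHom.inr X Y).toHom, ?_⟩⟩⟩
    refine BinaryCofan.IsColimit.mk _ (fun f g => (exists_desc_sum f g).choose)
      (fun f g => (exists_desc_sum f g).choose_spec.1)
      (fun f g => (exists_desc_sum f g).choose_spec.2) (fun f g m h1 h2 => sum_hom_ext' ?_ ?_)
    · exact h1.trans (exists_desc_sum f g).choose_spec.1.symm
    · exact h2.trans (exists_desc_sum f g).choose_spec.2.symm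
  exact hasBinaryCoproducts_of_hasColimit_pair _

/-- A null homotopy of the identity is the same thing as an inverse of `d`. -/
lemma isZero_iff (X : Tilt τ) : IsZero X ↔ IsIso X.d := by
  let _ : HasZeroMorphisms (Tilt τ) := hasZeroMorphisms
  rw [IsZero.iff_id_eq_zero, ← StrictHom.id_toHom, ← StrictHom.zero_toHom, eq_comm,
    StrictHom.toHom_eq_iff]
  constructor
  · rintro ⟨h, h1, h2⟩
    exact ⟨h, by simpa using h1.symm, by simpa using h2.symm⟩
  · intro _
    exact ⟨inv X.d, by simp, by simp⟩

/-- The object with zero components. -/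
@[simps] noncomputable abbrev zero (τ : TorsionPair A) : Tilt τ where
  Xm := 0
  X0 := 0
  d := 0
  ker_mem := (τ.F_kernel_iff _).2 fun _ _ _ _ => (isZero_zero A).eq_of_tgt _ _
  coker_mem := (τ.T_cokernel_iff _).2 fun _ _ _ _ => (isZero_zero A).eq_of_src _ _

lemma zero_isStrictlyZero (τ : TorsionPair A) : (zero τ).IsStrictlyZero :=
  ⟨isZero_zero A, isZero_zero A⟩

instance : HasZeroObject (Tilt τ) :=
  let _ : HasZeroMorphisms (Tilt τ) := hasZeroMorphisms
  ⟨zero τ, (zero_isStrictlyZero τ).isZero⟩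

instance : HasFiniteProducts (Tilt τ) := hasFiniteProducts_of_has_binary_and_terminal
instance : HasFiniteCoproducts (Tilt τ) := hasFiniteCoproducts_of_has_binary_and_initial

end Tilt

end HRS

/-! ### The tilted category is abelian. -/

namespace HRS

/-- A category with zero morphisms in which every morphism is the composite of a cokernel of its
kernel and a kernel of its cokernel. -/
lemma exists_abelian_of_factorization (C : Type*) [Category C] [HasZeroMorphisms C]
    [HasZeroObject C] [HasFiniteProducts C] [HasFiniteCoproducts C]
    (H : ∀ {X Y : C} (f : X ⟶ Y), ∃ (K I Q : C) (k : K ⟶ X) (e : X ⟶ I) (m : I ⟶ Y) (q : Y ⟶ Q)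
      (w₁ : k ≫ e = 0) (w₂ : m ≫ q = 0), e ≫ m = f ∧
      Nonempty (IsLimit (KernelFork.ofι k w₁)) ∧ Nonempty (IsColimit (CokernelCofork.ofπ e w₁)) ∧
      Nonempty (IsLimit (KernelFork.ofι m w₂)) ∧ Nonempty (IsColimit (CokernelCofork.ofπ q w₂))) :
    Nonempty (Abelian C) := by
  have lift_of {K X I : C} {k : K ⟶ X} {e : X ⟶ I} {w : k ≫ e = 0}
      (h : IsLimit (KernelFork.ofι k w)) {U : C} (t : U ⟶ X) (ht : t ≫ e = 0) :
      ∃ l : U ⟶ K, l ≫ k = t :=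
    ⟨(KernelFork.IsLimit.lift' h t ht).1, (KernelFork.IsLimit.lift' h t ht).2⟩
  have desc_of {K X I : C} {k : K ⟶ X} {e : X ⟶ I} {w : k ≫ e = 0}
      (h : IsColimit (CokernelCofork.ofπ e w)) {U : C} (t : X ⟶ U) (ht : k ≫ t = 0) :
      ∃ l : I ⟶ U, e ≫ l = t :=
    ⟨(CokernelCofork.IsColimit.desc' h t ht).1, (CokernelCofork.IsColimit.desc' h t ht).2⟩
  have mono_of {K X I : C} {k : K ⟶ X} {e : X ⟶ I} {w : k ≫ e = 0}
      (h : IsLimit (KernelFork.ofι k w)) : Mono k := mono_of_isLimit_fork h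
  have epi_of {K X I : C} {k : K ⟶ X} {e : X ⟶ I} {w : k ≫ e = 0}
      (h : IsColimit (CokernelCofork.ofπ e w)) : Epi e := epi_of_isColimit_cofork h
  have hker : HasKernels C := ⟨fun f => by
    obtain ⟨K, I, Q, k, e, m, q, w₁, w₂, rfl, ⟨h₁⟩, ⟨h₂⟩, ⟨h₃⟩, ⟨h₄⟩⟩ := H f
    have := mono_of h₃
    exact ⟨_, isKernelCompMono h₁ m rfl⟩⟩
  have hcoker : HasCokernels C := ⟨fun f => by
    obtain ⟨K, I, Q, k, e, m, q, w₁, w₂, rfl, ⟨h₁⟩, ⟨h₂⟩, ⟨h₃⟩, ⟨h₄⟩⟩ := H f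
    have := epi_of h₂
    exact ⟨_, isCokernelEpiComp h₄ e rfl⟩⟩
  have hmono {X Y : C} (f : X ⟶ Y) [Mono f] : Nonempty (NormalMono f) := by
    obtain ⟨K, I, Q, k, e, m, q, w₁, w₂, hf, ⟨h₁⟩, ⟨h₂⟩, ⟨h₃⟩, ⟨h₄⟩⟩ := H f
    have hm := mono_of h₃
    have he := epi_of h₂
    -- A monomorphism has zero kernel, so `e` is a cokernel of zero and hence invertible; `f` is
    -- then a kernel because `m` is one.
    have hk : k = 0 := by
      rw [← cancel_mono f, ← hf, reassoc_of% w₁, zero_comp, zero_comp]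
    obtain ⟨l, hl⟩ := desc_of h₂ (𝟙 X) (by rw [hk, zero_comp])
    have hl' : l ≫ e = 𝟙 I := by
      rw [← cancel_epi e, reassoc_of% hl, Category.comp_id]
    have hm' : m = l ≫ f := by rw [← hf, reassoc_of% hl']
    refine ⟨⟨Q, q, by rw [← hf, Category.assoc, w₂, comp_zero], ?_⟩⟩
    refine KernelFork.IsLimit.ofι _ _ (fun t ht => (lift_of h₃ t ht).choose ≫ l) ?_ ?_
    · intro U t ht
      rw [Category.assoc, ← hm', (lift_of h₃ t ht).choose_spec]
    · intro U t ht a ha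
      rw [← cancel_mono f, ha, Category.assoc, ← hm', (lift_of h₃ t ht).choose_spec]
  have hepi {X Y : C} (f : X ⟶ Y) [Epi f] : Nonempty (NormalEpi f) := by
    obtain ⟨K, I, Q, k, e, m, q, w₁, w₂, hf, ⟨h₁⟩, ⟨h₂⟩, ⟨h₃⟩, ⟨h₄⟩⟩ := H f
    have hm := mono_of h₃
    have he := epi_of h₂
    have hq : q = 0 := by
      rw [← cancel_epi f, ← hf, Category.assoc, w₂, comp_zero, comp_zero]
    obtain ⟨l, hl⟩ := lift_of h₃ (𝟙 Y) (by rw [hq, comp_zero])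
    have hl' : m ≫ l = 𝟙 I := by
      rw [← cancel_mono m, Category.assoc, hl, Category.comp_id, Category.id_comp]
    have he' : e = f ≫ l := by rw [← hf, Category.assoc, hl', Category.comp_id]
    refine ⟨⟨K, k, by rw [← hf, reassoc_of% w₁, zero_comp], ?_⟩⟩
    refine CokernelCofork.IsColimit.ofπ _ _ (fun t ht => l ≫ (desc_of h₂ t ht).choose) ?_ ?_
    · intro U t ht
      rw [← Category.assoc, ← he', (desc_of h₂ t ht).choose_spec]
    · intro U t ht a ha
      rw [← cancel_epi f, ha, ← Category.assoc, ← he', (desc_of h₂ t ht).choose_spec]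
  -- No addition has to be supplied: it is recovered from the finite products and coproducts and the
  -- normality of monomorphisms and epimorphisms.
  let _ : NonPreadditiveAbelian C :=
    { normalMonoOfMono := hmono
      normalEpiOfEpi := hepi }
  exact ⟨NonPreadditiveAbelian.abelian C⟩

variable {A : Type u} [Category.{v} A] [Abelian A] {τ : TorsionPair A}

attribute [local instance] Tilt.hasZeroMorphisms

namespace Tilt

/-- A factorization `Y⁻¹ ⟶ W ⟶ Y⁰` of the differential of `Y` such that `[Y⁻¹ ⟶ W]` and
`[W ⟶ Y⁰]` are objects of the tilted category. -/
structure Fac (Y : Tilt τ) where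
  W : A
  w : Y.Xm ⟶ W
  j : W ⟶ Y.X0
  fac : w ≫ j = Y.d
  coker_mem : ∀ G : A, τ.F G → ∀ s : W ⟶ G, w ≫ s = 0 → s = 0
  ker_mem : ∀ U : A, τ.T U → ∀ t : U ⟶ W, t ≫ j = 0 → t = 0

namespace Fac

variable {Y : Tilt τ} (W : Y.Fac)

/-- The subobject `[Y⁻¹ ⟶ W]` of `Y`. -/
@[simps] abbrev sub : Tilt τ where
  Xm := Y.Xm
  X0 := W.W
  d := W.w
  ker_mem := (τ.F_kernel_iff _).2 fun U hU t ht => Y.eq_zero_of_T hU t (by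
    rw [← W.fac, reassoc_of% ht, zero_comp])
  coker_mem := (τ.T_cokernel_iff _).2 W.coker_mem

/-- The quotient `[W ⟶ Y⁰]` of `Y`. -/
@[simps] abbrev quot : Tilt τ where
  Xm := W.W
  X0 := Y.X0
  d := W.j
  ker_mem := (τ.F_kernel_iff _).2 W.ker_mem
  coker_mem := (τ.T_cokernel_iff _).2 fun G hG s hs => Y.eq_zero_of_F hG s (by
    rw [← W.fac, Category.assoc, hs, comp_zero])

/-- The inclusion of the subobject. -/
@[simps] def inc : StrictHom W.sub Y := ⟨𝟙 _, W.j, by simp [W.fac]⟩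

/-- The projection to the quotient. -/
@[simps] def proj : StrictHom Y W.quot := ⟨W.w, 𝟙 _, by simp [W.fac]⟩

/-- The identity of `W` is a null homotopy of the composite chain map. -/
lemma inc_proj : W.inc.toHom ≫ W.proj.toHom = (StrictHom.zero _ _).toHom := by
  rw [← StrictHom.comp_toHom, eq_comm, StrictHom.toHom_eq_iff]
  exact ⟨𝟙 _, by simp, by simp⟩

/-- The composite of a butterfly with the inclusion. -/
@[simps] abbrev compInc {U : Tilt τ} (G : Butterfly U W.sub) : Butterfly U Y where
  E := G.E
  κ := G.κ
  ι := G.ι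
  σ := G.σ
  ρ := G.ρ ≫ W.j
  κ_σ := by simp
  ι_ρ := by simp [W.fac]
  κ_ρ := by simp
  ι_σ := G.ι_σ
  exact := G.exact

lemma toHom_comp_inc {U : Tilt τ} (G : Butterfly U W.sub) :
    G.toHom ≫ W.inc.toHom = (W.compInc G).toHom :=
  Butterfly.comp_toHom_eq (𝟙 _) (by simp) (by simp) (by simp) (by simp)

/-- The composite of the projection with a butterfly. -/
@[simps] abbrev projComp {U : Tilt τ} (G : Butterfly W.quot U) : Butterfly Y U where
  E := G.E
  κ := W.w ≫ G.κ
  ι := G.ι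
  σ := G.σ
  ρ := G.ρ
  κ_σ := by simp [W.fac]
  ι_ρ := by simp
  κ_ρ := by simp
  ι_σ := G.ι_σ
  exact := G.exact

lemma proj_comp_toHom {U : Tilt τ} (G : Butterfly W.quot U) :
    W.proj.toHom ≫ G.toHom = (W.projComp G).toHom :=
  Butterfly.toHom_comp_eq (𝟙 _) (by simp) (by simp) (by simp) (by simp)

instance : Mono W.inc.toHom where
  right_cancellation {U} f g h := by
    obtain ⟨G, rfl⟩ := Butterfly.exists_toHom f
    obtain ⟨G', rfl⟩ := Butterfly.exists_toHom g
    rw [toHom_comp_inc, toHom_comp_inc, Butterfly.toHom_eq_iff] at h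
    obtain ⟨φ, h⟩ := h
    have hκ : G.κ ≫ φ.hom = G'.κ := h.κ
    have hι : G.ι ≫ φ.hom = G'.ι := h.ι
    have hρ : φ.hom ≫ G'.ρ ≫ W.j = G.ρ ≫ W.j := h.ρ
    rw [Butterfly.toHom_eq_iff]
    refine ⟨φ, hκ, hι, h.σ, ?_⟩
    -- Composition with the inclusion changes only `ρ`. The defect of `φ` on `ρ` vanishes on `ι`, so
    -- it is a map `U⁰ ⟶ W`, which kills `d_U` and is killed by `j`; hence it is zero.
    obtain ⟨s, hs⟩ := G.exists_desc_σ (φ.hom ≫ G'.ρ - G.ρ) (by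
      rw [Preadditive.comp_sub, reassoc_of% hι, Butterfly.ι_ρ, Butterfly.ι_ρ, sub_self])
    have : s = 0 := U.comp_eq_zero W.j W.quot.ker_mem s
      (by rw [← Butterfly.κ_σ_assoc, hs, Preadditive.comp_sub, reassoc_of% hκ]; simp)
      (by rw [← cancel_epi G.σ, reassoc_of% hs]; simp [hρ])
    rw [this, comp_zero] at hs
    exact (sub_eq_zero.1 hs.symm)

instance : Epi W.proj.toHom where
  left_cancellation {U} f g h := by
    obtain ⟨G, rfl⟩ := Butterfly.exists_toHom f
    obtain ⟨G', rfl⟩ := Butterfly.exists_toHom g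
    rw [proj_comp_toHom, proj_comp_toHom, Butterfly.toHom_eq_iff] at h
    obtain ⟨φ, h⟩ := h
    have hκ : (W.w ≫ G.κ) ≫ φ.hom = W.w ≫ G'.κ := h.κ
    have hσ : φ.hom ≫ G'.σ = G.σ := h.σ
    have hρ : φ.hom ≫ G'.ρ = G.ρ := h.ρ
    rw [Butterfly.toHom_eq_iff]
    refine ⟨φ, ?_, h.ι, hσ, hρ⟩
    -- Dually only `κ` changes, and its defect is a map `W ⟶ U⁻¹` that kills `w` and is killed by
    -- `d_U`.
    obtain ⟨y, hy⟩ := G'.exists_lift (G.κ ≫ φ.hom - G'.κ) (by simp [hσ])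
    have : y = 0 := W.sub.comp_eq_zero U.d U.ker_mem y
      (by rw [← cancel_mono G'.ι, Category.assoc, hy, Preadditive.comp_sub]
          simpa [sub_eq_zero] using hκ)
      (by rw [← Butterfly.ι_ρ G', reassoc_of% hy]; simp [hρ])
    rw [this, zero_comp] at hy
    exact (sub_eq_zero.1 hy.symm)

/-- Lifting a butterfly along the inclusion means lifting its leg `ρ` along `j : W ⟶ Y⁰`. A null
composite with the projection is a link into a split middle object, and minus its component in `W`
is the required lift. -/
lemma exists_lift {U : Tilt τ} (f : U ⟶ Y) (hf : f ≫ W.proj.toHom = (StrictHom.zero _ _).toHom) :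
    ∃ l : U ⟶ W.sub, l ≫ W.inc.toHom = f := by
  obtain ⟨G, rfl⟩ := Butterfly.exists_toHom f
  change G.toHom ≫ W.proj.butterfly.toHom = _ at hf
  obtain ⟨r, s, hs⟩ := Butterfly.exists_splits W.proj
  generalize W.proj.butterfly = C at hf r s hs
  obtain ⟨δ, h⟩ := Butterfly.exists_isLink hf
  have h1 := congr($(h.ι) ≫ r)
  have h2 := congr($(h.κ) ≫ r)
  have h3 := h.ρ
  rw [hs.κ_r, Category.assoc] at h1
  rw [hs.ρ_eq, Preadditive.comp_add, reassoc_of% h.σ] at h3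
  have h1' : G.ι ≫ (-(δ ≫ r)) = W.w := by simp [h1]
  have h3' : (-(δ ≫ r)) ≫ W.j = G.ρ := by
    simp only [proj_f0, Category.comp_id] at h3
    rw [Preadditive.neg_comp, Category.assoc, neg_eq_iff_add_eq_zero, add_comm]
    exact h3
  let G' : Butterfly U W.sub :=
    { E := G.E, κ := G.κ, ι := G.ι, σ := G.σ, ρ := -(δ ≫ r)
      κ_σ := by simp
      ι_ρ := h1'
      κ_ρ := by simpa using h2
      ι_σ := G.ι_σ
      exact := G.exact }
  refine ⟨G'.toHom, ?_⟩
  rw [toHom_comp_inc]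
  congr 1
  cases G
  simp only [G', compInc, h3']

/-- Dually, the leg `κ` has to be extended along `w : Y⁻¹ ⟶ W`, and the link restricted to the
summand `W` of the split middle object is the extension. -/
lemma exists_desc {U : Tilt τ} (f : Y ⟶ U) (hf : W.inc.toHom ≫ f = (StrictHom.zero _ _).toHom) :
    ∃ l : W.quot ⟶ U, W.proj.toHom ≫ l = f := by
  obtain ⟨G, rfl⟩ := Butterfly.exists_toHom f
  change W.inc.butterfly.toHom ≫ G.toHom = _ at hf
  obtain ⟨r, s, hs⟩ := Butterfly.exists_splits W.inc
  generalize W.inc.butterfly = J at hf r s hs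
  obtain ⟨δ, h⟩ := Butterfly.exists_isLink hf
  have h1 := h.κ
  rw [hs.κ_eq, Preadditive.sub_comp, Category.assoc, Category.assoc, h.ι, sub_eq_zero] at h1
  have h1' : W.w ≫ s ≫ δ = G.κ := by simpa using h1
  have h2 : (s ≫ δ) ≫ G.σ = W.j := by rw [Category.assoc, h.σ, hs.s_ρ]; rfl
  let G' : Butterfly W.quot U :=
    { E := G.E, κ := s ≫ δ, ι := G.ι, σ := G.σ, ρ := G.ρ
      κ_σ := h2
      ι_ρ := by simp
      κ_ρ := by simp [h.ρ]
      ι_σ := G.ι_σ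
      exact := G.exact }
  refine ⟨G'.toHom, ?_⟩
  rw [proj_comp_toHom]
  congr 1
  cases G
  simp only [G', projComp, h1']

/-- The subobject is the kernel of the projection. -/
noncomputable def isKernel : IsLimit (KernelFork.ofι W.inc.toHom W.inc_proj) :=
  KernelFork.IsLimit.ofι _ _ (fun t ht => (W.exists_lift t ht).choose)
    (fun t ht => (W.exists_lift t ht).choose_spec)
    (fun t ht a ha => by rw [← cancel_mono W.inc.toHom, ha, (W.exists_lift t ht).choose_spec])

/-- The quotient is the cokernel of the inclusion. -/
noncomputable def isCokernel : IsColimit (CokernelCofork.ofπ W.proj.toHom W.inc_proj) :=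
  CokernelCofork.IsColimit.ofπ _ _ (fun t ht => (W.exists_desc t ht).choose)
    (fun t ht => (W.exists_desc t ht).choose_spec)
    (fun t ht a ha => by rw [← cancel_epi W.proj.toHom, ha, (W.exists_desc t ht).choose_spec])

end Fac

end Tilt

namespace Butterfly

variable {X Y : Tilt τ}

/-- A short exact sequence `R ⟶ E ⟶ C` through which the second diagonal of a butterfly
factors and which gives the image factorization of the butterfly. -/
structure ImageFac (P : Butterfly X Y) where
  R : A
  C : A
  k : X.Xm ⟶ R
  i : R ⟶ P.E
  p : P.E ⟶ C
  c : C ⟶ Y.X0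
  k_i : k ≫ i = P.κ
  p_c : p ≫ c = P.ρ
  i_p : i ≫ p = 0
  exact : (ShortComplex.mk i p i_p).ShortExact
  coker_mem : ∀ G : A, τ.F G → ∀ s : R ⟶ G, k ≫ s = 0 → s = 0
  ker_mem : ∀ U : A, τ.T U → ∀ t : U ⟶ C, t ≫ c = 0 → t = 0

namespace ImageFac

variable {P : Butterfly X Y} (I : P.ImageFac)

/-- The factorization of the differential of `X` which gives the kernel of the butterfly. -/
@[simps] abbrev facX : X.Fac where
  W := I.R
  w := I.k
  j := I.i ≫ P.σ
  fac := by rw [reassoc_of% I.k_i, κ_σ]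
  coker_mem := I.coker_mem
  ker_mem U hU t ht := by
    have : Mono I.i := I.exact.mono_f
    obtain ⟨y, hy⟩ := P.exists_lift (t ≫ I.i) (by simpa using ht)
    rw [← cancel_mono I.i, zero_comp, ← hy, Y.eq_zero_of_T hU y, zero_comp]
    rw [← P.ι_ρ, reassoc_of% hy, ← I.p_c, reassoc_of% I.i_p, zero_comp, comp_zero]

/-- The factorization of the differential of `Y` which gives the cokernel of the butterfly. -/
@[simps] abbrev facY : Y.Fac where
  W := I.C
  w := P.ι ≫ I.p
  j := I.c
  fac := by rw [Category.assoc, I.p_c, ι_ρ]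
  coker_mem G hG s hs := by
    have : Epi I.p := I.exact.epi_g
    obtain ⟨x, hx⟩ := P.exists_desc_σ (I.p ≫ s) (by simpa using hs)
    rw [← cancel_epi I.p, comp_zero, ← hx, X.eq_zero_of_F hG x, comp_zero]
    rw [← P.κ_σ, Category.assoc, hx, ← I.k_i, Category.assoc, reassoc_of% I.i_p, zero_comp,
      comp_zero]
  ker_mem := I.ker_mem

/-- The isomorphism from the coimage to the image. -/
@[simps] abbrev coimToIm : Butterfly I.facX.quot I.facY.sub where
  E := P.E
  κ := I.i
  ι := P.ι
  σ := P.σ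
  ρ := I.p
  κ_σ := rfl
  ι_ρ := rfl
  κ_ρ := I.i_p
  ι_σ := P.ι_σ
  exact := P.exact

instance : IsIso I.coimToIm.toHom := I.coimToIm.isIso_toHom I.exact

lemma factorization :
    I.facX.proj.toHom ≫ I.coimToIm.toHom ≫ I.facY.inc.toHom = P.toHom := by
  rw [Tilt.Fac.toHom_comp_inc, Tilt.Fac.proj_comp_toHom]
  congr 1
  have h1 := I.k_i
  have h2 := I.p_c
  cases P
  simp only [Tilt.Fac.projComp, Tilt.Fac.compInc, coimToIm, facX, facY] at h1 h2 ⊢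
  simp only [h1, h2]

end ImageFac

/-- Let `T'` be the torsion part of `ker ρ / im κ` and `F'` the quotient. Taking for `R` the
preimage of `T'` in `ker ρ` makes the cokernel of `X⁻¹ ⟶ R` equal to `T'` and the kernel of `E / R ⟶
Y⁰` equal to `F'`. Below, `R` is the kernel of `q : ker ρ ⟶ F'`. -/
lemma exists_imageFac (P : Butterfly X Y) : Nonempty P.ImageFac := by
  let k : X.Xm ⟶ kernel P.ρ := kernel.lift P.ρ P.κ P.κ_ρ
  obtain ⟨T', F', i, p, w, hT, hF, hS⟩ := τ.exists_shortExact (cokernel k)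
  have hmi : Mono i := hS.mono_f
  let q : kernel P.ρ ⟶ F' := cokernel.π k ≫ p
  let l : kernel q ⟶ P.E := kernel.ι q ≫ kernel.ι P.ρ
  have hkq : k ≫ q = 0 := by simp [q]
  have hc : l ≫ P.ρ = 0 := by simp [l]
  refine ⟨
    { R := kernel q
      C := cokernel l
      k := kernel.lift q k hkq
      i := l
      p := cokernel.π l
      c := cokernel.desc l P.ρ hc
      k_i := by simp [l, k]
      p_c := by simp
      i_p := by simp
      exact := { exact := ShortComplex.exact_cokernel l, mono_f := by dsimp; infer_instance }
      coker_mem := ?_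
      ker_mem := ?_ }⟩
  · intro G hG s hs
    -- The surjection `R ⟶ T'`. Its kernel is the image of `X⁻¹`, so a map that vanishes on `X⁻¹`
    -- descends to `T' ⟶ G`, which is zero.
    obtain ⟨b, hb⟩ : ∃ b : kernel q ⟶ T', b ≫ i = kernel.ι q ≫ cokernel.π k :=
      ⟨hS.exact.lift (kernel.ι q ≫ cokernel.π k) ((Category.assoc _ _ _).trans (kernel.condition q)),
        hS.exact.lift_f _ _⟩
    have hbe : Epi b := by
      rw [epi_iff_surjective_up_to_refinements]
      intro U t
      obtain ⟨U', e, he, x, hx⟩ := surjective_up_to_refinements_of_epi (cokernel.π k) (t ≫ i)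
      refine ⟨U', e, he, kernel.lift q x ?_, ?_⟩
      · rw [← Category.assoc, ← hx, Category.assoc, Category.assoc, w, comp_zero, comp_zero]
      · rw [← cancel_mono i, Category.assoc, Category.assoc, hb, kernel.lift_ι_assoc, ← hx]
    have hbs : kernel.ι b ≫ s = 0 := by
      have hE : (ShortComplex.mk k (cokernel.π k) (by simp)).Exact :=
        ShortComplex.exact_cokernel k
      rw [ShortComplex.exact_iff_exact_up_to_refinements] at hE
      obtain ⟨U', e, he, x, hx⟩ := hE (kernel.ι b ≫ kernel.ι q) (by
        dsimp
        rw [Category.assoc, ← hb, kernel.condition_assoc, zero_comp])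
      dsimp at hx
      have : e ≫ kernel.ι b = x ≫ kernel.lift q k hkq := by
        rw [← cancel_mono (kernel.ι q)]
        simpa using hx
      rw [← cancel_epi e, reassoc_of% this, hs, comp_zero, comp_zero]
    rw [← Abelian.comp_epiDesc b s hbs, τ.hom_eq_zero hT hG (Abelian.epiDesc b s hbs), comp_zero]
  · intro U hU t ht
    -- After the cover `a` of `U`, the map `t` lifts to `E`, and the lift `e` lies in `ker ρ`. Two
    -- lifts differ by an element of `R`, so the class of `e` in `F'` descends to a map `U ⟶ F'`; it
    -- is zero, whence `e` lies in `R`.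
    let a : pullback t (cokernel.π l) ⟶ U := pullback.fst _ _
    let e : pullback t (cokernel.π l) ⟶ P.E := pullback.snd _ _
    have hae : a ≫ t = e ≫ cokernel.π l := pullback.condition
    have ha : Epi a := inferInstanceAs (Epi (pullback.fst _ _))
    have he : e ≫ P.ρ = 0 := by
      have : e ≫ cokernel.π l ≫ cokernel.desc l P.ρ hc = 0 := by
        rw [← reassoc_of% hae, ht, comp_zero]
      simpa using this
    have key : kernel.ι a ≫ kernel.lift P.ρ e he ≫ q = 0 := by
      have h1 : (kernel.ι a ≫ e) ≫ cokernel.π l = 0 := by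
        rw [Category.assoc, ← hae, kernel.condition_assoc, zero_comp]
      have h2 := Abelian.monoLift_comp l (kernel.ι a ≫ e) h1
      have h3 : kernel.ι a ≫ kernel.lift P.ρ e he = Abelian.monoLift l _ h1 ≫ kernel.ι q := by
        rw [← cancel_mono (kernel.ι P.ρ)]
        rw [Category.assoc, kernel.lift_ι, Category.assoc]
        exact h2.symm
      rw [reassoc_of% h3, kernel.condition, comp_zero]
    have hz : kernel.lift P.ρ e he ≫ q = 0 := by
      rw [← Abelian.comp_epiDesc a _ key, τ.hom_eq_zero hU hF (Abelian.epiDesc a _ key), comp_zero]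
    have he' : e = kernel.lift q (kernel.lift P.ρ e he) hz ≫ l := by simp [l]
    rw [← cancel_epi a, hae, he', Category.assoc, cokernel.condition, comp_zero, comp_zero]

end Butterfly

theorem exists_abelian_tilt (τ : TorsionPair A) : Nonempty (Abelian (Tilt τ)) := by
  apply exists_abelian_of_factorization
  intro X Y f
  obtain ⟨P, rfl⟩ := Butterfly.exists_toHom f
  obtain ⟨I⟩ := P.exists_imageFac
  refine ⟨_, _, _, I.facX.inc.toHom, I.facX.proj.toHom ≫ I.coimToIm.toHom, I.facY.inc.toHom,
    I.facY.proj.toHom, ?_, I.facY.inc_proj, ?_, ⟨?_⟩, ⟨?_⟩, ⟨I.facY.isKernel⟩,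
    ⟨I.facY.isCokernel⟩⟩
  · rw [← Category.assoc, I.facX.inc_proj]
    exact zero_comp
  · rw [Category.assoc, I.factorization]
  · exact isKernelCompMono I.facX.isKernel I.coimToIm.toHom rfl
  -- The projection to the coimage is a cokernel of the kernel, and it remains one after the
  -- isomorphism from the coimage to the image.
  · refine CokernelCofork.IsColimit.ofπ _ _
      (fun t ht => inv I.coimToIm.toHom ≫ (I.facX.exists_desc t ht).choose) ?_ ?_
    · intro U t ht
      rw [Category.assoc, IsIso.hom_inv_id_assoc, (I.facX.exists_desc t ht).choose_spec]
    · intro U t ht a ha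
      rw [← cancel_epi (I.facX.proj.toHom ≫ I.coimToIm.toHom), ha, Category.assoc,
        IsIso.hom_inv_id_assoc, (I.facX.exists_desc t ht).choose_spec]

end HRS

/-! ### The addition of morphisms in terms of chain maps. -/

namespace HRS

variable {A : Type u} [Category.{v} A] [Abelian A] {τ : TorsionPair A}

namespace StrictHom

variable {X Y Z : Tilt τ}

/-- The sum of two chain maps. -/
@[simps] def add (f g : StrictHom X Y) : StrictHom X Y :=
  ⟨f.fm + g.fm, f.f0 + g.f0, by simp [f.comm, g.comm]⟩

/-- The multiplication by a sign. -/
@[simps] def sign (X : Tilt τ) (ε : ℤˣ) : StrictHom X X :=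
  ⟨ε • 𝟙 _, ε • 𝟙 _, by simp⟩

variable [Preadditive (Tilt τ)]

lemma sum_total (X Y : Tilt τ) : (fst X Y).toHom ≫ (inl X Y).toHom +
    (snd X Y).toHom ≫ (inr X Y).toHom = 𝟙 (X.sum Y) := by
  have h1 : (inl X Y).comp (fst X Y) = StrictHom.id X := by ext <;> simp
  have h2 : (inl X Y).comp (snd X Y) = StrictHom.zero X Y := by ext <;> simp
  have h3 : (inr X Y).comp (snd X Y) = StrictHom.id Y := by ext <;> simp
  have h4 : (inr X Y).comp (fst X Y) = StrictHom.zero Y X := by ext <;> simp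
  apply Tilt.sum_hom_ext
  · simp only [Preadditive.add_comp, Category.assoc, ← comp_toHom _ (fst X Y), h1, h4]
    simp [id_toHom, zero_toHom]
  · simp only [Preadditive.add_comp, Category.assoc, ← comp_toHom _ (snd X Y), h2, h3]
    simp [id_toHom, zero_toHom]

/-- The addition of a preadditive category is determined by its biproducts, and the degreewise
direct sums are biproducts. Hence the formula holds for every preadditive structure on the tilted
category. -/
lemma add_toHom (f g : StrictHom X Y) : (f.add g).toHom = f.toHom + g.toHom := by
  have h : f.add g = (lift f g).comp (desc (StrictHom.id Y) (StrictHom.id Y)) := by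
    ext <;> simp [biprod.lift_desc]
  rw [h, comp_toHom, ← Category.id_comp ((desc _ _).toHom), ← sum_total]
  simp only [Preadditive.add_comp, Preadditive.comp_add, Category.assoc]
  rw [← comp_toHom (inl Y Y), ← comp_toHom (inr Y Y), inl_desc, inr_desc, ← Category.assoc,
    ← Category.assoc _ (snd Y Y).toHom, ← comp_toHom (lift f g), ← comp_toHom (lift f g), lift_fst,
    lift_snd, id_toHom, Category.comp_id, Category.comp_id]

lemma sign_toHom (X : Tilt τ) (ε : ℤˣ) : (sign X ε).toHom = ε • 𝟙 X := by
  obtain rfl | rfl := Int.units_eq_one_or ε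
  · rw [one_smul, ← id_toHom]
    congr 1
    ext <;> simp
  · have h : (StrictHom.id X).add (sign X (-1)) = StrictHom.zero X X := by
      ext <;> simp [Units.smul_def]
    have := congr(StrictHom.toHom $h)
    rw [add_toHom, zero_toHom, id_toHom, add_comm, ← eq_neg_iff_add_eq_zero] at this
    rw [this, Units.smul_def]
    simp

end StrictHom

namespace Butterfly

variable {X Y X' Y' : Tilt τ} [Preadditive (Tilt τ)]

/-- A square of butterflies over a pair of chain maps which commutes up to a chain map. -/
lemma comp_add_eq (P : Butterfly X Y) (P' : Butterfly X' Y') (f : StrictHom X X')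
    (g : StrictHom Y Y') (k : StrictHom X Y') (φ : P.E ⟶ P'.E)
    (hκ : P.κ ≫ φ = f.fm ≫ P'.κ + k.fm ≫ P'.ι) (hι : P.ι ≫ φ = g.fm ≫ P'.ι)
    (hσ : φ ≫ P'.σ = P.σ ≫ f.f0) (hρ : φ ≫ P'.ρ = P.ρ ≫ g.f0 + P.σ ≫ k.f0) :
    P.toHom ≫ g.toHom + k.toHom = f.toHom ≫ P'.toHom := by
  -- Over the roof of `P` the left-hand side is the class of a single chain map, so a comparison map
  -- for one composite suffices.
  rw [← cancel_epi P.roofFst.toHom, Preadditive.comp_add, ← Category.assoc, roofFst_comp,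
    ← Category.assoc, ← StrictHom.comp_toHom, ← StrictHom.comp_toHom, ← StrictHom.comp_toHom,
    ← StrictHom.add_toHom]
  symm
  set s := (P.roofSnd.comp g).add (P.roofFst.comp k) with hs
  have hsm : s.fm = biprod.snd ≫ g.fm + biprod.fst ≫ k.fm := by simp [hs]
  have hs0 : s.f0 = P.ρ ≫ g.f0 + P.σ ≫ k.f0 := by simp [hs]
  clear_value s
  change _ = s.butterfly.toHom
  obtain ⟨r, c, h⟩ := exists_splits s
  generalize s.butterfly = R at r c h ⊢
  have e1 := R.κ_σ
  have e2 := R.ι_σ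
  have e3 := h.κ_r
  have e4 := h.ι_r
  have e5 := h.ρ_eq
  refine toHom_comp_eq (R.σ ≫ φ + r ≫ P'.ι) ?_ ?_ ?_ ?_
  · simp only [Preadditive.comp_add, reassoc_of% e1, reassoc_of% e3, StrictHom.comp_fm,
      roofFst_fm, hsm]
    ext
    · simp [hκ]
    · simp [hι]
  · simp [reassoc_of% e2, reassoc_of% e4]
  · simp [hσ]
  · simp [hρ, e5, hs0]

end Butterfly

end HRS

/-! ### From decorated complexes to complexes over the tilted category. -/

namespace HRS

variable {A : Type u} [Category.{v} A] [Abelian A] {τ : TorsionPair A}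

namespace Dec

variable {D D' D'' : Dec A}

/-- The object `[Mⁿ ⟶ Eⁿ⁺¹ / Mⁿ⁺¹]` of the tilted category. -/
@[simps] noncomputable abbrev tilt (D : Dec A) (hD : compat τ D) (n : ℤ) : Tilt τ where
  Xm := D.M n
  X0 := cokernel (D.M (n + 1)).arrow
  d := D.mid n
  ker_mem := (hD n).1
  coker_mem := (hD n).2

/-- The projection `Eʲ ⟶ Eʲ / Mʲ`, for `i + 1 = j`. -/
noncomputable def quotπ (D : Dec A) (i j : ℤ) (h : i + 1 = j) :
    D.E.X j ⟶ cokernel (D.M (i + 1)).arrow :=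
  (D.E.XIsoOfEq h.symm).hom ≫ cokernel.π _

@[simp] lemma quotπ_self (D : Dec A) (i : ℤ) : D.quotπ i (i + 1) rfl = cokernel.π _ := by
  simp [quotπ]

instance (i j : ℤ) (h : i + 1 = j) : Epi (D.quotπ i j h) := by
  subst h
  rw [quotπ_self]
  infer_instance

@[simp] lemma arrow_quotπ (D : Dec A) (i j : ℤ) (h : i + 1 = j) :
    (D.M j).arrow ≫ D.quotπ i j h = 0 := by
  subst h
  simp

lemma mid_eq (D : Dec A) (i j : ℤ) (h : i + 1 = j) :
    D.mid i = (D.M i).arrow ≫ D.E.d i j ≫ D.quotπ i j h := by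
  subst h
  simp [mid]

/-- The butterfly with middle object `Eʲ`, for `i + 1 = j`. -/
@[simps] noncomputable abbrev bfly (D : Dec A) (hD : compat τ D) (i j : ℤ) (h : i + 1 = j) :
    Butterfly (D.tilt hD i) (D.tilt hD j) where
  E := D.E.X j
  κ := (D.M i).arrow ≫ D.E.d i j
  ι := (D.M j).arrow
  σ := D.quotπ i j h
  ρ := D.E.d j (j + 1) ≫ cokernel.π _
  κ_σ := by rw [Category.assoc]; exact (mid_eq D i j h).symm
  ι_ρ := rfl
  κ_ρ := by simp
  ι_σ := D.arrow_quotπ i j h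
  exact := by
    subst h
    have : Mono (D.M (i + 1)).arrow := inferInstance
    refine { exact := ?_, mono_f := this, epi_g := ?_ }
    · refine ShortComplex.exact_of_iso ?_ (ShortComplex.exact_cokernel (D.M (i + 1)).arrow)
      exact ShortComplex.isoMk (Iso.refl _) (Iso.refl _) (Iso.refl _) (by simp) (by simp)
    · dsimp; infer_instance

/-- The differential of the decorated complex is the connecting map that witnesses the null
composite of consecutive butterflies. -/
lemma bfly_isLink (hD : compat τ D) (i j k : ℤ) (h : i + 1 = j) (h' : j + 1 = k) :
    Butterfly.IsLink (D.bfly hD i j h) (D.bfly hD j k h') (D.E.d j k) where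
  ι := rfl
  σ := by subst h'; simp
  κ := by simp
  ρ := by simp

/-- A chain map between objects `[Mⁿ ⟶ Eⁿ⁺¹ / Mⁿ⁺¹]` from maps between the `Eⁿ`. -/
noncomputable def mkStrict (hD : compat τ D) (hD' : compat τ D') {i i' : ℤ}
    (a : D.E.X i ⟶ D'.E.X i') (b : D.E.X (i + 1) ⟶ D'.E.X (i' + 1))
    (ha : (D'.M i').Factors ((D.M i).arrow ≫ a))
    (hb : (D'.M (i' + 1)).Factors ((D.M (i + 1)).arrow ≫ b))
    (hc : (D.M i).arrow ≫ D.E.d i (i + 1) ≫ b ≫ cokernel.π (D'.M (i' + 1)).arrow =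
      (D.M i).arrow ≫ a ≫ D'.E.d i' (i' + 1) ≫ cokernel.π _) :
    StrictHom (D.tilt hD i) (D'.tilt hD' i') where
  fm := (D'.M i').factorThru _ ha
  f0 := cokernel.desc _ (b ≫ cokernel.π _) (by
    rw [← Category.assoc, ← factors_iff_π]; exact hb)
  comm := by
    simp only [mid, Category.assoc, cokernel.π_desc, hc]
    rw [Subobject.factorThru_arrow_assoc, Category.assoc]

section

variable (hD : compat τ D) (hD' : compat τ D') {i i' : ℤ}
    (a : D.E.X i ⟶ D'.E.X i') (b : D.E.X (i + 1) ⟶ D'.E.X (i' + 1))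
    (ha : (D'.M i').Factors ((D.M i).arrow ≫ a))
    (hb : (D'.M (i' + 1)).Factors ((D.M (i + 1)).arrow ≫ b))
    (hc : (D.M i).arrow ≫ D.E.d i (i + 1) ≫ b ≫ cokernel.π (D'.M (i' + 1)).arrow =
      (D.M i).arrow ≫ a ≫ D'.E.d i' (i' + 1) ≫ cokernel.π _)

@[simp] lemma mkStrict_fm_arrow :
    (mkStrict hD hD' a b ha hb hc).fm ≫ (D'.M i').arrow = (D.M i).arrow ≫ a :=
  Subobject.factorThru_arrow _ _ ha

@[simp] lemma π_mkStrict_f0 :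
    cokernel.π (D.M (i + 1)).arrow ≫ (mkStrict hD hD' a b ha hb hc).f0 = b ≫ cokernel.π _ :=
  cokernel.π_desc _ _ _

end

lemma strict_ext {hD : compat τ D} {hD' : compat τ D'} {i i' : ℤ}
    {f g : StrictHom (D.tilt hD i) (D'.tilt hD' i')}
    (hm : f.fm ≫ (D'.M i').arrow = g.fm ≫ (D'.M i').arrow)
    (h0 : cokernel.π (D.M (i + 1)).arrow ≫ f.f0 = cokernel.π (D.M (i + 1)).arrow ≫ g.f0) :
    f = g :=
  StrictHom.ext ((cancel_mono (D'.M i').arrow).1 hm)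
    ((cancel_epi (cokernel.π (D.M (i + 1)).arrow)).1 h0)

/-- The chain map in degree `n` attached to a map of decorated complexes. -/
noncomputable def strict (f : D ⟶ D') (hD : compat τ D) (hD' : compat τ D') (n : ℤ) :
    StrictHom (D.tilt hD n) (D'.tilt hD' n) :=
  mkStrict hD hD' (f.hom.f n) (f.hom.f (n + 1)) (f.factors n) (f.factors (n + 1)) (by simp)

@[simp] lemma strict_fm_arrow (f : D ⟶ D') (hD : compat τ D) (hD' : compat τ D') (n : ℤ) :
    (strict f hD hD' n).fm ≫ (D'.M n).arrow = (D.M n).arrow ≫ f.hom.f n :=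
  mkStrict_fm_arrow ..

@[simp] lemma π_strict_f0 (f : D ⟶ D') (hD : compat τ D) (hD' : compat τ D') (n : ℤ) :
    cokernel.π (D.M (n + 1)).arrow ≫ (strict f hD hD' n).f0 = f.hom.f (n + 1) ≫ cokernel.π _ :=
  π_mkStrict_f0 ..

lemma strict_id (hD : compat τ D) (n : ℤ) : strict (𝟙 D) hD hD n = StrictHom.id _ := by
  apply strict_ext <;> simp

lemma strict_comp (f : D ⟶ D') (g : D' ⟶ D'') (hD : compat τ D) (hD' : compat τ D')
    (hD'' : compat τ D'') (n : ℤ) :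
    strict (f ≫ g) hD hD'' n = (strict f hD hD' n).comp (strict g hD' hD'' n) := by
  apply strict_ext
  · simp only [strict_fm_arrow, StrictHom.comp_fm, Category.assoc]
    rw [← Category.assoc _ (D'.M n).arrow, strict_fm_arrow, Category.assoc]
    rfl
  · simp only [π_strict_f0, StrictHom.comp_f0]
    rw [← Category.assoc (cokernel.π (D.M (n + 1)).arrow), π_strict_f0, Category.assoc, π_strict_f0]
    simp

lemma isSq_of {hD : compat τ D} {hD' : compat τ D'} {i j i' j' : ℤ} (h : i + 1 = j)
    (h' : i' + 1 = j') (f : StrictHom (D.tilt hD i) (D'.tilt hD' i'))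
    (g : StrictHom (D.tilt hD j) (D'.tilt hD' j')) (φ : D.E.X j ⟶ D'.E.X j')
    (h1 : (D.M i).arrow ≫ D.E.d i j ≫ φ = f.fm ≫ (D'.M i').arrow ≫ D'.E.d i' j')
    (h2 : (D.M j).arrow ≫ φ = g.fm ≫ (D'.M j').arrow)
    (h3 : φ ≫ D'.quotπ i' j' h' = D.quotπ i j h ≫ f.f0)
    (h4 : φ ≫ D'.E.d j' (j' + 1) ≫ cokernel.π _ = D.E.d j (j + 1) ≫ cokernel.π _ ≫ g.f0) :
    Butterfly.IsSq (D.bfly hD i j h) (D'.bfly hD' i' j' h') f g φ where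
  κ := by simpa using h1
  ι := h2
  σ := h3
  ρ := by simpa using h4

lemma strict_isSq (f : D ⟶ D') (hD : compat τ D) (hD' : compat τ D') (i j : ℤ) (h : i + 1 = j) :
    Butterfly.IsSq (D.bfly hD i j h) (D'.bfly hD' i j h) (strict f hD hD' i)
      (strict f hD hD' j) (f.hom.f j) := by
  refine isSq_of h h _ _ _ ?_ ?_ ?_ ?_
  · rw [← Category.assoc _ (D'.M i).arrow, strict_fm_arrow]
    simp
  · simp
  · subst h; simp
  · simp

/-- A map of decorated complexes is determined by the associated chain maps. -/
lemma hom_ext_of_strict {f g : D ⟶ D'} (hD : compat τ D) (hD' : compat τ D')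
    (h : ∀ n, strict f hD hD' n = strict g hD hD' n) : f = g := by
  apply hom_ext
  ext n
  refine Butterfly.IsSq.unique (strict_isSq f hD hD' (n - 1) n (by simp)) ?_
  rw [h, h]
  exact strict_isSq g hD hD' (n - 1) n (by simp)

/-- Chain maps which commute with the differentials come from a map of decorated complexes. -/
lemma exists_strict_eq {hD : compat τ D} {hD' : compat τ D'}
    (f : ∀ n, StrictHom (D.tilt hD n) (D'.tilt hD' n))
    (comm : ∀ i j (h : i + 1 = j), (D.bfly hD i j h).toHom ≫ (f j).toHom =
      (f i).toHom ≫ (D'.bfly hD' i j h).toHom) :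
    ∃ g : D ⟶ D', ∀ n, strict g hD hD' n = f n := by
  -- The component in degree `n` comes from the square `n - 1 ⟶ n`. Quantifying over all `i` with `i
  -- + 1 = n` avoids transport along equalities of degrees later.
  have H (n : ℤ) : ∃ φ : D.E.X n ⟶ D'.E.X n, ∀ i (h : i + 1 = n),
      Butterfly.IsSq (D.bfly hD i n h) (D'.bfly hD' i n h) (f i) (f n) φ := by
    obtain ⟨φ, hφ⟩ := Butterfly.exists_isSq (comm (n - 1) n (by simp))
    refine ⟨φ, fun i h => ?_⟩
    obtain rfl : i = n - 1 := by lia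
    exact hφ
  choose φ hφ using H
  have hι (n : ℤ) : (D.M n).arrow ≫ φ n = (f n).fm ≫ (D'.M n).arrow :=
    (hφ n (n - 1) (by simp)).ι
  have hκ (i j : ℤ) (h : i + 1 = j) : (D.M i).arrow ≫ D.E.d i j ≫ φ j =
      (f i).fm ≫ (D'.M i).arrow ≫ D'.E.d i j := by
    simpa using (hφ j i h).κ
  have hσ (i : ℤ) : φ (i + 1) ≫ cokernel.π (D'.M (i + 1)).arrow =
      cokernel.π (D.M (i + 1)).arrow ≫ (f i).f0 := by
    simpa using (hφ (i + 1) i rfl).σ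
  have hρ (n : ℤ) : φ n ≫ D'.E.d n (n + 1) ≫ cokernel.π (D'.M (n + 1)).arrow =
      D.E.d n (n + 1) ≫ cokernel.π (D.M (n + 1)).arrow ≫ (f n).f0 := by
    simpa using (hφ n (n - 1) (by simp)).ρ
  let g : D ⟶ D' :=
    { hom :=
        { f := φ
          comm' := by
            rintro i j h
            obtain rfl : i + 1 = j := h
            rw [← sub_eq_zero]
            -- The defect of commutation with the differentials is a map between the middle objects
            -- of two consecutive differentials, so rigidity applies.
            apply Butterfly.eq_zero (D.bfly hD (i - 1) i (by simp)) (D'.bfly hD' i (i + 1) rfl)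
            · have := hκ (i - 1) i (by simp)
              simp [reassoc_of% this]
            · have h1 := hι i
              have h2 := hκ i (i + 1) rfl
              simp [reassoc_of% h1, h2]
            · simp [hσ, hρ]
            · simp [hρ] }
      factors := fun n => by
        change (D'.M n).Factors ((D.M n).arrow ≫ φ n)
        rw [hι]
        exact Subobject.factors_comp_arrow _ }
  have hg (n : ℤ) : g.hom.f n = φ n := rfl
  refine ⟨g, fun n => strict_ext ?_ ?_⟩
  · rw [strict_fm_arrow, hg, hι]
  · rw [π_strict_f0, hg, hσ]

section

variable [Abelian (Tilt τ)]

open Classical in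
/-- The complex over the tilted category attached to a decorated complex. -/
@[simps] noncomputable abbrev cx (D : Dec A) (hD : compat τ D) : CochainComplex (Tilt τ) ℤ where
  X n := D.tilt hD n
  d i j := if h : i + 1 = j then (D.bfly hD i j h).toHom else 0
  shape i j h := dif_neg h
  d_comp_d' i j k h h' := by
    have h : i + 1 = j := h
    have h' : j + 1 = k := h'
    rw [dif_pos h, dif_pos h', (bfly_isLink hD i j k h h').comp_eq_zero, StrictHom.zero_toHom]

lemma cx_d_eq (hD : compat τ D) (i j : ℤ) (h : i + 1 = j) :
    (D.cx hD).d i j = (D.bfly hD i j h).toHom := dif_pos h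

/-- The map of complexes attached to a map of decorated complexes. -/
@[simps] noncomputable def cxMap (f : D ⟶ D') (hD : compat τ D) (hD' : compat τ D') :
    D.cx hD ⟶ D'.cx hD' where
  f n := (strict f hD hD' n).toHom
  comm' i j h := by
    have h : i + 1 = j := h
    rw [cx_d_eq _ _ _ h, cx_d_eq _ _ _ h]
    exact (strict_isSq f hD hD' i j h).comm.symm

/-- The functor from a category of decorated complexes to complexes over the tilted category. -/
@[simps] noncomputable def toCx (P : ObjectProperty (Dec A)) (hP : P ≤ compat τ) :
    P.FullSubcategory ⥤ CochainComplex (Tilt τ) ℤ where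
  obj X := X.obj.cx (hP _ X.property)
  map f := cxMap f.hom _ _
  map_id X := by
    ext n
    exact congr(StrictHom.toHom $(strict_id _ _))
  map_comp f g := by
    ext n
    exact congr(StrictHom.toHom $(strict_comp f.hom g.hom _ _ _ n)).trans
      (StrictHom.comp_toHom _ _)

end

end Dec

end HRS

/-! ### The totalization: existence and comparison with the complexes of butterflies. -/

namespace HRS

variable {A : Type u} [Category.{v} A] [Abelian A] {τ : TorsionPair A}

namespace StrictHom

variable {X Y : Tilt τ}

lemma isIso_toHom_of_inverse (f : StrictHom X Y) (g : StrictHom Y X)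
    (h1 : f.comp g = StrictHom.id X) (h2 : g.comp f = StrictHom.id Y) : IsIso f.toHom :=
  ⟨g.toHom, by rw [← comp_toHom, h1, id_toHom], by rw [← comp_toHom, h2, id_toHom]⟩

end StrictHom

namespace TotObj

variable [Abelian (Tilt τ)] {X : CochainComplex (Tilt τ) ℤ} {D : Dec A} (t : TotObj X D)

lemma factors_iff (n : ℤ) {U : A} (s : U ⟶ D.E.X (n + 1)) :
    (D.M (n + 1)).Factors s ↔ ∃ y : U ⟶ (X.X (n + 1)).Xm, y ≫ (t.b n).ι ≫ (t.e n).hom = s := by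
  rw [t.decoration]
  exact Subobject.mk_factors_iff _ _

include t in
-- With `Mⁿ` identified with `ⁿX⁻¹` and `Eⁿ⁺¹ / Mⁿ⁺¹` with `ⁿX⁰`, the map `mid` becomes the
-- differential of `ⁿX`.
lemma compat : Dec.compat τ D := by
  intro n
  obtain ⟨m, rfl⟩ : ∃ m, n = m + 1 := ⟨n - 1, by ring⟩
  rw [Dec.kernel_mid_iff, Dec.cokernel_mid_iff]
  constructor
  · intro U hU s h1 h2
    obtain ⟨x, rfl⟩ := (t.factors_iff m s).1 h1
    simp only [Category.assoc, t.ι_d] at h2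
    obtain ⟨y, hy⟩ := (t.factors_iff (m + 1) _).1 h2
    have : x ≫ (X.X (m + 1)).d = 0 := by
      have := congr($hy ≫ (t.e (m + 1)).inv ≫ (t.b (m + 1)).σ)
      simpa using this.symm
    rw [(X.X (m + 1)).eq_zero_of_T hU x this, zero_comp]
  · intro G hG s h1 h2
    have g1 {U : A} (u : U ⟶ _) (hu : (D.M (m + 1 + 1)).Factors u) : u ≫ s = 0 := by
      rw [← Subobject.factorThru_arrow _ u hu, Category.assoc, h1, comp_zero]
    have g2 {U : A} (u : U ⟶ _) (hu : (D.M (m + 1)).Factors u) :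
        u ≫ D.E.d (m + 1) (m + 1 + 1) ≫ s = 0 := by
      rw [← Subobject.factorThru_arrow _ u hu, Category.assoc, h2, comp_zero]
    obtain ⟨x, hx⟩ := (t.b (m + 1)).exists_desc_σ ((t.e (m + 1)).hom ≫ s) (by
      simpa using g1 _ ((t.factors_iff (m + 1) _).2 ⟨𝟙 _, rfl⟩))
    have h3 := g2 _ ((t.factors_iff m _).2 ⟨𝟙 _, rfl⟩)
    have h4 := t.ι_d m
    simp only [Category.id_comp, Category.assoc, reassoc_of% h4, ← hx,
      Butterfly.κ_σ_assoc] at h3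
    rw [← cancel_epi (t.e (m + 1)).hom, ← hx, (X.X (m + 1)).eq_zero_of_F hG x h3]
    simp

/-- The inclusion of `ⁿX⁻¹` into `Eⁿ`, with a free choice of the preceding index. -/
noncomputable def jAux (n m : ℤ) (h : m + 1 = n) : (X.X n).Xm ⟶ D.E.X n := by
  subst h
  exact (t.b m).ι ≫ (t.e m).hom

/-- The inclusion of `ⁿX⁻¹` into `Eⁿ`. -/
noncomputable def j (n : ℤ) : (X.X n).Xm ⟶ D.E.X n := t.jAux n (n - 1) (by simp)

lemma j_succ (n : ℤ) : t.j (n + 1) = (t.b n).ι ≫ (t.e n).hom := by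
  have (m : ℤ) (h : m + 1 = n + 1) : t.jAux (n + 1) m h = (t.b n).ι ≫ (t.e n).hom := by
    obtain rfl : m = n := by lia
    rfl
  exact this _ _

/-- The projection of `Eⁿ⁺¹` to `ⁿX⁰`. -/
noncomputable def p (n : ℤ) : D.E.X (n + 1) ⟶ (X.X n).X0 := (t.e n).inv ≫ (t.b n).σ

lemma e_hom_p (n : ℤ) : (t.e n).hom ≫ t.p n = (t.b n).σ := by simp [p]

instance (n : ℤ) : Epi (t.p n) := by
  rw [p]; infer_instance

lemma j_p (n : ℤ) : t.j (n + 1) ≫ t.p n = 0 := by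
  simp [j_succ, p]

lemma j_d (n : ℤ) : t.j n ≫ D.E.d n (n + 1) = (t.b n).κ ≫ (t.e n).hom := by
  obtain ⟨m, rfl⟩ : ∃ m, n = m + 1 := ⟨n - 1, by ring⟩
  rw [j_succ, Category.assoc, t.ι_d]

lemma d_p (n : ℤ) :
    (t.e n).hom ≫ D.E.d (n + 1) (n + 1 + 1) ≫ t.p (n + 1) = (t.b n).ρ := t.d_σ n

lemma j_factors_iff (n : ℤ) {U : A} (s : U ⟶ D.E.X n) :
    (D.M n).Factors s ↔ ∃ y : U ⟶ (X.X n).Xm, y ≫ t.j n = s := by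
  obtain ⟨m, rfl⟩ : ∃ m, n = m + 1 := ⟨n - 1, by ring⟩
  rw [t.factors_iff, t.j_succ]

instance (n : ℤ) : Mono (t.j n) := by
  obtain ⟨m, rfl⟩ : ∃ m, n = m + 1 := ⟨n - 1, by ring⟩
  rw [j_succ]
  infer_instance

lemma exists_desc_p (n : ℤ) {U : A} (s : D.E.X (n + 1) ⟶ U) (h : t.j (n + 1) ≫ s = 0) :
    ∃ x : (X.X n).X0 ⟶ U, t.p n ≫ x = s := by
  obtain ⟨x, hx⟩ := (t.b n).exists_desc_σ ((t.e n).hom ≫ s) (by simpa [j_succ] using h)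
  exact ⟨x, by simp [p, hx]⟩

/-- Both `j` and the arrow of `Mⁿ` represent the same subobject, and both `p` and the cokernel
projection are quotients by `Mⁿ⁺¹`. Recording the effect of `u` on them makes it usable without
unfolding. -/
lemma exists_strict (n : ℤ) : ∃ (u : StrictHom (X.X n) (D.tilt t.compat n))
    (v : StrictHom (D.tilt t.compat n) (X.X n)), u.comp v = StrictHom.id _ ∧
    v.comp u = StrictHom.id _ ∧ u.fm ≫ (D.M n).arrow = t.j n ∧
    t.p n ≫ u.f0 = cokernel.π (D.M (n + 1)).arrow := by
  have hj : (D.M n).Factors (t.j n) := (t.j_factors_iff n _).2 ⟨𝟙 _, Category.id_comp _⟩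
  obtain ⟨y, hy⟩ := (t.j_factors_iff n _).1 (Subobject.factors_self (D.M n))
  obtain ⟨x, hx⟩ := t.exists_desc_p n (cokernel.π (D.M (n + 1)).arrow) (by
    rw [← Dec.factors_iff_π]
    exact (t.j_factors_iff (n + 1) _).2 ⟨𝟙 _, Category.id_comp _⟩)
  obtain ⟨y', hy'⟩ := (t.j_factors_iff (n + 1) _).1 (Subobject.factors_self (D.M (n + 1)))
  let z : cokernel (D.M (n + 1)).arrow ⟶ (X.X n).X0 := cokernel.desc _ (t.p n) (by
    rw [← hy', Category.assoc, j_p, comp_zero])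
  have hz : cokernel.π _ ≫ z = t.p n := cokernel.π_desc _ _ _
  have hu : (D.M n).factorThru _ hj ≫ (D.M n).arrow = t.j n := Subobject.factorThru_arrow _ _ _
  have hd : (X.X n).d = t.j n ≫ D.E.d n (n + 1) ≫ t.p n := by
    have := t.j_d n
    rw [reassoc_of% this, e_hom_p, Butterfly.κ_σ]
  refine ⟨⟨(D.M n).factorThru _ hj, x, ?_⟩, ⟨y, z, ?_⟩, ?_, ?_, hu, hx⟩
  · simp only [Dec.mid, hd, Category.assoc, hx, reassoc_of% hu]
  · simp only [Dec.mid, hd, Category.assoc, hz, reassoc_of% hy]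
  · ext
    · change (D.M n).factorThru _ hj ≫ y = 𝟙 _
      rw [← cancel_mono (t.j n), Category.assoc, hy, hu, Category.id_comp]
    · change x ≫ z = 𝟙 _
      rw [← cancel_epi (t.p n), reassoc_of% hx, hz, Category.comp_id]
  · apply Dec.strict_ext
    · change (y ≫ (D.M n).factorThru _ hj) ≫ _ = 𝟙 _ ≫ _
      rw [Category.assoc, hu, hy, Category.id_comp]
    · change _ ≫ z ≫ x = _ ≫ 𝟙 _
      rw [reassoc_of% hz, hx, Category.comp_id]

/-- The strict isomorphism from `ⁿX` to `[Mⁿ ⟶ Eⁿ⁺¹ / Mⁿ⁺¹]`. -/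
noncomputable def u (n : ℤ) : StrictHom (X.X n) (D.tilt t.compat n) := (t.exists_strict n).choose

/-- The inverse of `u`. -/
noncomputable def v (n : ℤ) : StrictHom (D.tilt t.compat n) (X.X n) :=
  (t.exists_strict n).choose_spec.choose

lemma u_v (n : ℤ) : (t.u n).comp (t.v n) = StrictHom.id _ :=
  (t.exists_strict n).choose_spec.choose_spec.1

lemma v_u (n : ℤ) : (t.v n).comp (t.u n) = StrictHom.id _ :=
  (t.exists_strict n).choose_spec.choose_spec.2.1

@[simp] lemma u_fm_arrow (n : ℤ) : (t.u n).fm ≫ (D.M n).arrow = t.j n :=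
  (t.exists_strict n).choose_spec.choose_spec.2.2.1

@[simp] lemma p_u_f0 (n : ℤ) : t.p n ≫ (t.u n).f0 = cokernel.π (D.M (n + 1)).arrow :=
  (t.exists_strict n).choose_spec.choose_spec.2.2.2

instance (n : ℤ) : IsIso (t.u n).toHom := (t.u n).isIso_toHom_of_inverse _ (t.u_v n) (t.v_u n)

lemma isSq (n : ℤ) : Butterfly.IsSq (t.b n) (D.bfly t.compat n (n + 1) rfl) (t.u n)
    (t.u (n + 1)) (t.e n).hom where
  κ := by
    have := t.u_fm_arrow n
    dsimp only [Dec.bfly]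
    rw [reassoc_of% this, j_d]
  ι := by
    dsimp only [Dec.bfly]
    rw [u_fm_arrow, j_succ]
  σ := by
    dsimp only [Dec.bfly]
    rw [Dec.quotπ_self, ← t.e_hom_p, Category.assoc, t.p_u_f0]
  ρ := by
    dsimp only [Dec.bfly]
    rw [← t.d_p n, Category.assoc, Category.assoc, t.p_u_f0]

/-- A complex over the tilted category is isomorphic to the complex attached to its totalization. -/
noncomputable def iso : X ≅ D.cx t.compat :=
  HomologicalComplex.Hom.isoOfComponents (fun n => asIso (t.u n).toHom) (by
    rintro i j h
    obtain rfl : i + 1 = j := h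
    rw [Dec.cx_d_eq _ _ _ rfl, ← t.toHom_b]
    exact (t.isSq i).comm.symm)

end TotObj

section Existence

variable [Abelian (Tilt τ)]

/-- Butterflies representing the differentials have null composites and hence links `δ`. The square
of `δ` satisfies the four vanishing conditions of `Butterfly.eq_zero`, so no choice has to be
adjusted to obtain a complex. -/
lemma exists_totObj (X : CochainComplex (Tilt τ) ℤ) : ∃ D : Dec A, Nonempty (TotObj X D) := by
  choose b hb using fun n => Butterfly.exists_toHom (X.d n (n + 1))
  have hδ (n : ℤ) : ∃ δ, Butterfly.IsLink (b n) (b (n + 1)) δ := Butterfly.exists_isLink (by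
    rw [hb, hb, X.d_comp_d, StrictHom.zero_toHom])
  choose δ hδ using hδ
  let E : CochainComplex A ℤ := CochainComplex.of (fun n => (b n).E) δ (fun n => by
    apply Butterfly.eq_zero (b n) (b (n + 1 + 1))
    · rw [reassoc_of% (hδ n).κ, zero_comp]
    · rw [reassoc_of% (hδ n).ι, (hδ (n + 1)).κ]
    · rw [Category.assoc, (hδ (n + 1)).σ, (hδ n).ρ]
    · rw [Category.assoc, (hδ (n + 1)).ρ, comp_zero])
  have hE (n : ℤ) : E.d n (n + 1) = δ n := by simp [E]
  -- The butterfly `ⁿX ⟶ ⁿ⁺¹X` belongs in degree `n + 1`. The complex is reindexed by hand, since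
  -- the shift functor by an odd number would change the sign of the differential.
  let E' : CochainComplex A ℤ :=
    { X := fun n => E.X (n - 1)
      d := fun i j => E.d (i - 1) (j - 1)
      shape := fun i j h => E.shape _ _ (fun h' => h (by
        change i - 1 + 1 = j - 1 at h'
        change i + 1 = j
        lia))
      d_comp_d' := fun i j k _ _ => E.d_comp_d _ _ _ }
  let D : Dec A := ⟨E', fun n => Subobject.mk (b (n - 1)).ι⟩
  let e (n : ℤ) : E.X n ≅ E.X (n + 1 - 1) := E.XIsoOfEq (by simp)
  have he (n : ℤ) : (e n).hom ≫ E.d (n + 1 - 1) (n + 1 + 1 - 1) = δ n ≫ (e (n + 1)).hom := by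
    rw [← hE]
    simp [e]
  refine ⟨D, ⟨{ b := b, toHom_b := hb, e := e, decoration := ?_, ι_d := ?_, d_σ := ?_ }⟩⟩
  · intro n
    have (m : ℤ) (h : n = m) :
        Subobject.mk (b m).ι = Subobject.mk ((b n).ι ≫ (E.XIsoOfEq h).hom) := by
      subst h
      change Subobject.mk (b n).ι = Subobject.mk ((b n).ι ≫ 𝟙 (b n).E)
      simp only [Category.comp_id]
    exact this _ _
  · intro n
    change (b n).ι ≫ (e n).hom ≫ E.d (n + 1 - 1) (n + 1 + 1 - 1) = _
    rw [he, reassoc_of% (hδ n).ι]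
  · intro n
    change (e n).hom ≫ E.d (n + 1 - 1) (n + 1 + 1 - 1) ≫ _ = _
    have := he n
    rw [reassoc_of% this, Iso.hom_inv_id_assoc, (hδ n).σ]

/-- A map of decorated complexes which corresponds to a strict map. -/
lemma exists_tot_map {X Y : ChSt τ} {D D' : Dec A} (t : TotObj X.cx D) (t' : TotObj Y.cx D')
    (f : X ⟶ Y) : ∃ g : D ⟶ D', ∀ n, Dec.strict g t.compat t'.compat n =
      ((t.v n).comp (f.f n)).comp (t'.u n) := by
  apply Dec.exists_strict_eq
  intro i j h
  subst h
  have h1 := (t.isSq i).comm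
  have h2 := (t'.isSq i).comm
  have h3 := f.comm i (i + 1)
  rw [← t.toHom_b, ← t'.toHom_b] at h3
  have hv (n : ℤ) : (t.u n).toHom ≫ (t.v n).toHom = 𝟙 _ := by
    rw [← StrictHom.comp_toHom, t.u_v, StrictHom.id_toHom]
  rw [← cancel_epi (t.u i).toHom]
  simp only [StrictHom.comp_toHom, Category.assoc, ← h2, reassoc_of% (hv i)]
  rw [reassoc_of% h3, ← reassoc_of% h1, reassoc_of% (hv (i + 1))]

variable (τ) in
-- Middle maps are chosen separately for each strict map. They are nevertheless functorial, because
-- a map of decorated complexes is determined by its chain maps (`hom_ext_of_strict`).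
theorem exists_tot :
    ∃ Tot : ChSt τ ⥤ (Dec.compat τ).FullSubcategory, Nonempty (TotData Tot) := by
  choose D hD using fun X : ChSt τ => exists_totObj X.cx
  let t (X : ChSt τ) : TotObj X.cx (D X) := (hD X).some
  choose g hg using fun {X Y : ChSt τ} (f : X ⟶ Y) => exists_tot_map (t X) (t Y) f
  have key {X Y : ChSt τ} (f : X ⟶ Y) (n : ℤ) :
      ((t X).u n).comp (Dec.strict (g f) (t X).compat (t Y).compat n) =
        (f.f n).comp ((t Y).u n) := by
    have h1 := congr(StrictHom.fm $((t X).u_v n))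
    have h2 := congr(StrictHom.f0 $((t X).u_v n))
    simp only [StrictHom.comp_fm, StrictHom.comp_f0, StrictHom.id_fm, StrictHom.id_f0] at h1 h2
    rw [hg]
    ext
    · simp [reassoc_of% h1]
    · simp [reassoc_of% h2]
  have hid (X : ChSt τ) : g (𝟙 X) = 𝟙 (D X) := by
    apply Dec.hom_ext_of_strict (t X).compat (t X).compat
    intro n
    rw [hg, Dec.strict_id, ← (t X).v_u n]
    congr 1
    exact StrictHom.ext (Category.comp_id _) (Category.comp_id _)
  have hcomp {X Y Z : ChSt τ} (f : X ⟶ Y) (f' : Y ⟶ Z) : g (f ≫ f') = g f ≫ g f' := by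
    apply Dec.hom_ext_of_strict (t X).compat (t Z).compat
    intro n
    have h1 := congr(StrictHom.fm $(key f' n))
    have h2 := congr(StrictHom.f0 $(key f' n))
    simp only [StrictHom.comp_fm, StrictHom.comp_f0] at h1 h2
    have h3 : (f ≫ f').f n = (f.f n).comp (f'.f n) := rfl
    rw [Dec.strict_comp _ _ _ (t Y).compat, hg f, hg, h3]
    apply StrictHom.ext
    · simp only [StrictHom.comp_fm, Category.assoc, h1]
    · simp only [StrictHom.comp_f0, Category.assoc, h2]
  let Tot : ChSt τ ⥤ (Dec.compat τ).FullSubcategory :=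
    { obj := fun X => ⟨D X, (t X).compat⟩
      map := fun f => ObjectProperty.homMk (g f)
      map_id := fun X => by ext : 1; exact hid X
      map_comp := fun f f' => by ext : 1; exact hcomp f f' }
  refine ⟨Tot, ⟨{ obj := t, ι_map := ?_, map_σ := ?_ }⟩⟩
  · intro X Y f n
    change _ ≫ _ ≫ (g f).hom.f (n + 1) = _
    have h1 := congr(StrictHom.fm $(key f (n + 1)) ≫ ((D Y).M (n + 1)).arrow)
    simp only [StrictHom.comp_fm, Category.assoc, Dec.strict_fm_arrow, TotObj.u_fm_arrow] at h1
    rw [← TotObj.j_succ, ← h1, ← Category.assoc, ← TotObj.j_succ, ← Category.assoc,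
      TotObj.u_fm_arrow]
  · intro X Y f n
    change _ ≫ (g f).hom.f (n + 1) ≫ (t Y).p n = _
    have h1 := congr((t X).p n ≫ StrictHom.f0 $(key f n) ≫ ((t Y).v n).f0)
    have h2 := congr(StrictHom.f0 $((t Y).u_v n))
    have h3 := (t X).p_u_f0 n
    have h4 := Dec.π_strict_f0 (g f) (t X).compat (t Y).compat n
    have h5 := (t Y).p_u_f0 n
    simp only [StrictHom.comp_f0, StrictHom.id_f0] at h1 h2
    simp only [Category.assoc, h2, Category.comp_id, reassoc_of% h3, reassoc_of% h4, ← h5] at h1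
    rw [h1, ← Category.assoc, TotObj.e_hom_p]

end Existence

section Comparison

variable [Abelian (Tilt τ)] {Tot : ChSt τ ⥤ (Dec.compat τ).FullSubcategory} (h : TotData Tot)

include h in
-- The action of `Tot` on `ι` and `σ` prescribes its action on `Mⁿ` and on `Eⁿ⁺¹ / Mⁿ⁺¹`. This makes
-- the isomorphisms `u` natural for every choice of `Tot`.
lemma TotData.u_comp_strict {X Y : ChSt τ} (f : X ⟶ Y) (n : ℤ) :
    ((h.obj X).u n).comp (Dec.strict (Tot.map f).hom (h.obj X).compat (h.obj Y).compat n) =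
      (f.f n).comp ((h.obj Y).u n) := by
  apply StrictHom.ext
  · simp only [StrictHom.comp_fm]
    rw [← cancel_mono ((Tot.obj Y).obj.M n).arrow]
    have h1 := (h.obj X).u_fm_arrow n
    simp only [Category.assoc, Dec.strict_fm_arrow, TotObj.u_fm_arrow, reassoc_of% h1]
    obtain ⟨m, rfl⟩ : ∃ m, n = m + 1 := ⟨n - 1, by ring⟩
    rw [TotObj.j_succ, TotObj.j_succ, Category.assoc, h.ι_map f m]
  · simp only [StrictHom.comp_f0]
    have h3 := (h.obj X).p_u_f0 n
    have h4 := Dec.π_strict_f0 (Tot.map f).hom (h.obj X).compat (h.obj Y).compat n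
    have h5 := (h.obj Y).p_u_f0 n
    have h6 : (Tot.map f).hom.hom.f (n + 1) ≫ (h.obj Y).p n = (h.obj X).p n ≫ (f.f n).f0 := by
      rw [← cancel_epi ((h.obj X).e n).hom, TotObj.p, h.map_σ f n, ← Category.assoc,
        TotObj.e_hom_p]
    rw [← cancel_epi ((h.obj X).p n), reassoc_of% h3, h4, ← h5, reassoc_of% h6]

/-- A complex with strict maps is isomorphic to the complex attached to its totalization. -/
noncomputable def TotData.isoToCx : ChSt.toCh τ ≅ Tot ⋙ Dec.toCx (Dec.compat τ) le_rfl :=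
  NatIso.ofComponents (fun X => (h.obj X).iso) (fun {X Y} f => by
    ext n
    have := congr(StrictHom.toHom $(h.u_comp_strict f n))
    rw [StrictHom.comp_toHom, StrictHom.comp_toHom] at this
    exact this.symm)

/-- The bounded version of `isoToCx`. -/
noncomputable def TotData.restrictIsoToCx (b : Bdd) :
    (ChSt.isBdd τ b).ι ⋙ ChSt.toCh τ ≅
      h.restrict b ⋙ Dec.toCx (Dec.compat τ ⊓ Dec.isBdd A b) inf_le_left :=
  Functor.isoWhiskerLeft (ChSt.isBdd τ b).ι h.isoToCx

end Comparison

end HRS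

/-! ### Compatibility with shifts. -/

namespace HRS

variable {A : Type u} [Category.{v} A] [Abelian A] {τ : TorsionPair A}

namespace Dec

variable {D D' D'' : Dec A}

/-- A chain map between objects `[Mⁿ ⟶ Eⁿ⁺¹ / Mⁿ⁺¹]` is induced by maps between the `Eⁿ`. -/
structure Induces {hD : compat τ D} {hD' : compat τ D'} {i i' : ℤ}
    (f : StrictHom (D.tilt hD i) (D'.tilt hD' i')) (a : D.E.X i ⟶ D'.E.X i')
    (b : D.E.X (i + 1) ⟶ D'.E.X (i' + 1)) : Prop where
  fm : f.fm ≫ (D'.M i').arrow = (D.M i).arrow ≫ a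
  f0 : cokernel.π (D.M (i + 1)).arrow ≫ f.f0 = b ≫ cokernel.π _

namespace Induces

variable {hD : compat τ D} {hD' : compat τ D'} {hD'' : compat τ D''} {i i' i'' : ℤ}

lemma unique {f g : StrictHom (D.tilt hD i) (D'.tilt hD' i')} {a : D.E.X i ⟶ D'.E.X i'}
    {b : D.E.X (i + 1) ⟶ D'.E.X (i' + 1)} (hf : Induces f a b) (hg : Induces g a b) : f = g :=
  strict_ext (hf.fm.trans hg.fm.symm) (hf.f0.trans hg.f0.symm)

lemma eq_of_eq {f g : StrictHom (D.tilt hD i) (D'.tilt hD' i')} {a a' : D.E.X i ⟶ D'.E.X i'}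
    {b b' : D.E.X (i + 1) ⟶ D'.E.X (i' + 1)} (hf : Induces f a b) (hg : Induces g a' b')
    (ha : a = a') (hb : b = b') : f = g := by
  subst ha hb
  exact hf.unique hg

lemma comp {f : StrictHom (D.tilt hD i) (D'.tilt hD' i')} {a : D.E.X i ⟶ D'.E.X i'}
    {b : D.E.X (i + 1) ⟶ D'.E.X (i' + 1)} (hf : Induces f a b)
    {g : StrictHom (D'.tilt hD' i') (D''.tilt hD'' i'')} {a' : D'.E.X i' ⟶ D''.E.X i''}
    {b' : D'.E.X (i' + 1) ⟶ D''.E.X (i'' + 1)} (hg : Induces g a' b') :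
    Induces (f.comp g) (a ≫ a') (b ≫ b') where
  fm := by
    have h1 := hf.fm
    have h2 := hg.fm
    rw [StrictHom.comp_fm, Category.assoc, h2, reassoc_of% h1]
  f0 := by
    have h1 := hf.f0
    have h2 := hg.f0
    rw [StrictHom.comp_f0, reassoc_of% h1, h2, Category.assoc]

lemma add {f g : StrictHom (D.tilt hD i) (D'.tilt hD' i')} {a a' : D.E.X i ⟶ D'.E.X i'}
    {b b' : D.E.X (i + 1) ⟶ D'.E.X (i' + 1)} (hf : Induces f a b) (hg : Induces g a' b') :
    Induces (f.add g) (a + a') (b + b') where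
  fm := by simp [hf.fm, hg.fm]
  f0 := by simp [hf.f0, hg.f0]

lemma id (hD : compat τ D) (i : ℤ) : Induces (StrictHom.id (D.tilt hD i)) (𝟙 _) (𝟙 _) where
  fm := by simp
  f0 := by simp

lemma sign (hD : compat τ D) (i : ℤ) (ε : ℤˣ) :
    Induces (StrictHom.sign (D.tilt hD i) ε) (ε • 𝟙 _) (ε • 𝟙 _) where
  fm := by simp
  f0 := by simp

end Induces

lemma induces_mkStrict (hD : compat τ D) (hD' : compat τ D') {i i' : ℤ}
    (a : D.E.X i ⟶ D'.E.X i') (b : D.E.X (i + 1) ⟶ D'.E.X (i' + 1))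
    (ha : (D'.M i').Factors ((D.M i).arrow ≫ a))
    (hb : (D'.M (i' + 1)).Factors ((D.M (i + 1)).arrow ≫ b))
    (hc : (D.M i).arrow ≫ D.E.d i (i + 1) ≫ b ≫ cokernel.π (D'.M (i' + 1)).arrow =
      (D.M i).arrow ≫ a ≫ D'.E.d i' (i' + 1) ≫ cokernel.π _) :
    Induces (mkStrict hD hD' a b ha hb hc) a b :=
  ⟨mkStrict_fm_arrow .., π_mkStrict_f0 ..⟩

lemma induces_strict (f : D ⟶ D') (hD : compat τ D) (hD' : compat τ D') (n : ℤ) :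
    Induces (strict f hD hD' n) (f.hom.f n) (f.hom.f (n + 1)) :=
  ⟨strict_fm_arrow .., π_strict_f0 ..⟩

/-- The identification of the objects in equal degrees. -/
noncomputable def castStrict (hD : compat τ D) {i j : ℤ} (h : i = j) :
    StrictHom (D.tilt hD i) (D.tilt hD j) :=
  mkStrict hD hD (D.E.XIsoOfEq h).hom (D.E.XIsoOfEq (by rw [h])).hom (factors_XIsoOfEq D _)
    (factors_XIsoOfEq D _) (by subst h; simp)

lemma induces_castStrict (hD : compat τ D) {i j : ℤ} (h : i = j) :
    Induces (castStrict hD h) (D.E.XIsoOfEq h).hom (D.E.XIsoOfEq (by rw [h])).hom :=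
  induces_mkStrict ..

section

variable [Abelian (Tilt τ)]

lemma cx_XIsoOfEq (hD : compat τ D) {i j : ℤ} (h : i = j) :
    ((D.cx hD).XIsoOfEq h).hom = (castStrict hD h).toHom := by
  subst h
  have : castStrict hD rfl = StrictHom.id (D.tilt hD i) :=
    (induces_castStrict hD rfl).unique (by simpa using Induces.id hD i)
  rw [this]
  rfl

end

section

variable (K : CochainComplex A ℤ) (ε : ℤˣ) {n m : ℤ} (h : m = n + 1) {U V : A}
  (s : U ⟶ K.X n) (t : K.X (n + 1) ⟶ V)

/-- Bookkeeping for the shift by `a`: its differential carries the sign `(-1)ᵃ`, and the degrees `n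
+ 1 + a` and `n + a + 1` agree only up to a proof. -/
lemma signed_d_comp_cast : s ≫ (ε • K.d n m) ≫ (K.XIsoOfEq h).hom ≫ t =
    s ≫ (ε • 𝟙 _) ≫ K.d n (n + 1) ≫ t := by
  subst h
  simp

lemma d_comp_cast (t : K.X m ⟶ V) : s ≫ K.d n (n + 1) ≫ (K.XIsoOfEq h.symm).hom ≫ t =
      s ≫ (ε • 𝟙 _) ≫ (ε • K.d n m) ≫ t := by
  subst h
  simp [smul_smul]

end

lemma factors_signed_id (D : Dec A) (ε : ℤˣ) (n : ℤ) :
    (D.M n).Factors ((D.M n).arrow ≫ (ε • 𝟙 _)) := by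
  obtain h | h := Int.units_eq_one_or ε
  · rw [h, one_smul, Category.comp_id]
    exact Subobject.factors_self _
  · rw [h, Units.smul_def]
    simpa using factors_neg (Subobject.factors_self (D.M n))

/-- The identification of the object in degree `n` for `D⟦a⟧` with the object in degree `n + a`
for `D`. -/
noncomputable def shiftStrict (hD : compat τ D) (a n : ℤ) :
    StrictHom ((D.shiftObj a).tilt (compat_shift hD a) n) (D.tilt hD (n + a)) :=
  -- The map `mid` of the shift carries the sign, so the sign is placed on the component in degree
  -- `-1` and not on the one in degree `0`.
  mkStrict (D := D.shiftObj a) (compat_shift hD a) hD (a.negOnePow • 𝟙 (D.E.X (n + a)))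
    (D.E.XIsoOfEq (show n + 1 + a = n + a + 1 by ring)).hom
    (D.factors_signed_id a.negOnePow (n + a)) (D.factors_XIsoOfEq _)
    (signed_d_comp_cast D.E a.negOnePow _ _ _)

lemma induces_shiftStrict (hD : compat τ D) (a n : ℤ) :
    Induces (shiftStrict hD a n) (a.negOnePow • 𝟙 (D.E.X (n + a)))
      (D.E.XIsoOfEq (show n + 1 + a = n + a + 1 by ring)).hom :=
  induces_mkStrict ..

lemma signed_id_comp_signed_id (X : A) (ε : ℤˣ) : (ε • 𝟙 X) ≫ (ε • 𝟙 X) = 𝟙 X := by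
  simp [smul_smul]

instance (hD : compat τ D) (a n : ℤ) : IsIso (shiftStrict hD a n).toHom := by
  let g : StrictHom (D.tilt hD (n + a)) ((D.shiftObj a).tilt (compat_shift hD a) n) :=
    mkStrict (D' := D.shiftObj a) hD (compat_shift hD a) (a.negOnePow • 𝟙 (D.E.X (n + a)))
    (D.E.XIsoOfEq (show n + a + 1 = n + 1 + a by ring)).hom
    (D.factors_signed_id a.negOnePow (n + a)) (D.factors_XIsoOfEq _)
    (d_comp_cast D.E a.negOnePow (show n + 1 + a = n + a + 1 by ring) _ _)
  have hg : Induces g (a.negOnePow • 𝟙 (D.E.X (n + a)))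
      (D.E.XIsoOfEq (show n + a + 1 = n + 1 + a by ring)).hom :=
    induces_mkStrict ..
  refine StrictHom.isIso_toHom_of_inverse _ g ?_ ?_
  · refine ((induces_shiftStrict hD a n).comp hg).eq_of_eq (Induces.id (compat_shift hD a) n) ?_ ?_
    · exact signed_id_comp_signed_id (D.E.X (n + a)) _
    · exact (D.E.XIsoOfEq (show n + 1 + a = n + a + 1 by ring)).hom_inv_id
  · refine (hg.comp (induces_shiftStrict hD a n)).eq_of_eq (Induces.id hD (n + a)) ?_ ?_
    · exact signed_id_comp_signed_id (D.E.X (n + a)) _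
    · exact (D.E.XIsoOfEq (show n + a + 1 = n + 1 + a by ring)).hom_inv_id

/-- `shiftStrict` as an isomorphism. -/
noncomputable def shiftTiltIso (hD : compat τ D) (a n : ℤ) :
    (D.shiftObj a).tilt (compat_shift hD a) n ≅ D.tilt hD (n + a) :=
  asIso (shiftStrict hD a n).toHom

/-- The middle objects are literally equal and the identity is the square, at the price of an extra
sign on the target. This sign is the one in the differential of the shifted complex over the tilted
category. -/
lemma shift_isSq (hD : compat τ D) (a n m : ℤ) (h : n + 1 = m) (h' : n + a + 1 = m + a) :
    Butterfly.IsSq ((D.shiftObj a).bfly (compat_shift hD a) n m h)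
      (D.bfly hD (n + a) (m + a) h') (shiftStrict hD a n)
      ((shiftStrict hD a m).comp (StrictHom.sign _ a.negOnePow)) (𝟙 (D.E.X (m + a))) := by
  have h1 := induces_shiftStrict hD a n
  have h2 := (induces_shiftStrict hD a m).comp (Induces.sign hD (m + a) a.negOnePow)
  refine isSq_of h h' _ _ _ ?_ ?_ ?_ ?_
  · have e {K : CochainComplex A ℤ} (ε : ℤˣ) {i j : ℤ} {U : A} (s : U ⟶ K.X i) :
        s ≫ (ε • K.d i j) ≫ 𝟙 _ = (s ≫ (ε • 𝟙 _)) ≫ K.d i j := by simp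
    rw [← Category.assoc _ (D.M (n + a)).arrow, h1.fm]
    exact e (K := D.E) a.negOnePow (D.M (n + a)).arrow
  · rw [h2.fm]
    exact congr((D.M (m + a)).arrow ≫
      $((signed_id_comp_signed_id (D.E.X (m + a)) a.negOnePow).symm))
  · subst h
    have h3 := h1.f0
    rw [quotπ_self, h3]
    exact Category.id_comp _
  · rw [h2.f0]
    have e {K : CochainComplex A ℤ} (ε : ℤˣ) {i j j' : ℤ} (h : j = j') {V : A}
        (t : K.X j' ⟶ V) : 𝟙 _ ≫ K.d i j' ≫ t =
        (ε • K.d i j) ≫ ((K.XIsoOfEq h).hom ≫ (ε • 𝟙 _)) ≫ t := by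
      subst h
      simp [smul_smul]
    exact e (K := D.E) a.negOnePow (show m + 1 + a = m + a + 1 by ring) _

section

variable [Abelian (Tilt τ)]

lemma shiftStrict_comm (hD : compat τ D) (a n m : ℤ) (h : n + 1 = m) (h' : n + a + 1 = m + a) :
    (shiftStrict hD a n).toHom ≫ (a.negOnePow • (D.bfly hD (n + a) (m + a) h').toHom) =
      ((D.shiftObj a).bfly (compat_shift hD a) n m h).toHom ≫ (shiftStrict hD a m).toHom := by
  have := (shift_isSq hD a n m h h').comm
  rw [StrictHom.comp_toHom, StrictHom.sign_toHom, Linear.comp_units_smul,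
    Linear.comp_units_smul, Category.comp_id] at this
  rw [Linear.comp_units_smul, ← this, smul_smul]
  simp

/-- The complex attached to the shift. -/
noncomputable def cxShiftIso (hD : compat τ D) (a : ℤ) :
    (D.shiftObj a).cx (compat_shift hD a) ≅ (D.cx hD)⟦a⟧ :=
  HomologicalComplex.Hom.isoOfComponents (fun n => shiftTiltIso hD a n) (by
    intro n m h
    have h : n + 1 = m := h
    have h' : n + a + 1 = m + a := by lia
    rw [CochainComplex.shiftFunctor_obj_d', cx_d_eq _ _ _ h, cx_d_eq _ _ _ h']
    exact shiftStrict_comm hD a n m h h')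

lemma cxShiftIso_naturality (f : D ⟶ D') (hD : compat τ D) (hD' : compat τ D') (a : ℤ) :
    cxMap (D := D.shiftObj a) (D' := D'.shiftObj a) ((shiftBy A a).map f) (compat_shift hD a)
      (compat_shift hD' a) ≫ (cxShiftIso hD' a).hom =
      (cxShiftIso hD a).hom ≫ (cxMap f hD hD')⟦a⟧' := by
  have key (n : ℤ) : (strict (D := D.shiftObj a) (D' := D'.shiftObj a) ((shiftBy A a).map f)
      (compat_shift hD a) (compat_shift hD' a) n).comp (shiftStrict hD' a n) =
      (shiftStrict hD a n).comp (strict f hD hD' (n + a)) := by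
    refine ((induces_strict ..).comp (induces_shiftStrict ..)).eq_of_eq
      ((induces_shiftStrict hD a n).comp (induces_strict f hD hD' (n + a))) ?_ ?_
    · have e {X Y : A} (f : X ⟶ Y) (ε : ℤˣ) : f ≫ (ε • 𝟙 _) = (ε • 𝟙 _) ≫ f := by simp
      exact e (f.hom.f (n + a)) _
    · have e {K L : CochainComplex A ℤ} (f : K ⟶ L) {i j : ℤ} (h : i = j) :
          f.f i ≫ (L.XIsoOfEq h).hom = (K.XIsoOfEq h).hom ≫ f.f j := by
        subst h
        simp
      exact e f.hom (show n + 1 + a = n + a + 1 by ring)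
  ext n
  have := congr(StrictHom.toHom $(key n))
  rw [StrictHom.comp_toHom, StrictHom.comp_toHom] at this
  exact this

lemma cxShiftIso_zero (hD : compat τ D) :
    (cxShiftIso hD 0).hom =
      cxMap (D := D.shiftObj 0) (D' := D) ((shiftZero A).hom.app D) (compat_shift hD 0) hD ≫
      (shiftFunctorZero (CochainComplex (Tilt τ) ℤ) ℤ).inv.app (D.cx hD) := by
  have key (n : ℤ) : shiftStrict hD 0 n =
      (strict (D := D.shiftObj 0) (D' := D) ((shiftZero A).hom.app D) (compat_shift hD 0)
        hD n).comp (castStrict hD (show n = n + 0 by simp)) := by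
    refine (induces_shiftStrict ..).eq_of_eq ((induces_strict (D := D.shiftObj 0) (D' := D)
      ((shiftZero A).hom.app D) (compat_shift hD 0) hD n).comp
      (induces_castStrict hD (show n = n + 0 by simp))) ?_ ?_
    · have e {K : CochainComplex A ℤ} {i j : ℤ} (h : i = j) :
          (0 : ℤ).negOnePow • 𝟙 (K.X i) = (K.XIsoOfEq h).hom ≫ (K.XIsoOfEq h.symm).hom := by
        simp
      exact e (K := D.E) (show n + 0 = n by simp)
    · have e {K : CochainComplex A ℤ} {i j l : ℤ} (h : i = j) (h' : j = l) :
          (K.XIsoOfEq (h.trans h')).hom =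
            (K.XIsoOfEq h).hom ≫ (K.XIsoOfEq h').hom := by simp
      exact e (K := D.E) (show n + 1 + 0 = n + 1 by simp) (show n + 1 = n + 0 + 1 by simp)
  ext n
  have := congr(StrictHom.toHom $(key n))
  rw [StrictHom.comp_toHom, ← cx_XIsoOfEq] at this
  exact this

/-- Both sides are induced by maps between the objects `Eⁿ`, so the coherence reduces to composing
identifications of degrees and to multiplicativity of the signs. -/
lemma cxShiftIso_add (hD : compat τ D) (a b : ℤ) :
    (cxShiftIso hD (a + b)).hom =
      cxMap (D := D.shiftObj (a + b)) (D' := (D.shiftObj a).shiftObj b)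
        ((shiftAdd A a b).hom.app D) (compat_shift hD (a + b))
        (compat_shift (compat_shift hD a) b) ≫ (cxShiftIso (compat_shift hD a) b).hom ≫
      (cxShiftIso hD a).hom⟦b⟧' ≫
      (shiftFunctorAdd (CochainComplex (Tilt τ) ℤ) a b).inv.app (D.cx hD) := by
  have key (n : ℤ) : shiftStrict hD (a + b) n =
      (strict (D := D.shiftObj (a + b)) (D' := (D.shiftObj a).shiftObj b)
        ((shiftAdd A a b).hom.app D) (compat_shift hD (a + b))
        (compat_shift (compat_shift hD a) b) n).comp
      ((shiftStrict (compat_shift hD a) b n).comp ((shiftStrict hD a (n + b)).comp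
        (castStrict hD (show n + b + a = n + (a + b) by ring)))) := by
    refine (induces_shiftStrict ..).eq_of_eq ((induces_strict (D := D.shiftObj (a + b))
      (D' := (D.shiftObj a).shiftObj b) ((shiftAdd A a b).hom.app D) (compat_shift hD _)
        (compat_shift (compat_shift hD a) b) n).comp
      ((induces_shiftStrict (compat_shift hD a) b n).comp
      ((induces_shiftStrict hD a (n + b)).comp
      (induces_castStrict hD (show n + b + a = n + (a + b) by ring))))) ?_ ?_
    · have e {K : CochainComplex A ℤ} {i j : ℤ} (h : i = j) :
          (a + b).negOnePow • 𝟙 (K.X i) = (K.XIsoOfEq h).hom ≫ (b.negOnePow • 𝟙 _) ≫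
            (a.negOnePow • 𝟙 _) ≫ (K.XIsoOfEq h.symm).hom := by
        simp [smul_smul, Int.negOnePow_add]
      exact e (K := D.E) (show n + (a + b) = n + b + a by ring)
    · have e {K : CochainComplex A ℤ} {i j k l m : ℤ} (h1 : i = j) (h2 : j = k) (h3 : k = l)
          (h4 : l = m) : (K.XIsoOfEq (h1.trans (h2.trans (h3.trans h4)))).hom =
          (K.XIsoOfEq h1).hom ≫ (K.XIsoOfEq h2).hom ≫ (K.XIsoOfEq h3).hom ≫
            (K.XIsoOfEq h4).hom := by
        simp
      exact e (K := D.E) (show n + 1 + (a + b) = n + 1 + b + a by ring)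
        (show n + 1 + b + a = n + b + 1 + a by ring) (show n + b + 1 + a = n + b + a + 1 by ring)
        (show n + b + a + 1 = n + (a + b) + 1 by ring)
  ext n
  have := congr(StrictHom.toHom $(key n))
  rw [StrictHom.comp_toHom, StrictHom.comp_toHom, StrictHom.comp_toHom, ← cx_XIsoOfEq] at this
  exact this

lemma cxMap_id (hD : compat τ D) : cxMap (𝟙 D) hD hD = 𝟙 _ := by
  ext n
  exact congr(StrictHom.toHom $(strict_id _ _))

lemma cxMap_comp (f : D ⟶ D') (g : D' ⟶ D'') (hD : compat τ D) (hD' : compat τ D')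
    (hD'' : compat τ D'') : cxMap (f ≫ g) hD hD'' = cxMap f hD hD' ≫ cxMap g hD' hD'' := by
  ext n
  exact congr(StrictHom.toHom $(strict_comp f g _ _ _ n)).trans (StrictHom.comp_toHom _ _)

/-- The isomorphism of complexes attached to an isomorphism of decorated complexes. -/
@[simps] noncomputable def cxMapIso (e : D ≅ D') (hD : compat τ D) (hD' : compat τ D') :
    D.cx hD ≅ D'.cx hD' where
  hom := cxMap e.hom hD hD'
  inv := cxMap e.inv hD' hD
  hom_inv_id := by rw [← cxMap_comp, e.hom_inv_id, cxMap_id]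
  inv_hom_id := by rw [← cxMap_comp, e.inv_hom_id, cxMap_id]

/-- A pasting of squares in an arbitrary category, so that it can be applied to objects whose
identification needs unfolding of the shift. -/
lemma comp_comp_eq_of_eq {C : Type*} [Category C] {x y z w p q : C} {f : x ⟶ y} {g : y ⟶ z}
    {h : z ⟶ w} {k : x ⟶ p} {l : p ⟶ z} {m : p ⟶ q} {n : q ⟶ w} (h1 : f ≫ g = k ≫ l)
    (h2 : l ≫ h = m ≫ n) : f ≫ g ≫ h = (k ≫ m) ≫ n := by
  rw [reassoc_of% h1, h2, Category.assoc]

lemma comp_comp_comp_eq_of_eq {C : Type*} [Category C] {x₁ x₂ x₃ x₄ x₅ x₆ x₇ x₈ x₉ : C}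
    {k : x₁ ⟶ x₂} {s : x₂ ⟶ x₃} {t : x₃ ⟶ x₄} {z : x₄ ⟶ x₅} {i : x₅ ⟶ x₆} {u : x₁ ⟶ x₇}
    {v : x₇ ⟶ x₈} {w : x₈ ⟶ x₃} {t' : x₈ ⟶ x₉} {w' : x₉ ⟶ x₄} {c : x₉ ⟶ x₅}
    (h1 : k ≫ s = u ≫ v ≫ w) (h2 : w ≫ t = t' ≫ w') (h3 : c = w' ≫ z) :
    k ≫ s ≫ t ≫ z ≫ i = u ≫ (v ≫ t') ≫ c ≫ i := by
  rw [reassoc_of% h1, reassoc_of% h2, h3]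
  simp

section

variable (P : ObjectProperty (Dec A)) [P.IsStableUnderShift ℤ] (hP : P ≤ compat τ)

/-- The compatibility of the functor `toCx` with the shift by `a`. -/
noncomputable def toCxShiftIso (a : ℤ) :
    shiftFunctor P.FullSubcategory a ⋙ toCx P hP ≅
      toCx P hP ⋙ shiftFunctor (CochainComplex (Tilt τ) ℤ) a :=
  NatIso.ofComponents
    (fun X => cxMapIso (D' := X.obj.shiftObj a) ((P.ι.commShiftIso a).app X)
      (hP _ (X⟦a⟧).property) (compat_shift (hP _ X.property) a) ≪≫
      cxShiftIso (hP _ X.property) a)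
    (fun {X Y} f => by
      have h := (P.ι.commShiftIso a).hom.naturality f
      have h1 := cxShiftIso_naturality f.hom (hP _ X.property) (hP _ Y.property) a
      have h2 := cxMap_comp (D' := (Y⟦a⟧).obj) (D'' := Y.obj.shiftObj a) (f⟦a⟧').hom
        ((P.ι.commShiftIso a).hom.app Y) (hP _ (X⟦a⟧).property)
        (hP _ (Y⟦a⟧).property) (compat_shift (hP _ Y.property) a)
      have h3 := cxMap_comp (D := (X⟦a⟧).obj) (D' := X.obj.shiftObj a) (D'' := Y.obj.shiftObj a)
        ((P.ι.commShiftIso a).hom.app X) ((shiftBy A a).map f.hom) (hP _ (X⟦a⟧).property)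
        (compat_shift (hP _ X.property) a) (compat_shift (hP _ Y.property) a)
      have h4 := h2.symm.trans ((congr(cxMap $h (hP _ (X⟦a⟧).property)
        (compat_shift (hP _ Y.property) a))).trans h3)
      exact comp_comp_eq_of_eq h4 h1)

lemma toCxShiftIso_hom_app (a : ℤ) (X : P.FullSubcategory) :
    (toCxShiftIso P hP a).hom.app X = cxMap (D := (X⟦a⟧).obj) (D' := X.obj.shiftObj a)
      ((P.ι.commShiftIso a).hom.app X) (hP _ (X⟦a⟧).property) (compat_shift (hP _ X.property) a) ≫
      (cxShiftIso (hP _ X.property) a).hom := rfl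

noncomputable instance : (toCx P hP).CommShift ℤ where
  commShiftIso := toCxShiftIso P hP
  commShiftIso_zero := by
    ext1
    apply NatTrans.ext
    funext X
    rw [toCxShiftIso_hom_app, Functor.CommShift.isoZero_hom_app, cxShiftIso_zero]
    have h := congr($(P.ι.commShiftIso_zero ℤ).hom.app X ≫ (shiftFunctorZero (Dec A) ℤ).hom.app _)
    rw [Functor.CommShift.isoZero_hom_app, Category.assoc, Iso.inv_hom_id_app] at h
    have h' : (P.ι.commShiftIso (0 : ℤ)).hom.app X ≫ (shiftZero A).hom.app X.obj =
      ((shiftFunctorZero P.FullSubcategory ℤ).hom.app X).hom := h.trans (Category.comp_id _)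
    rw [← Category.assoc]
    refine congr($((cxMap_comp (D' := X.obj.shiftObj 0) (D'' := X.obj) _ _ _ _ _).symm.trans ?_) ≫ _)
    exact congr(cxMap $h' _ _)
  commShiftIso_add a b := by
    ext1
    apply NatTrans.ext
    funext X
    rw [Functor.CommShift.isoAdd_hom_app, toCxShiftIso_hom_app, toCxShiftIso_hom_app,
      toCxShiftIso_hom_app, cxShiftIso_add]
    let u : (X⟦a + b⟧).obj ⟶ ((X⟦a⟧)⟦b⟧).obj :=
      ((shiftFunctorAdd P.FullSubcategory a b).hom.app X).hom
    let v : ((X⟦a⟧)⟦b⟧).obj ⟶ (X⟦a⟧).obj.shiftObj b := (P.ι.commShiftIso b).hom.app (X⟦a⟧)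
    let w : (X⟦a⟧).obj ⟶ X.obj.shiftObj a := (P.ι.commShiftIso a).hom.app X
    let w' : (X⟦a⟧).obj.shiftObj b ⟶ (X.obj.shiftObj a).shiftObj b := (shiftBy A b).map w
    let k : (X⟦a + b⟧).obj ⟶ X.obj.shiftObj (a + b) := (P.ι.commShiftIso (a + b)).hom.app X
    let s : X.obj.shiftObj (a + b) ⟶ (X.obj.shiftObj a).shiftObj b := (shiftAdd A a b).hom.app X.obj
    have h : k ≫ s = u ≫ v ≫ w' := by
      have h := congr($(P.ι.commShiftIso_add a b).hom.app X ≫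
        (shiftFunctorAdd (Dec A) a b).hom.app _)
      rw [Functor.CommShift.isoAdd_hom_app, Category.assoc, Category.assoc, Category.assoc,
        Iso.inv_hom_id_app] at h
      exact h.trans congr(_ ≫ _ ≫ $(Category.comp_id _))
    have hX := hP _ X.property
    have hu := hP _ (X⟦a + b⟧).property
    have hv := hP _ ((X⟦a⟧)⟦b⟧).property
    have hw := hP _ (X⟦a⟧).property
    have h1 : cxMap k hu (compat_shift hX _) ≫
        cxMap s (compat_shift hX _) (compat_shift (compat_shift hX a) b) =
        cxMap u hu hv ≫ cxMap v hv (compat_shift hw b) ≫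
          cxMap w' (compat_shift hw b) (compat_shift (compat_shift hX a) b) := by
      rw [← cxMap_comp, ← cxMap_comp, ← cxMap_comp, h]
    have h2 := cxShiftIso_naturality w hw (compat_shift hX a) b
    exact comp_comp_comp_eq_of_eq h1 h2 (Functor.map_comp _ _ _)

end

end

end Dec

end HRS

/-! ### Homotopies and cones of decorated complexes. -/

namespace HRS

variable {A : Type u} [Category.{v} A] [Abelian A] {τ : TorsionPair A}

namespace Dec

variable {D D' : Dec A}

section

variable {f g : D ⟶ D'} (h : Homotopy f.hom g.hom)

lemma homotopy_comm (i j : ℤ) (hij : j + 1 = i) :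
    D.E.d i (i + 1) ≫ h.hom (i + 1) i + h.hom i j ≫ D'.E.d j i = f.hom.f i - g.hom.f i := by
  have := h.comm i
  rw [dNext_eq _ (show (ComplexShape.up ℤ).Rel i (i + 1) from rfl),
    prevD_eq _ (show (ComplexShape.up ℤ).Rel j i from hij)] at this
  rw [this, add_sub_cancel_right]

lemma arrow_hom_π (f : D ⟶ D') (j : ℤ) :
    (D.M j).arrow ≫ f.hom.f j ≫ cokernel.π (D'.M j).arrow = 0 := by
  rw [← Category.assoc, ← factors_iff_π]
  exact f.factors j

variable (hM : ∀ i j : ℤ, (D'.M j).Factors ((D.M i).arrow ≫ h.hom i j))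

/-- The chain map in degree `i` attached to a homotopy. -/
noncomputable def homotopyStrict (hD : compat τ D) (hD' : compat τ D') (i j : ℤ) (hij : j + 1 = i) :
    StrictHom (D.tilt hD i) (D'.tilt hD' j) :=
  -- Since `f - g` carries `Mⁱ` into the decoration, the homotopy relation gives `dh = -hd` on `Mⁱ`
  -- modulo the decoration; this forces the relative sign of the two components.
  mkStrict hD hD' (-h.hom i j) (h.hom (i + 1) (j + 1))
    (by rw [Preadditive.comp_neg]; exact factors_neg (hM i j)) (hM _ _) (by
      subst hij
      have h1 := congr((D.M (j + 1)).arrow ≫ $(homotopy_comm h (j + 1) j rfl) ≫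
        cokernel.π (D'.M (j + 1)).arrow)
      simp only [Preadditive.add_comp, Preadditive.comp_add, Preadditive.sub_comp,
        Preadditive.comp_sub, arrow_hom_π, sub_zero, Category.assoc] at h1
      rw [add_eq_zero_iff_eq_neg] at h1
      simpa using h1)

lemma induces_homotopyStrict (hD : compat τ D) (hD' : compat τ D') (i j : ℤ) (hij : j + 1 = i) :
    Induces (homotopyStrict h hM hD hD' i j hij) (-h.hom i j) (h.hom (i + 1) (j + 1)) :=
  induces_mkStrict ..

variable [Abelian (Tilt τ)]

/-- The component `h : Eᵏ ⟶ E'ⁱ` maps between the middle objects of the butterflies `i ⟶ k` and `j ⟶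
i`. It is a square up to the chain map `f - g`, so `comp_add_eq` turns it into the homotopy
relation. Composing the target map with `-1` compensates for the sign in `homotopyStrict`. -/
lemma homotopyStrict_comm (hD : compat τ D) (hD' : compat τ D') (i j k : ℤ) (hij : j + 1 = i)
    (hk : i + 1 = k) :
    (strict f hD hD' i).toHom =
      (D.bfly hD i k hk).toHom ≫ (homotopyStrict h hM hD hD' k i hk).toHom +
      (homotopyStrict h hM hD hD' i j hij).toHom ≫ (D'.bfly hD' j i hij).toHom +
      (strict g hD hD' i).toHom := by
  have h1 := induces_homotopyStrict h hM hD hD' i j hij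
  have h2 := (induces_homotopyStrict h hM hD hD' k i hk).comp (Induces.sign hD' i (-1))
  have h3 := (induces_strict f hD hD' i).add
    ((induces_strict g hD hD' i).comp (Induces.sign hD' i (-1)))
  have c1 := homotopy_comm h i j hij
  have c2 := homotopy_comm h k i hk
  have key := Butterfly.comp_add_eq (D.bfly hD i k hk) (D'.bfly hD' j i hij)
    (homotopyStrict h hM hD hD' i j hij)
    ((homotopyStrict h hM hD hD' k i hk).comp (StrictHom.sign _ (-1)))
    ((strict f hD hD' i).add ((strict g hD hD' i).comp (StrictHom.sign _ (-1)))) (h.hom k i)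
    (by
      have h4 := h1.fm
      have h5 := h3.fm
      dsimp only [bfly]
      rw [reassoc_of% h4, h5]
      subst hk
      simp only [Units.smul_def, Units.val_neg, Units.val_one, neg_smul, one_smul,
        Preadditive.comp_neg, Preadditive.neg_comp, Category.comp_id, ← sub_eq_add_neg, ← c1]
      simp)
    (by
      have h4 := h2.fm
      dsimp only [bfly]
      rw [h4]
      simp [Units.smul_def])
    (by
      have h4 := h1.f0
      subst hk
      subst hij
      dsimp only [bfly]
      rw [quotπ_self, quotπ_self, h4])
    (by
      have h4 := h2.f0
      have h5 := h3.f0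
      subst hk
      dsimp only [bfly]
      rw [quotπ_self, Category.assoc, h4, h5, ← Category.assoc, ← Category.assoc,
        ← Preadditive.add_comp, ← Category.assoc (D.E.d _ _)]
      congr 1
      simp only [Units.smul_def, Units.val_neg, Units.val_one, neg_smul, one_smul,
        Preadditive.comp_neg, Category.comp_id, ← sub_eq_add_neg, ← c2]
      simp)
  simp only [StrictHom.comp_toHom, StrictHom.sign_toHom, StrictHom.add_toHom] at key
  simp only [Units.smul_def, Units.val_neg, Units.val_one, neg_smul, one_smul,
        Preadditive.comp_neg, Category.comp_id] at key
  rw [← key]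
  abel

open Classical in
/-- A homotopy which respects the decorations gives a homotopy over the tilted category. -/
noncomputable def cxHomotopy (hD : compat τ D) (hD' : compat τ D') :
    Homotopy (cxMap f hD hD') (cxMap g hD hD') where
  hom i j := if hij : j + 1 = i then (homotopyStrict h hM hD hD' i j hij).toHom else 0
  zero i j hij := dif_neg hij
  comm i := by
    rw [dNext_eq _ (show (ComplexShape.up ℤ).Rel i (i + 1) from rfl),
      prevD_eq _ (show (ComplexShape.up ℤ).Rel (i - 1) i from by simp), dif_pos rfl,
      dif_pos (by simp), cx_d_eq _ _ _ rfl, cx_d_eq _ _ _ (by simp)]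
    exact homotopyStrict_comm h hM hD hD' i (i - 1) (i + 1) _ _

lemma cxHomotopy_hom (hD : compat τ D) (hD' : compat τ D') (i j : ℤ) (hij : j + 1 = i) :
    (cxHomotopy h hM hD hD').hom i j = (homotopyStrict h hM hD hD' i j hij).toHom :=
  dif_pos hij

end

section Cone

open CochainComplex HomComplex

variable (f : D ⟶ D')

/-- The inclusion of the source into the cone is a null homotopy. -/
noncomputable def coneHomotopy : Homotopy (f ≫ coneInr f).hom
    (⟨0, fun _ => by simpa using Subobject.factors_zero⟩ : D ⟶ cone f).hom :=
  (Cochain.equivHomotopy (f.hom ≫ mappingCone.inr f.hom) 0).symm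
    ⟨mappingCone.inl f.hom, by simp⟩

lemma coneHomotopy_hom (i j : ℤ) (hij : j + 1 = i) :
    (coneHomotopy f).hom i j = (mappingCone.inl f.hom).v i j (by lia) :=
  dif_pos _

lemma coneHomotopy_factors (i j : ℤ) :
    ((cone f).M j).Factors ((D.M i).arrow ≫ (coneHomotopy f).hom i j) := by
  by_cases hij : j + 1 = i
  · rw [coneHomotopy_hom f i j hij]
    exact inl_factors f.hom D.M D'.M j i (by lia)
  · rw [(coneHomotopy f).zero i j hij, comp_zero]
    exact Subobject.factors_zero

variable (hD : compat τ D) (hD' : compat τ D')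

lemma factors_comp_neg {U X Y : A} {M : Subobject Y} {s : U ⟶ X} {g : X ⟶ Y}
    (h : M.Factors (s ≫ g)) : M.Factors (s ≫ (-g)) := by
  rw [Preadditive.comp_neg]
  exact factors_neg h

lemma comp_eq_of_eq_neg {U X Y Z W V : A} {s : U ⟶ X} {d : X ⟶ Y} {p : Y ⟶ Z} {q : X ⟶ W}
    {e : W ⟶ Z} {t : Z ⟶ V} (h : d ≫ p = -q ≫ e) : s ≫ d ≫ p ≫ t = s ≫ (-q) ≫ e ≫ t := by
  rw [reassoc_of% h]
  simp

lemma comp_eq_of_eq_add {U X Y Z W W' V : A} {s : U ⟶ X} {d : X ⟶ Y} {p : Y ⟶ Z} {q : X ⟶ W}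
    {e : W ⟶ Z} {a : X ⟶ W'} {b : W' ⟶ Z} {t : Z ⟶ V} (h : d ≫ p = a ≫ b + q ≫ e)
    (h' : s ≫ a ≫ b ≫ t = 0) : s ≫ d ≫ p ≫ t = s ≫ q ≫ e ≫ t := by
  rw [reassoc_of% h]
  simp [h']

/-- The projection of the object in degree `n` for the cone to the object in degree `n + 1` for
the source. -/
noncomputable def coneFst (n m : ℤ) (h : n + 1 = m) :
    StrictHom ((cone f).tilt (compat_cone f hD hD') n) (D.tilt hD m) :=
  mkStrict (D := cone f) (compat_cone f hD hD') hD (-(mappingCone.fst f.hom).1.v n m h)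
    ((mappingCone.fst f.hom).1.v (n + 1) (m + 1) (by lia))
    (factors_comp_neg (X := (mappingCone f.hom).X n)
      ((coneDecoration_factors_iff f.hom D.M D'.M n m h _).1 (Subobject.factors_self _)).1)
    (((coneDecoration_factors_iff f.hom D.M D'.M (n + 1) (m + 1) (by lia) _).1
        (Subobject.factors_self _)).1)
    (by
      have := mappingCone.d_fst_v f.hom n (n + 1) (m + 1) rfl (by lia)
      subst h
      exact comp_eq_of_eq_neg this)

lemma induces_coneFst (n m : ℤ) (h : n + 1 = m) :
    Induces (coneFst f hD hD' n m h) (-(mappingCone.fst f.hom).1.v n m h)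
      ((mappingCone.fst f.hom).1.v (n + 1) (m + 1) (by lia)) :=
  induces_mkStrict ..

/-- The projection of the object in degree `n` for the cone to the object for the target. -/
noncomputable def coneSnd (n : ℤ) :
    StrictHom ((cone f).tilt (compat_cone f hD hD') n) (D'.tilt hD' n) :=
  mkStrict (D := cone f) (compat_cone f hD hD') hD' ((mappingCone.snd f.hom).v n n (add_zero n))
    ((mappingCone.snd f.hom).v (n + 1) (n + 1) (by lia))
    (((coneDecoration_factors_iff f.hom D.M D'.M n _ rfl _).1 (Subobject.factors_self _)).2)
    (((coneDecoration_factors_iff f.hom D.M D'.M (n + 1) _ rfl _).1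
        (Subobject.factors_self _)).2)
    (by
      have h1 := mappingCone.d_snd_v f.hom n (n + 1) rfl
      have h2 := ((coneDecoration_factors_iff f.hom D.M D'.M n _ rfl _).1
        (Subobject.factors_self _)).1
      have h3 := (factors_iff_π _ _).1 (factors_comp (f.factors (n + 1)) h2)
      simp only [Category.assoc] at h3
      exact comp_eq_of_eq_add h1 h3)

lemma induces_coneSnd (n : ℤ) :
    Induces (coneSnd f hD hD' n) ((mappingCone.snd f.hom).v n n (add_zero n))
      ((mappingCone.snd f.hom).v (n + 1) (n + 1) (by lia)) :=
  induces_mkStrict ..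

/-- The inclusion of the object in degree `m` for the source into the object in degree `m - 1`
for the cone. -/
noncomputable def coneInlStrict (n m : ℤ) (h : n + 1 = m) :
    StrictHom (D.tilt hD m) ((cone f).tilt (compat_cone f hD hD') n) :=
  homotopyStrict (coneHomotopy f) (coneHomotopy_factors f) hD (compat_cone f hD hD') m n h

lemma induces_coneInlStrict (n m : ℤ) (h : n + 1 = m) :
    Induces (coneInlStrict f hD hD' n m h) (-(mappingCone.inl f.hom).v m n (by lia))
      ((mappingCone.inl f.hom).v (m + 1) (n + 1) (by lia)) := by
  have := induces_homotopyStrict (coneHomotopy f) (coneHomotopy_factors f) hD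
    (compat_cone f hD hD') m n h
  rw [coneHomotopy_hom f m n h, coneHomotopy_hom f (m + 1) (n + 1) (by lia)] at this
  exact this

/-- The inclusion of the object for the target into the object for the cone. -/
noncomputable def coneInrStrict (n : ℤ) :
    StrictHom (D'.tilt hD' n) ((cone f).tilt (compat_cone f hD hD') n) :=
  strict (coneInr f) hD' (compat_cone f hD hD') n

lemma induces_coneInrStrict (n : ℤ) :
    Induces (coneInrStrict f hD hD' n) ((mappingCone.inr f.hom).f n)
      ((mappingCone.inr f.hom).f (n + 1)) :=
  induces_strict ..

lemma Induces.zero (hD : compat τ D) (hD' : compat τ D') (i j : ℤ) :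
    Induces (StrictHom.zero (D.tilt hD i) (D'.tilt hD' j)) 0 0 where
  fm := by simp
  f0 := by simp

/-- This and the four relations that follow make the object of the cone a biproduct of the two
pieces. They are inherited from the mapping cone in `A`, where the signs in degree `-1` of
`coneInlStrict` and `coneFst` cancel. -/
lemma coneInlStrict_coneFst (n m : ℤ) (h : n + 1 = m) :
    (coneInlStrict f hD hD' n m h).comp (coneFst f hD hD' n m h) = StrictHom.id _ := by
  refine ((induces_coneInlStrict f hD hD' n m h).comp (induces_coneFst f hD hD' n m h)).eq_of_eq
    (Induces.id hD m) ?_ ?_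
  · exact (Preadditive.neg_comp_neg ..).trans (mappingCone.inl_v_fst_v f.hom m n h)
  · exact mappingCone.inl_v_fst_v f.hom (m + 1) (n + 1) (by lia)

lemma coneInlStrict_coneSnd (n m : ℤ) (h : n + 1 = m) :
    (coneInlStrict f hD hD' n m h).comp (coneSnd f hD hD' n) = StrictHom.zero _ _ := by
  refine ((induces_coneInlStrict f hD hD' n m h).comp (induces_coneSnd f hD hD' n)).eq_of_eq
    (Induces.zero hD hD' m n) ?_ ?_
  · exact (Preadditive.neg_comp ..).trans
      ((congr(-$(mappingCone.inl_v_snd_v f.hom m n (by lia)))).trans neg_zero)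
  · exact mappingCone.inl_v_snd_v f.hom (m + 1) (n + 1) (by lia)

lemma coneInrStrict_coneFst (n m : ℤ) (h : n + 1 = m) :
    (coneInrStrict f hD hD' n).comp (coneFst f hD hD' n m h) = StrictHom.zero _ _ := by
  refine ((induces_coneInrStrict f hD hD' n).comp (induces_coneFst f hD hD' n m h)).eq_of_eq
    (Induces.zero hD' hD n m) ?_ ?_
  · exact (Preadditive.comp_neg ..).trans
      ((congr(-$(mappingCone.inr_f_fst_v f.hom n m h))).trans neg_zero)
  · exact mappingCone.inr_f_fst_v f.hom (n + 1) (m + 1) (by lia)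

lemma coneInrStrict_coneSnd (n : ℤ) :
    (coneInrStrict f hD hD' n).comp (coneSnd f hD hD' n) = StrictHom.id _ := by
  refine ((induces_coneInrStrict f hD hD' n).comp (induces_coneSnd f hD hD' n)).eq_of_eq
    (Induces.id hD' n) ?_ ?_
  · exact mappingCone.inr_f_snd_v f.hom n
  · exact mappingCone.inr_f_snd_v f.hom (n + 1)

lemma cone_total (n m : ℤ) (h : n + 1 = m) :
    ((coneFst f hD hD' n m h).comp (coneInlStrict f hD hD' n m h)).add
      ((coneSnd f hD hD' n).comp (coneInrStrict f hD hD' n)) = StrictHom.id _ := by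
  refine (((induces_coneFst f hD hD' n m h).comp (induces_coneInlStrict f hD hD' n m h)).add
    ((induces_coneSnd f hD hD' n).comp (induces_coneInrStrict f hD hD' n))).eq_of_eq
    (Induces.id (compat_cone f hD hD') n) ?_ ?_
  · exact (congr($(Preadditive.neg_comp_neg ..) + _)).trans (mappingCone.id_X f.hom n m h)
  · exact mappingCone.id_X f.hom (n + 1) (m + 1) (by lia)

variable [Abelian (Tilt τ)]

/-- The comparison map from the cone over the tilted category. -/
noncomputable def coneComparison :
    mappingCone (cxMap f hD hD') ⟶ (cone f).cx (compat_cone f hD hD') :=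
  mappingCone.desc _
    (Cochain.ofHomotopy (cxHomotopy (coneHomotopy f) (coneHomotopy_factors f) hD
      (compat_cone f hD hD')))
    (cxMap (coneInr f) hD' (compat_cone f hD hD')) (by
      have h0 : cxMap (⟨0, fun _ => by simpa using Subobject.factors_zero⟩ : D ⟶ cone f) hD
          (compat_cone f hD hD') = 0 := by
        ext n
        have : strict (⟨0, fun _ => by simpa using Subobject.factors_zero⟩ : D ⟶ cone f) hD
            (compat_cone f hD hD') n = StrictHom.zero _ _ :=
          (induces_strict _ hD (compat_cone f hD hD') n).unique (Induces.zero ..)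
        exact congr(StrictHom.toHom $this).trans (StrictHom.zero_toHom ..)
      rw [δ_ofHomotopy, h0, cxMap_comp _ _ hD hD' (compat_cone f hD hD')]
      simp)

lemma inl_coneComparison (n m : ℤ) (h : n + 1 = m) :
    (mappingCone.inl (cxMap f hD hD')).v m n (by lia) ≫ (coneComparison f hD hD').f n =
      (coneInlStrict f hD hD' n m h).toHom := by
  rw [coneComparison, mappingCone.inl_v_desc_f, Cochain.ofHomotopy, Cochain.mk_v]
  exact cxHomotopy_hom ..

lemma inr_coneComparison :
    mappingCone.inr (cxMap f hD hD') ≫ coneComparison f hD hD' =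
      cxMap (coneInr f) hD' (compat_cone f hD hD') := by
  rw [coneComparison, mappingCone.inr_desc]

lemma inr_coneComparison_f (n : ℤ) :
    (mappingCone.inr (cxMap f hD hD')).f n ≫ (coneComparison f hD hD').f n =
      (coneInrStrict f hD hD' n).toHom := by
  rw [coneComparison, mappingCone.inr_f_desc_f]
  rfl

/-- In each degree both sides are biproducts of the same two objects, and the comparison matches the
inclusions; the inverse is assembled from `coneFst` and `coneSnd`. -/
instance (n : ℤ) : IsIso ((coneComparison f hD hD').f n) := by
  have e1 := congr(StrictHom.toHom $(coneInlStrict_coneFst f hD hD' n (n + 1) rfl))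
  have e2 := congr(StrictHom.toHom $(coneInlStrict_coneSnd f hD hD' n (n + 1) rfl))
  have e3 := congr(StrictHom.toHom $(coneInrStrict_coneFst f hD hD' n (n + 1) rfl))
  have e4 := congr(StrictHom.toHom $(coneInrStrict_coneSnd f hD hD' n))
  have e5 := congr(StrictHom.toHom $(cone_total f hD hD' n (n + 1) rfl))
  rw [StrictHom.comp_toHom, StrictHom.id_toHom] at e1 e4
  rw [StrictHom.comp_toHom, StrictHom.zero_toHom] at e2 e3
  rw [StrictHom.add_toHom, StrictHom.comp_toHom, StrictHom.comp_toHom, StrictHom.id_toHom] at e5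
  refine ⟨(coneFst f hD hD' n (n + 1) rfl).toHom ≫
    (mappingCone.inl (cxMap f hD hD')).v (n + 1) n (by lia) +
      (coneSnd f hD hD' n).toHom ≫ (mappingCone.inr (cxMap f hD hD')).f n, ?_, ?_⟩
  · apply mappingCone.ext_from _ (n + 1) n rfl
    · rw [← Category.assoc, inl_coneComparison f hD hD' n (n + 1) rfl, Preadditive.comp_add,
        reassoc_of% e1, reassoc_of% e2]
      simp
    · rw [← Category.assoc, inr_coneComparison_f, Preadditive.comp_add,
        reassoc_of% e3, reassoc_of% e4]
      simp
  · rw [Preadditive.add_comp, Category.assoc, Category.assoc,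
      inl_coneComparison f hD hD' n (n + 1) rfl, inr_coneComparison_f, e5]

instance : IsIso (coneComparison f hD hD') :=
  HomologicalComplex.Hom.isIso_of_components _

end Cone

end Dec

end HRS

/-! ### Triangles of decorated cones become distinguished. -/

namespace HRS

variable {A : Type u} [Category.{v} A] [Abelian A] {τ : TorsionPair A}

namespace Dec

variable {D D' : Dec A}

section

open CochainComplex HomComplex

variable (f : D ⟶ D') (hD : compat τ D) (hD' : compat τ D')

/-- The third map of the mapping cone triangle is `-1` on the first summand. In degree `-1` the
signs of `coneInlStrict` and of `shiftStrict` cancel, and in degree `0` neither has one, so `-1`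
remains in both. -/
lemma coneInlStrict_δ (n : ℤ) :
    ((coneInlStrict f hD hD' n (n + 1) rfl).comp
      (strict (D := cone f) (D' := D.shiftObj 1) (coneδ f) (compat_cone f hD hD')
        (compat_shift hD 1) n)).comp (shiftStrict hD 1 n) = StrictHom.sign _ (-1) := by
  refine (((induces_coneInlStrict f hD hD' n (n + 1) rfl).comp (induces_strict (D := cone f)
    (D' := D.shiftObj 1) (coneδ f) _ _ n)).comp (induces_shiftStrict hD 1 n)).eq_of_eq
    (Induces.sign hD (n + 1) (-1)) ?_ ?_
  · have e {X Y : A} {i : X ⟶ Y} {d : Y ⟶ X} (h : i ≫ d = -𝟙 X) :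
        (-i ≫ d) ≫ ((1 : ℤ).negOnePow • 𝟙 X) = (-1 : ℤˣ) • 𝟙 X := by
      rw [h]
      simp
    have h := mappingCone.inl_v_triangle_mor₃_f f.hom (n + 1) n (by lia)
    simp only [shiftFunctorObjXIso, HomologicalComplex.XIsoOfEq_rfl] at h
    exact (congr($(Preadditive.neg_comp ..) ≫ _)).trans (e h)
  · have e {K : CochainComplex A ℤ} {i j : ℤ} (h : i = j) {Y : A} {u : K.X j ⟶ Y} {d : Y ⟶ K.X i}
        (h' : u ≫ d = -(K.XIsoOfEq h).inv) : (u ≫ d) ≫ (K.XIsoOfEq h).hom = (-1 : ℤˣ) • 𝟙 _ := by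
      subst h
      rw [h']
      simp [Units.smul_def]
    exact e (K := D.E) (show n + 1 + 1 = n + 1 + 1 by ring)
      (mappingCone.inl_v_triangle_mor₃_f f.hom (n + 1 + 1) (n + 1) (by lia))

lemma coneInrStrict_δ (n : ℤ) :
    (coneInrStrict f hD hD' n).comp
      (strict (D := cone f) (D' := D.shiftObj 1) (coneδ f) (compat_cone f hD hD')
        (compat_shift hD 1) n) = StrictHom.zero _ _ := by
  refine ((induces_coneInrStrict f hD hD' n).comp (induces_strict (D := cone f)
    (D' := D.shiftObj 1) (coneδ f) _ _ n)).eq_of_eq (Induces.zero hD' (compat_shift hD 1) n n) ?_ ?_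
  · exact mappingCone.inr_f_triangle_mor₃_f f.hom n
  · exact mappingCone.inr_f_triangle_mor₃_f f.hom (n + 1)

variable [Abelian (Tilt τ)]

/-- The comparison map as an isomorphism. -/
noncomputable def coneIso :
    mappingCone (cxMap f hD hD') ≅ (cone f).cx (compat_cone f hD hD') :=
  asIso (coneComparison f hD hD')

/-- Checked on the two summands of the mapping cone, where it reduces to `coneInlStrict_δ` and
`coneInrStrict_δ`. -/
lemma coneComparison_mor₃ :
    coneComparison f hD hD' ≫ cxMap (D := cone f) (D' := D.shiftObj 1) (coneδ f)
      (compat_cone f hD hD') (compat_shift hD 1) ≫ (cxShiftIso hD 1).hom =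
      (mappingCone.triangle (cxMap f hD hD')).mor₃ := by
  have e1 (n : ℤ) := congr(StrictHom.toHom $(coneInlStrict_δ f hD hD' n))
  have e2 (n : ℤ) := congr(StrictHom.toHom $(coneInrStrict_δ f hD hD' n))
  simp only [StrictHom.comp_toHom, StrictHom.sign_toHom, StrictHom.zero_toHom] at e1 e2
  ext n
  apply mappingCone.ext_from (cxMap f hD hD') (n + 1) n rfl
  · refine Eq.trans ?_ (mappingCone.inl_v_triangle_mor₃_f (cxMap f hD hD') (n + 1) n _).symm
    refine (Category.assoc _ _ _).symm.trans ((congr($(inl_coneComparison f hD hD' n (n + 1) rfl) ≫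
      _)).trans ((Category.assoc _ _ _).symm.trans ((e1 n).trans ?_)))
    simp only [shiftFunctorObjXIso, HomologicalComplex.XIsoOfEq_rfl, Units.smul_def, Units.val_neg,
      Units.val_one, neg_smul, one_smul]
    rfl
  · refine Eq.trans ?_ (mappingCone.inr_f_triangle_mor₃_f (cxMap f hD hD') n).symm
    refine (Category.assoc _ _ _).symm.trans ((congr($(inr_coneComparison_f f hD hD' n) ≫
      _)).trans ((Category.assoc _ _ _).symm.trans ((congr($(e2 n) ≫ _)).trans ?_)))
    exact zero_comp

end

section

variable [Abelian (Tilt τ)] (P : ObjectProperty (Dec A)) [P.IsStableUnderShift ℤ] [ConeClosed P]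
  (hP : P ≤ compat τ)

/-- The triangle attached to a decorated cone becomes the triangle attached to a mapping cone. -/
noncomputable def mapConeTriangleIso {X Y : P.FullSubcategory} (f : X ⟶ Y) :
    CochainComplex.mappingCone.triangle ((toCx P hP).map f) ≅
      (toCx P hP).mapTriangle.obj (coneTriangle P f) :=
  Pretriangulated.Triangle.isoMk _ _ (Iso.refl _) (Iso.refl _)
    (coneIso f.hom (hP _ X.property) (hP _ Y.property))
    ((Category.comp_id _).trans (Category.id_comp _).symm)
    ((inr_coneComparison f.hom (hP _ X.property) (hP _ Y.property)).trans
      (Category.id_comp _).symm)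
    (by
      have h1 := coneComparison_mor₃ f.hom (hP _ X.property) (hP _ Y.property)
      have h2 := cxMap_comp (D' := (X⟦(1 : ℤ)⟧).obj) (D'' := X.obj.shiftObj 1)
        (coneδ f.hom ≫ (P.ι.commShiftIso (1 : ℤ)).inv.app X)
        ((P.ι.commShiftIso (1 : ℤ)).hom.app X)
        (compat_cone f.hom (hP _ X.property) (hP _ Y.property)) (hP _ (X⟦(1 : ℤ)⟧).property)
        (compat_shift (hP _ X.property) 1)
      have h3 : (P.ι.commShiftIso (1 : ℤ)).inv.app X ≫ (P.ι.commShiftIso (1 : ℤ)).hom.app X =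
        𝟙 _ := Iso.inv_hom_id_app _ _
      have h4 : (coneδ f.hom ≫ (P.ι.commShiftIso (1 : ℤ)).inv.app X) ≫
          (P.ι.commShiftIso (1 : ℤ)).hom.app X = coneδ f.hom :=
        (Category.assoc _ _ _).trans (congr(_ ≫ $h3).trans (Category.comp_id _))
      have e {C : Type _} [Category C] {a b c d g : C} {p : a ⟶ b} {q : b ⟶ c} {r : c ⟶ d}
          {s : d ⟶ g} {t : b ⟶ d} {u : a ⟶ g} {v : g ⟶ g} (k1 : p ≫ t ≫ s = u) (k2 : t = q ≫ r)
          (k3 : v = 𝟙 g) : u ≫ v = p ≫ q ≫ r ≫ s := by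
        subst k2 k3
        rw [← k1]
        simp
      exact e h1 ((congr(cxMap $h4.symm _ _)).trans h2) (CategoryTheory.Functor.map_id _ _))

variable [HasDerivedCategory.{w} (Tilt τ)]

lemma coneTriangle_distinguished {X Y : P.FullSubcategory} (f : X ⟶ Y) :
    (toCx P hP ⋙ DerivedCategory.Q).mapTriangle.obj (coneTriangle P f) ∈
      Pretriangulated.distinguishedTriangles := by
  refine Pretriangulated.isomorphic_distinguished _
    (DerivedCategory.mappingCone_triangle_distinguished ((toCx P hP).map f)) _ ?_
  exact (Functor.mapTriangleCompIso _ _).app _ ≪≫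
    DerivedCategory.Q.mapTriangle.mapIso (mapConeTriangleIso P hP f).symm

end

end Dec

end HRS

/-! ### Acyclicity over `A` and over the tilted category. -/

namespace HRS

variable {A : Type u} [Category.{v} A] [Abelian A] {τ : TorsionPair A}

lemma exact_mk_iff {C : Type*} [Category C] [Abelian C] {X Y Z : C} (f : X ⟶ Y) (g : Y ⟶ Z)
    (w : f ≫ g = 0) : (ShortComplex.mk f g w).Exact ↔ ∀ ⦃U : C⦄ (x : U ⟶ Y), x ≫ g = 0 →
      ∃ (U' : C) (π : U' ⟶ U) (_ : Epi π) (y : U' ⟶ X), π ≫ x = y ≫ f :=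
  ShortComplex.exact_iff_exact_up_to_refinements _

namespace Butterfly

variable {X Y Z : Tilt τ} {P : Butterfly X Y} {Q : Butterfly Y Z} {δ : P.E ⟶ Q.E}

/-- Restricted to `R`, the link lands in `Z⁻¹`, and the vanishing from `T` to `F` kills it, so it
factors through `C`. The composite `C ⟶ E' ⟶ C'` vanishes for the same reason, so the link lands in
`R'`. -/
lemma ImageFac.exists_connecting (I : P.ImageFac) (J : Q.ImageFac) (h : IsLink P Q δ) :
    ∃ δ' : I.C ⟶ J.R, I.p ≫ δ' ≫ J.i = δ := by
  have : Epi I.p := I.exact.epi_g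
  obtain ⟨y, hy⟩ := Q.exists_lift (I.i ≫ δ) (by
    rw [Category.assoc, h.σ, ← I.p_c, reassoc_of% I.i_p, zero_comp])
  have hy0 : y = 0 := by
    have h1 : I.facX.sub.d ≫ y = 0 := by
      change I.k ≫ y = 0
      rw [← cancel_mono Q.ι, Category.assoc, hy, reassoc_of% I.k_i, h.κ, zero_comp]
    refine I.facX.sub.comp_eq_zero Z.d Z.ker_mem y h1 ?_
    rw [← Q.ι_ρ, reassoc_of% hy, h.ρ, comp_zero]
  rw [hy0, zero_comp] at hy
  obtain ⟨s, hs⟩ : ∃ s : I.C ⟶ Q.E, I.p ≫ s = δ :=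
    ⟨I.exact.exact.desc δ hy.symm, I.exact.exact.g_desc δ hy.symm⟩
  have hs0 : s ≫ J.p = 0 := by
    refine I.facY.sub.comp_eq_zero J.c J.facY.quot.ker_mem (s ≫ J.p) ?_ ?_
    · change (P.ι ≫ I.p) ≫ s ≫ J.p = 0
      rw [Category.assoc, reassoc_of% hs, reassoc_of% h.ι, ← J.k_i, Category.assoc, J.i_p,
        comp_zero]
    · rw [← cancel_epi I.p, Category.assoc, J.p_c, reassoc_of% hs, h.ρ, comp_zero]
  have : Mono (ShortComplex.mk J.i J.p J.i_p).f := J.exact.mono_f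
  exact ⟨J.exact.exact.lift s hs0, by rw [← hs]; exact congr(_ ≫ $(J.exact.exact.lift_f s hs0))⟩

section

variable {I : P.ImageFac} {J : Q.ImageFac} (h : IsLink P Q δ) {δ' : I.C ⟶ J.R}
  (hδ' : I.p ≫ δ' ≫ J.i = δ)

include h hδ'

lemma ImageFac.ι_connecting : (P.ι ≫ I.p) ≫ δ' = J.k := by
  have : Mono J.i := J.exact.mono_f
  rw [← cancel_mono J.i, Category.assoc, Category.assoc, hδ', h.ι, J.k_i]

lemma ImageFac.connecting_σ : δ' ≫ J.i ≫ Q.σ = I.c := by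
  have : Epi I.p := I.exact.epi_g
  rw [← cancel_epi I.p, reassoc_of% hδ', h.σ, I.p_c]

/-- The image `[Y⁻¹ ⟶ C]` of the first butterfly lies in the kernel `[Y⁻¹ ⟶ R']` of the second by
the factorization through `C` of the differential of this kernel. The quotient `[C ⟶ R']` is the
homology. -/
lemma ImageFac.exists_fac : ∃ W : J.facX.sub.Fac, (IsIso δ' ↔ IsIso W.quot.d) ∧
    ∃ e : X ⟶ W.sub, Epi e ∧ e ≫ W.inc.toHom ≫ J.facX.inc.toHom = P.toHom := by
  let W : J.facX.sub.Fac :=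
    { W := I.C
      w := P.ι ≫ I.p
      j := δ'
      fac := ImageFac.ι_connecting h hδ'
      coker_mem := I.facY.coker_mem
      ker_mem := fun U hU t ht => I.ker_mem U hU t (by
        rw [← ImageFac.connecting_σ h hδ', reassoc_of% ht, zero_comp]) }
  refine ⟨W, Iff.rfl, I.facX.proj.toHom ≫ I.coimToIm.toHom, epi_comp _ _, ?_⟩
  have h2 : W.inc.comp J.facX.inc = I.facY.inc :=
    StrictHom.ext (Category.comp_id _) (ImageFac.connecting_σ h hδ')
  rw [← StrictHom.comp_toHom, h2, Category.assoc]
  exact I.factorization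

variable [Abelian (Tilt τ)]

/-- The exactness of two composable butterflies. -/
lemma ImageFac.exact_iff (w : P.toHom ≫ Q.toHom = 0) :
    (ShortComplex.mk P.toHom Q.toHom w).Exact ↔ IsIso δ' := by
  obtain ⟨W, hW, e, he, hP⟩ := ImageFac.exists_fac h hδ'
  rw [hW, ← Tilt.isZero_iff, exact_mk_iff]
  have hQ : J.facX.proj.toHom ≫ J.coimToIm.toHom ≫ J.facY.inc.toHom = Q.toHom := J.factorization
  have hinc : J.facX.inc.toHom ≫ J.facX.proj.toHom = 0 := by
    rw [J.facX.inc_proj, StrictHom.zero_toHom]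
  have hW0 : W.inc.toHom ≫ W.proj.toHom = 0 := by
    rw [W.inc_proj, StrictHom.zero_toHom]
  constructor
  · intro H
    -- Exactness is tested on the inclusion of the kernel. It then factors through the image after
    -- an epimorphism, so the homology vanishes.
    obtain ⟨U, π, hπ, x, hx⟩ := H J.facX.inc.toHom (by
      rw [← hQ, reassoc_of% hinc, zero_comp])
    have h1 : π = (x ≫ e) ≫ W.inc.toHom := by
      rw [← cancel_mono J.facX.inc.toHom, hx, ← hP]
      simp
    have h2 : W.proj.toHom = 0 := by
      rw [← cancel_epi π, h1, Category.assoc, hW0, comp_zero, comp_zero]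
    rw [IsZero.iff_id_eq_zero, ← cancel_epi W.proj.toHom, h2, zero_comp, zero_comp]
  · intro H U x hx
    have h0 : W.proj.toHom = 0 := H.eq_of_tgt _ _
    obtain ⟨l, hl⟩ := J.facX.exists_lift x (by
      rw [StrictHom.zero_toHom, ← cancel_mono (J.coimToIm.toHom ≫ J.facY.inc.toHom),
        Category.assoc, hQ, hx, zero_comp])
    obtain ⟨l', hl'⟩ := W.exists_lift l (by rw [h0, comp_zero, StrictHom.zero_toHom])
    obtain ⟨U', π, hπ, y, hy⟩ := surjective_up_to_refinements_of_epi e l'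
    refine ⟨U', π, hπ, y, ?_⟩
    rw [← hl, ← hl', ← hP, Category.assoc, reassoc_of% hy]

end

end Butterfly

namespace Dec

variable {D : Dec A} (hD : compat τ D)

section

variable [Abelian (Tilt τ)]

lemma cx_exactAt_iff (i j k : ℤ) (hij : i + 1 = j) (hjk : j + 1 = k) :
    (D.cx hD).ExactAt j ↔ (ShortComplex.mk (D.bfly hD i j hij).toHom (D.bfly hD j k hjk).toHom
      (by rw [(bfly_isLink hD i j k hij hjk).comp_eq_zero, StrictHom.zero_toHom])).Exact := by
  rw [HomologicalComplex.exactAt_iff' _ i j k (by simp; lia) (by simp; lia)]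
  apply ShortComplex.exact_iff_of_iso
  refine ShortComplex.isoMk (Iso.refl _) (Iso.refl _) (Iso.refl _) ?_ ?_
  · exact (Category.id_comp _).trans ((cx_d_eq hD i j hij).symm.trans (Category.comp_id _).symm)
  · exact (Category.id_comp _).trans ((cx_d_eq hD j k hjk).symm.trans (Category.comp_id _).symm)

/-- Exactness makes all connecting maps `C ⟶ R'` invertible. The differentials of `E` are then the
composites `E ⟶ C ≅ R' ⟶ E'`, and splicing the short exact sequences `R ⟶ E ⟶ C` gives an exact
complex. -/
lemma acyclic_of_cx (h : (D.cx hD).Acyclic) : D.E.Acyclic := by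
  let I (n : ℤ) := (D.bfly hD n (n + 1) rfl).exists_imageFac.some
  choose δ hδ using fun n : ℤ => (I n).exists_connecting (I (n + 1))
    (bfly_isLink hD n (n + 1) (n + 1 + 1) rfl rfl)
  have hiso (n : ℤ) : IsIso (δ n) :=
    (Butterfly.ImageFac.exact_iff (bfly_isLink hD n (n + 1) (n + 1 + 1) rfl rfl) (hδ n) _).1
      ((cx_exactAt_iff hD n (n + 1) (n + 1 + 1) rfl rfl).1 (h (n + 1)))
  intro n
  obtain ⟨m, rfl⟩ : ∃ m, n = m + 1 + 1 := ⟨n - 2, by ring⟩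
  rw [HomologicalComplex.exactAt_iff' _ (m + 1) (m + 1 + 1) (m + 1 + 1 + 1) (by simp) (by simp)]
  change (ShortComplex.mk _ _ _).Exact
  rw [exact_mk_iff]
  intro U x hx
  have : Mono (I (m + 1)).i := (I (m + 1)).exact.mono_f
  have : Mono (I (m + 1 + 1)).i := (I (m + 1 + 1)).exact.mono_f
  have : Epi (I m).p := (I m).exact.epi_g
  have h1 : x ≫ (I (m + 1)).p = 0 := by
    rw [← cancel_mono (δ (m + 1)), ← cancel_mono (I (m + 1 + 1)).i, Category.assoc, Category.assoc,
      hδ, hx, zero_comp, zero_comp]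
  obtain ⟨s, hs⟩ : ∃ s, s ≫ (I (m + 1)).i = x := by
    have : Mono (ShortComplex.mk _ _ (I (m + 1)).i_p).f := ‹Mono (I (m + 1)).i›
    exact ⟨(I (m + 1)).exact.exact.lift x h1, (I (m + 1)).exact.exact.lift_f x h1⟩
  obtain ⟨U', π, hπ, y, hy⟩ := surjective_up_to_refinements_of_epi (I m).p (s ≫ inv (δ m))
  refine ⟨U', π, hπ, y, ?_⟩
  have h2 : π ≫ s = y ≫ (I m).p ≫ δ m := by
    rw [← reassoc_of% hy]
    simp
  rw [← hs, reassoc_of% h2, hδ m]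

end

lemma epi_lift_of_acyclic (h : D.E.Acyclic) (i : ℤ) :
    Epi (kernel.lift (D.E.d (i + 1) (i + 1 + 1)) (D.E.d i (i + 1)) (by simp)) := by
  have := h (i + 1)
  rw [HomologicalComplex.exactAt_iff' _ i (i + 1) (i + 1 + 1) (by simp) (by simp)] at this
  exact this.epi_kernelLift

/-- The image factorization attached to an acyclic decorated complex. -/
noncomputable def imageFacOfAcyclic (h : D.E.Acyclic) (i : ℤ) :
    (D.bfly hD i (i + 1) rfl).ImageFac where
  R := kernel (D.E.d (i + 1) (i + 1 + 1))
  C := kernel (D.E.d (i + 1 + 1) (i + 1 + 1 + 1))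
  k := kernel.lift _ ((D.M i).arrow ≫ D.E.d i (i + 1)) (by simp)
  i := kernel.ι _
  p := kernel.lift _ (D.E.d (i + 1) (i + 1 + 1)) (by simp)
  c := kernel.ι _ ≫ cokernel.π _
  k_i := by simp
  p_c := by simp
  i_p := by
    rw [← cancel_mono (kernel.ι _)]
    simp
  exact :=
    { exact := by
        rw [exact_mk_iff]
        intro U x hx
        have hx' : x ≫ D.E.d (i + 1) (i + 1 + 1) = 0 := by
          simpa using congr($hx ≫ kernel.ι _)
        exact ⟨U, 𝟙 _, inferInstance, kernel.lift _ x hx',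
          (Category.id_comp _).trans (kernel.lift_ι _ _ hx').symm⟩
      mono_f := by dsimp; infer_instance
      epi_g := epi_lift_of_acyclic h (i + 1) }
  coker_mem G hG s hs := by
    have := epi_lift_of_acyclic h i
    rw [← cancel_epi (kernel.lift (D.E.d (i + 1) (i + 1 + 1)) (D.E.d i (i + 1)) (D.E.d_comp_d _ _ _)),
      comp_zero]
    -- Composed with the surjection from `Eⁱ` onto the cycles, `s` vanishes on `Mⁱ` by assumption
    -- and on the boundaries of `Mⁱ⁻¹` because `dd = 0`.
    refine hD.eq_zero_right (i := i - 1) (by simp) hG _ ?_ ?_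
    · rw [← hs, ← Category.assoc]
      congr 1
      rw [← cancel_mono (kernel.ι _)]
      simp
    · have : D.E.d (i - 1) i ≫
          kernel.lift (D.E.d (i + 1) (i + 1 + 1)) (D.E.d i (i + 1)) (by simp) = 0 := by
        rw [← cancel_mono (kernel.ι _)]
        simp
      rw [reassoc_of% this, zero_comp, comp_zero]
  ker_mem U hU t ht := by
    -- A cycle that is zero in `E / M` lies in `M`, and its differential, being zero, lies in the
    -- next decoration.
    have h1 := hD.eq_zero_left (i := i + 1 + 1) rfl hU (t ≫ kernel.ι _)
      ((factors_iff_π _ _).2 (by simpa using ht))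
      (by simpa using Subobject.factors_zero)
    rwa [← cancel_mono (kernel.ι _), zero_comp]

/-- For an acyclic complex the cycles serve both as `C` for one butterfly and as `R` for the next,
so the connecting map is an identity. -/
lemma cx_acyclic [Abelian (Tilt τ)] (h : D.E.Acyclic) : (D.cx hD).Acyclic := by
  intro n
  obtain ⟨m, rfl⟩ : ∃ m, n = m + 1 := ⟨n - 1, by ring⟩
  rw [cx_exactAt_iff hD m (m + 1) (m + 1 + 1) rfl rfl,
    Butterfly.ImageFac.exact_iff (I := imageFacOfAcyclic hD h m)
      (J := imageFacOfAcyclic hD h (m + 1)) (bfly_isLink hD m (m + 1) (m + 1 + 1) rfl rfl)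
      (δ' := 𝟙 _) ((congr(_ ≫ $(Category.id_comp _))).trans (kernel.lift_ι _ _ _))]
  exact IsIso.id _

end Dec

end HRS

/-! ### Localization by right fractions, restriction to truncations, and quasi-isomorphisms. -/

namespace HRS

section Localization

variable {C D : Type*} [Category C] [Category D]

/-- A functor whose morphisms are right fractions is a localization as soon as it identifies only
morphisms which every localization identifies. -/
lemma isLocalization_of_fractions (L : C ⥤ D) (W : MorphismProperty C) [L.EssSurj]
    (hW : ∀ {X Y : C} (f : X ⟶ Y), W f ↔ IsIso (L.map f))
    (hfac : ∀ {X Y : C} (φ : L.obj X ⟶ L.obj Y), ∃ (Z : C) (s : Z ⟶ X) (f : Z ⟶ Y),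
      W s ∧ L.map s ≫ φ = L.map f)
    (hext : ∀ {X Y : C} (f g : X ⟶ Y), L.map f = L.map g → W.Q.map f = W.Q.map g) :
    L.IsLocalization W := by
  obtain ⟨Λ, rfl⟩ : ∃ Λ : W.Localization ⥤ D, W.Q ⋙ Λ = L :=
    ⟨_, Localization.Construction.fac L fun _ _ f hf => (hW f).1 hf⟩
  simp only [Functor.comp_map] at hW hfac hext
  have isoQ {X Y : C} (f : X ⟶ Y) (hf : W f) : IsIso (W.Q.map f) := Localization.inverts W.Q W f hf
  -- the right fractions in the localization
  let R : MorphismProperty W.Localization := fun X Y m =>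
    ∃ (Z : C) (s : Z ⟶ X.as.obj) (f : Z ⟶ Y.as.obj), W s ∧ W.Q.map s ≫ m = W.Q.map f
  have hR {X Y : C} (m : W.Q.obj X ⟶ W.Q.obj Y) : R m ↔
      ∃ (Z : C) (s : Z ⟶ X) (f : Z ⟶ Y), W s ∧ W.Q.map s ≫ m = W.Q.map f := Iff.rfl
  have objQ (X : W.Localization) : ∃ X' : C, W.Q.obj X' = X := ⟨X.as.obj, rfl⟩
  have hRtop : R = ⊤ := by
    have : R.IsStableUnderComposition := ⟨by
      intro X Y Z m m' h h'
      obtain ⟨X, rfl⟩ := objQ X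
      obtain ⟨Y, rfl⟩ := objQ Y
      obtain ⟨Z, rfl⟩ := objQ Z
      obtain ⟨U, s, f, hs, e⟩ := (hR m).1 h
      obtain ⟨U', s', f', hs', e'⟩ := (hR m').1 h'
      have := isoQ s hs
      have := isoQ s' hs'
      -- The Ore square is produced in `D`, where fractions exist. The assumption `hext` brings its
      -- commutativity back to the localization.
      obtain ⟨V, t, g, ht, e''⟩ := hfac (Λ.map (W.Q.map f ≫ inv (W.Q.map s')))
      have := isoQ t ht
      have e3 : W.Q.map (t ≫ f) = W.Q.map (g ≫ s') := by
        refine hext _ _ ?_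
        rw [W.Q.map_comp, W.Q.map_comp, Λ.map_comp, Λ.map_comp, ← e'', ← Λ.map_comp,
          ← Λ.map_comp, ← Λ.map_comp]
        simp
      refine (hR _).2 ⟨V, t ≫ s, g ≫ f', (hW _).2 ?_, ?_⟩
      · rw [W.Q.map_comp]
        infer_instance
      · rw [W.Q.map_comp, W.Q.map_comp, ← e', ← Category.assoc, Category.assoc (W.Q.map t), e,
          ← W.Q.map_comp, e3, W.Q.map_comp, Category.assoc]⟩
    -- The localization is generated by the maps of `C` and the formal inverses of `W`. Both are
    -- right fractions, and fractions compose.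
    refine Localization.Construction.morphismProperty_eq_top R
      (fun X Y f => (hR _).2 ⟨X, 𝟙 X, f, (hW _).2 ?_, ?_⟩)
      (fun X Y w hw => (hR _).2 ⟨X, w, 𝟙 X, hw, ?_⟩)
    · infer_instance
    · rw [CategoryTheory.Functor.map_id, Category.id_comp]
    · rw [CategoryTheory.Functor.map_id]
      exact (Localization.Construction.wIso w hw).hom_inv_id
  have key {X Y : C} (m : W.Q.obj X ⟶ W.Q.obj Y) :
      ∃ (Z : C) (s : Z ⟶ X) (f : Z ⟶ Y), W s ∧ W.Q.map s ≫ m = W.Q.map f :=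
    (hR m).1 (by rw [hRtop]; trivial)
  have : Λ.Full := ⟨by
    intro X Y φ
    obtain ⟨X, rfl⟩ := objQ X
    obtain ⟨Y, rfl⟩ := objQ Y
    obtain ⟨Z, s, f, hs, e⟩ := hfac (X := X) (Y := Y) φ
    have := isoQ s hs
    refine ⟨inv (W.Q.map s) ≫ W.Q.map f, ?_⟩
    rw [← cancel_epi (Λ.map (W.Q.map s)), ← Λ.map_comp, IsIso.hom_inv_id_assoc]
    exact e.symm⟩
  have : Λ.Faithful := ⟨by
    intro X Y m m' hm
    obtain ⟨X, rfl⟩ := objQ X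
    obtain ⟨Y, rfl⟩ := objQ Y
    obtain ⟨Z, s, f, hs, e⟩ := key m
    obtain ⟨Z', s', f', hs', e'⟩ := key m'
    have := isoQ s hs
    have := isoQ s' hs'
    -- A common denominator for the two fractions; equality after `Λ` then becomes equality of
    -- images of maps of `C`, where `hext` applies.
    obtain ⟨V, t, g, ht, e''⟩ := hfac (Λ.map (W.Q.map s ≫ inv (W.Q.map s')))
    have := isoQ t ht
    have h1 : Λ.map (W.Q.map (t ≫ s)) = Λ.map (W.Q.map (g ≫ s')) := by
      rw [W.Q.map_comp, W.Q.map_comp, Λ.map_comp, Λ.map_comp, ← e'', ← Λ.map_comp,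
        ← Λ.map_comp, ← Λ.map_comp]
      simp
    have : IsIso (W.Q.map (t ≫ s)) := by rw [W.Q.map_comp]; infer_instance
    have h3 : Λ.map (W.Q.map (t ≫ f)) = Λ.map (W.Q.map (g ≫ f')) := by
      rw [W.Q.map_comp, W.Q.map_comp, ← e, ← e', ← Category.assoc, ← Category.assoc,
        ← W.Q.map_comp, ← W.Q.map_comp, Λ.map_comp, Λ.map_comp, h1, hm]
    have h4 := hext _ _ h3
    have h5 := hext _ _ h1
    rw [← cancel_epi (W.Q.map (t ≫ s)), W.Q.map_comp, Category.assoc, e, ← W.Q.map_comp, h4,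
      W.Q.map_comp, ← e', ← Category.assoc, ← W.Q.map_comp, ← h5, W.Q.map_comp]⟩
  have : Λ.EssSurj := ⟨fun Y => ⟨W.Q.obj ((W.Q ⋙ Λ).objPreimage Y),
    ⟨(W.Q ⋙ Λ).objObjPreimageIso Y⟩⟩⟩
  have : Λ.IsEquivalence := {}
  infer_instance

/-- A functor with terminal roofs is a localization at the morphisms which it inverts. -/
lemma isLocalization_of_terminal_roofs (L : C ⥤ D) (W : MorphismProperty C) [L.EssSurj]
    (hW : ∀ {X Y : C} (f : X ⟶ Y), W f ↔ IsIso (L.map f))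
    (hfac : ∀ {X Y : C} (φ : L.obj X ⟶ L.obj Y), ∃ (Z : C) (s : Z ⟶ X) (f : Z ⟶ Y),
      W s ∧ L.map s ≫ φ = L.map f ∧ ∀ (U : C) (a : U ⟶ X) (b : U ⟶ Y),
        L.map a ≫ φ = L.map b → ∃ r : U ⟶ Z, r ≫ s = a ∧ r ≫ f = b) :
    L.IsLocalization W := by
  refine isLocalization_of_fractions L W hW (fun φ => ?_) (fun {X Y} f g hfg => ?_)
  · obtain ⟨Z, s, f, hs, e, -⟩ := hfac φ
    exact ⟨Z, s, f, hs, e⟩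
  · obtain ⟨Z, s, q, hs, e, h⟩ := hfac (L.map f)
    -- Both `(𝟙, f)` and `(𝟙, g)` factor through the terminal roof, by two sections of `s`. These
    -- agree once `s` is inverted, and so do `f` and `g`.
    obtain ⟨r, hr, rfl⟩ := h X (𝟙 X) f (by simp)
    obtain ⟨r', hr', rfl⟩ := h X (𝟙 X) g (by simp [hfg])
    have : IsIso (W.Q.map s) := Localization.inverts W.Q W s hs
    have : W.Q.map r = W.Q.map r' := by
      rw [← cancel_mono (W.Q.map s), ← W.Q.map_comp, ← W.Q.map_comp, hr, hr']
    rw [W.Q.map_comp, W.Q.map_comp, this]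

section Truncation

variable (L : C ⥤ D) (W : MorphismProperty C)
    (hW : ∀ {X Y : C} (f : X ⟶ Y), W f ↔ IsIso (L.map f))
    (hfac : ∀ {X Y : C} (φ : L.obj X ⟶ L.obj Y), ∃ (Z : C) (s : Z ⟶ X) (f : Z ⟶ Y),
      W s ∧ L.map s ≫ φ = L.map f)
    (H : ObjectProperty C) (K : ObjectProperty D) (hHK : ∀ X, H X → K (L.obj X))
    (hK : ∀ Y, K Y → ∃ X, H X ∧ Nonempty (L.obj X ≅ Y))
    (htrunc : ∀ X Y, H X → H Y → ∃ (S : C ⥤ C) (T : C ⥤ C) (α : S ⟶ 𝟭 C) (β : S ⟶ T),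
      (∀ Z, H (T.obj Z)) ∧ (∀ {Z Z' : C} (f : Z ⟶ Z'), W f → W (S.map f)) ∧
      (∀ {Z Z' : C} (f : Z ⟶ Z'), W f → W (T.map f)) ∧
      IsIso (α.app X) ∧ IsIso (α.app Y) ∧ IsIso (β.app X) ∧ IsIso (β.app Y))

include hK in
lemma essSurj_lift_of_exists_iso :
    (K.lift (H.ι ⋙ L) (fun X => hHK _ X.property)).EssSurj := ⟨fun Y => by
  obtain ⟨X, hX, ⟨e⟩⟩ := hK Y.obj Y.property
  exact ⟨⟨X, hX⟩, ⟨K.ι.preimageIso e⟩⟩⟩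

include hW hfac htrunc in
-- The apex `Z` of a fraction in `C` need not satisfy `H`. It is replaced by `T Z`, which does, and
-- which maps to `X` and `Y` since `T`, `S` and the identity agree on these two objects.
lemma exists_fraction_of_truncations {X Y : H.FullSubcategory}
    (φ : (K.lift (H.ι ⋙ L) (fun X => hHK _ X.property)).obj X ⟶
      (K.lift (H.ι ⋙ L) (fun X => hHK _ X.property)).obj Y) :
    ∃ (Z : H.FullSubcategory) (s : Z ⟶ X) (f : Z ⟶ Y), W.inverseImage H.ι s ∧
      (K.lift (H.ι ⋙ L) (fun X => hHK _ X.property)).map s ≫ φ =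
        (K.lift (H.ι ⋙ L) (fun X => hHK _ X.property)).map f := by
  obtain ⟨S, T, α, β, hT, hWS, hWT, _, _, _, _⟩ := htrunc X.obj Y.obj X.property Y.property
  obtain ⟨Z, s, f, hs, e⟩ := hfac (X := X.obj) (Y := Y.obj) φ.hom
  have := (hW _).1 (hWS s hs)
  have := (hW _).1 (hWT s hs)
  -- Naturality of `β` along the denominator `s`: `S s` and `T s` are inverted by `L`, and `β` is
  -- invertible at `X`.
  have : IsIso (L.map (β.app Z)) := by
    have e1 : L.map (β.app Z) ≫ L.map (T.map s) = L.map (S.map s) ≫ L.map (β.app X.obj) := by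
      rw [← L.map_comp, ← β.naturality, L.map_comp]
    have : IsIso (L.map (β.app Z) ≫ L.map (T.map s)) := by rw [e1]; infer_instance
    exact IsIso.of_isIso_comp_right _ (L.map (T.map s))
  have aux {U : C} (a : Z ⟶ U) [IsIso (β.app U)] :
      L.map (β.app Z) ≫ L.map (T.map a ≫ inv (β.app U) ≫ α.app U) =
        L.map (α.app Z) ≫ L.map a := by
    rw [← L.map_comp, ← L.map_comp]
    congr 1
    rw [← β.naturality_assoc, IsIso.hom_inv_id_assoc]
    exact α.naturality a
  refine ⟨⟨T.obj Z, hT Z⟩, ObjectProperty.homMk (T.map s ≫ inv (β.app X.obj) ≫ α.app X.obj),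
    ObjectProperty.homMk (T.map f ≫ inv (β.app Y.obj) ≫ α.app Y.obj), ?_, ?_⟩
  · refine (hW _).2 ?_
    change IsIso (L.map (T.map s ≫ inv (β.app X.obj) ≫ α.app X.obj))
    rw [L.map_comp]
    infer_instance
  · ext
    change L.map (T.map s ≫ inv (β.app X.obj) ≫ α.app X.obj) ≫ φ.hom =
      L.map (T.map f ≫ inv (β.app Y.obj) ≫ α.app Y.obj)
    rw [← cancel_epi (L.map (β.app Z)), ← Category.assoc, aux, aux, ← e, Category.assoc]

include hW hfac hK htrunc in
/-- The restriction of a localization functor to a full subcategory is a localization, if for any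
two objects of the subcategory there is a truncation functor to the subcategory. -/
lemma isLocalization_lift_of_truncations [L.IsLocalization W] :
    (K.lift (H.ι ⋙ L) (fun X => hHK _ X.property)).IsLocalization (W.inverseImage H.ι) := by
  let L' := K.lift (H.ι ⋙ L) (fun X => hHK _ X.property)
  have : L'.EssSurj := essSurj_lift_of_exists_iso L H K hHK hK
  refine isLocalization_of_fractions L' (W.inverseImage H.ι) (fun {X Y} f => ?_)
    (fun {X Y} φ => exists_fraction_of_truncations L W hW hfac H K hHK htrunc φ)
    (fun {X Y} f g hfg => ?_)
  · exact (hW f.hom).trans (isIso_iff_of_reflects_iso (L'.map f) K.ι)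
  · obtain ⟨S, T, α, β, hT, hWS, hWT, _, _, _, _⟩ := htrunc X.obj Y.obj X.property Y.property
    let W' := W.inverseImage H.ι
    -- Followed by localization, the truncation inverts `W` and so factors through `L`. Hence it
    -- identifies maps with the same image under `L`, and on `X` and `Y` it is isomorphic to the
    -- identity.
    let T' : C ⥤ H.FullSubcategory := H.lift T hT
    have inv' : W.IsInvertedBy (T' ⋙ W'.Q) := fun _ _ a ha =>
      Localization.inverts W'.Q W' _ (hWT a ha)
    have h0 : (T' ⋙ W'.Q).map f.hom = (T' ⋙ W'.Q).map g.hom := by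
      have := congr((Localization.lift (T' ⋙ W'.Q) inv' L).map $(congr(($hfg).hom)))
      exact (NatIso.naturality_1 (Localization.fac (T' ⋙ W'.Q) inv' L) f.hom).symm.trans
        ((congr(_ ≫ $this ≫ _)).trans
          (NatIso.naturality_1 (Localization.fac (T' ⋙ W'.Q) inv' L) g.hom))
    let e (U : H.FullSubcategory) [IsIso (α.app U.obj)] [IsIso (β.app U.obj)] :
        T'.obj U.obj ≅ U := H.ι.preimageIso ((asIso (β.app U.obj)).symm ≪≫ asIso (α.app U.obj))
    have he (m : X ⟶ Y) : T'.map m.hom ≫ (e Y).hom = (e X).hom ≫ m := by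
      refine H.ι.map_injective ?_
      rw [H.ι.map_comp, H.ι.map_comp, Functor.preimageIso_hom, Functor.preimageIso_hom,
        H.ι.map_preimage, H.ι.map_preimage]
      change T.map m.hom ≫ CategoryTheory.inv (β.app Y.obj) ≫ α.app Y.obj =
        (CategoryTheory.inv (β.app X.obj) ≫ α.app X.obj) ≫ m.hom
      rw [← cancel_epi (β.app X.obj), ← β.naturality_assoc, IsIso.hom_inv_id_assoc,
        Category.assoc, IsIso.hom_inv_id_assoc]
      exact α.naturality m.hom
    rw [← cancel_epi (W'.Q.map (e X).hom), ← W'.Q.map_comp, ← W'.Q.map_comp, ← he, ← he,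
      W'.Q.map_comp, W'.Q.map_comp]
    exact congr($h0 ≫ _)

end Truncation

end Localization

section QuasiIso

variable {C : Type*} [Category C] [Abelian C]

lemma quasiIso_iff_acyclic_mappingCone {K L : CochainComplex C ℤ} (φ : K ⟶ L) :
    QuasiIso φ ↔ (CochainComplex.mappingCone φ).Acyclic := by
  have h := (HomotopyCategory.subcategoryAcyclic C).trW_iff_of_distinguished _
    (HomotopyCategory.mappingCone_triangleh_distinguished φ)
  rw [← HomotopyCategory.quasiIso_eq_trW_subcategoryAcyclic] at h
  exact (HomotopyCategory.quotient_map_mem_quasiIso_iff φ).symm.trans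
    (h.trans (HomotopyCategory.quotient_obj_mem_subcategoryAcyclic_iff_acyclic _))

end QuasiIso

namespace Dec

variable {A : Type u} [Category.{v} A] [Abelian A] {τ : TorsionPair A} [Abelian (Tilt τ)]

/-- Being a quasi-isomorphism is acyclicity of the cone, the cones correspond by `coneIso`, and
acyclicity is the same on both sides. -/
lemma quasiIso_cxMap_iff {D D' : Dec A} (f : D ⟶ D') (hD : compat τ D) (hD' : compat τ D') :
    QuasiIso (cxMap f hD hD') ↔ QuasiIso f.hom := by
  rw [quasiIso_iff_acyclic_mappingCone, quasiIso_iff_acyclic_mappingCone]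
  have h : (CochainComplex.mappingCone (cxMap f hD hD')).Acyclic ↔
      ((cone f).cx (compat_cone f hD hD')).Acyclic :=
    ⟨fun h => fun n => (h n).of_iso (coneIso f hD hD'),
      fun h n => (h n).of_iso (coneIso f hD hD').symm⟩
  exact h.trans ⟨acyclic_of_cx (D := cone f) _, cx_acyclic (D := cone f) _⟩

lemma qis_iff (P : ObjectProperty (Dec A)) (hP : P ≤ compat τ) {X Y : P.FullSubcategory}
    (f : X ⟶ Y) : qis P f ↔ QuasiIso ((toCx P hP).map f) :=
  (quasiIso_cxMap_iff f.hom (hP _ X.2) (hP _ Y.2)).symm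

end Dec

end HRS

/-! ### Terminal roofs and essential surjectivity. -/

namespace HRS

variable {A : Type u} [Category.{v} A] [Abelian A] {τ : TorsionPair A}

/-- The roof of a butterfly `P` is terminal among the pairs of chain maps related by `P`. -/
lemma Butterfly.exists_lift_roof {U X Y : Tilt τ} (P : Butterfly X Y) (a : StrictHom U X)
    (b : StrictHom U Y) (h : a.toHom ≫ P.toHom = b.toHom) :
    ∃ c : StrictHom U P.roof, c.comp P.roofFst = a ∧ c.comp P.roofSnd = b := by
  -- The relation is a commutative square with the identity on `Y`, so it gives a map from the split
  -- middle object of `b` to `E`. Its restriction to the summand `U⁰` is the degree `0` component of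
  -- the lift.
  obtain ⟨φ, hφ⟩ := Butterfly.exists_isSq (P := b.butterfly) (P' := P) (f := a)
    (g := StrictHom.id Y) (by
      rw [StrictHom.id_toHom, Category.comp_id]
      exact h.symm)
  obtain ⟨r, s, hs⟩ := exists_splits b
  generalize b.butterfly = R at r s hs φ hφ
  have h1 := hφ.κ
  have h2 := hφ.ι
  have h3 := hφ.σ
  have h4 := hφ.ρ
  have h5 := hs.κ_eq
  rw [StrictHom.id_fm, Category.id_comp] at h2
  rw [StrictHom.id_f0, Category.comp_id] at h4
  refine ⟨⟨biprod.lift a.fm b.fm, s ≫ φ, ?_⟩, ?_, ?_⟩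
  · have : U.d ≫ s = R.κ + b.fm ≫ R.ι := by rw [h5]; abel
    simp only [biprod.lift_desc, ← Category.assoc, this, Preadditive.add_comp, h1]
    simp [h2]
  · apply StrictHom.ext
    · simp
    · simp [h3, reassoc_of% hs.s_σ]
  · apply StrictHom.ext
    · simp
    · simp [h4, hs.s_ρ]

namespace Dec

variable {D : Dec A}

lemma isZero_tilt_Xm (hD : compat τ D) (n : ℤ) (h : IsZero (D.E.X n)) :
    IsZero (D.tilt hD n).Xm := by
  rw [IsZero.iff_id_eq_zero, ← cancel_mono (D.M n).arrow]
  exact h.eq_of_tgt _ _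

lemma isZero_tilt_X0 (hD : compat τ D) (n : ℤ) (h : IsZero (D.E.X (n + 1))) :
    IsZero (D.tilt hD n).X0 := by
  rw [IsZero.iff_id_eq_zero, ← cancel_epi (cokernel.π (D.M (n + 1)).arrow)]
  exact h.eq_of_src _ _

end Dec

variable [Abelian (Tilt τ)]

namespace TotObj

variable {X : CochainComplex (Tilt τ) ℤ} {D D' : Dec A} (t : TotObj X D)

lemma u_toHom_v_toHom (n : ℤ) : (t.u n).toHom ≫ (t.v n).toHom = 𝟙 _ := by
  rw [← StrictHom.comp_toHom, t.u_v, StrictHom.id_toHom]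

lemma v_toHom_u_toHom (n : ℤ) : (t.v n).toHom ≫ (t.u n).toHom = 𝟙 _ := by
  rw [← StrictHom.comp_toHom, t.v_u, StrictHom.id_toHom]

lemma exists_desc_strict (hD' : Dec.compat τ D') (f : ∀ n, StrictHom (X.X n) (D'.tilt hD' n))
    (comm : ∀ n, X.d n (n + 1) ≫ (f (n + 1)).toHom = (f n).toHom ≫ (D'.cx hD').d n (n + 1)) :
    ∃ g : D ⟶ D', ∀ n, Dec.strict g t.compat hD' n = (t.v n).comp (f n) := by
  apply Dec.exists_strict_eq
  intro i j h
  subst h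
  have h1 := (t.isSq i).comm
  have h3 := comm i
  rw [← t.toHom_b, Dec.cx_d_eq _ _ _ rfl] at h3
  rw [← cancel_epi (t.u i).toHom]
  simp only [StrictHom.comp_toHom, Category.assoc, reassoc_of% (t.u_toHom_v_toHom i)]
  rw [← h3, ← reassoc_of% h1, reassoc_of% (t.u_toHom_v_toHom (i + 1))]

lemma exists_lift_strict (hD' : Dec.compat τ D') (f : ∀ n, StrictHom (D'.tilt hD' n) (X.X n))
    (comm : ∀ n, (D'.cx hD').d n (n + 1) ≫ (f (n + 1)).toHom = (f n).toHom ≫ X.d n (n + 1)) :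
    ∃ g : D' ⟶ D, ∀ n, Dec.strict g hD' t.compat n = (f n).comp (t.u n) := by
  apply Dec.exists_strict_eq
  intro i j h
  subst h
  have h1 := (t.isSq i).comm
  have h3 := comm i
  rw [← t.toHom_b, Dec.cx_d_eq _ _ _ rfl] at h3
  simp only [StrictHom.comp_toHom, Category.assoc, ← h1, reassoc_of% h3]

include t in
lemma isZero_X (n : ℤ) (h : IsZero (X.X n).X0) (h' : IsZero (X.X (n + 1)).Xm) :
    IsZero (D.E.X (n + 1)) :=
  ((t.b n).isZero_E h h').of_iso (t.e n).symm

end TotObj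

namespace Dec

variable {D D' : Dec A}

/-- A map between the complexes attached to two decorated complexes is a right fraction of maps
of decorated complexes, in a terminal way. -/
lemma exists_terminal_roof (hD : compat τ D) (hD' : compat τ D') (φ : D.cx hD ⟶ D'.cx hD') :
    ∃ (D'' : Dec A) (hD'' : compat τ D'') (p : D'' ⟶ D) (q : D'' ⟶ D'),
      IsIso (cxMap p hD'' hD) ∧ cxMap p hD'' hD ≫ φ = cxMap q hD'' hD' ∧
      (∀ (U : Dec A) (hU : compat τ U) (a : U ⟶ D) (b : U ⟶ D'),
        cxMap a hU hD ≫ φ = cxMap b hU hD' → ∃ r : U ⟶ D'', r ≫ p = a ∧ r ≫ q = b) ∧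
      ∀ n, IsZero (D.E.X n) → IsZero (D'.E.X n) → IsZero (D'.E.X (n - 1)) →
        IsZero (D''.E.X n) := by
  choose P hP using fun n => Butterfly.exists_toHom (φ.f n)
  have hroof (n : ℤ) : (P n).roofFst.toHom ≫ φ.f n = (P n).roofSnd.toHom := by
    rw [← hP, Butterfly.roofFst_comp]
  -- The roofs of the components of `φ`, with the differential transported from `D` along the
  -- invertible projections. Its totalization is the apex.
  let K : CochainComplex (Tilt τ) ℤ :=
    { X := fun n => (P n).roof
      d := fun i j => (P i).roofFst.toHom ≫ (D.cx hD).d i j ≫ inv (P j).roofFst.toHom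
      shape := fun i j h => by rw [(D.cx hD).shape i j h]; simp
      d_comp_d' := fun i j k _ _ => by
        rw [Category.assoc, Category.assoc, IsIso.inv_hom_id_assoc,
          (D.cx hD).d_comp_d_assoc, zero_comp, comp_zero] }
  have hKd (i j : ℤ) : K.d i j ≫ (P j).roofFst.toHom =
      (P i).roofFst.toHom ≫ (D.cx hD).d i j := by
    simp only [K, Category.assoc, IsIso.inv_hom_id, Category.comp_id]
  obtain ⟨D'', ⟨t⟩⟩ := exists_totObj K
  obtain ⟨p, hp⟩ := t.exists_desc_strict hD (fun n => (P n).roofFst) (fun n => hKd n (n + 1))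
  obtain ⟨q, hq⟩ := t.exists_desc_strict hD' (fun n => (P n).roofSnd) (fun n => by
    rw [← hroof, ← hroof, ← Category.assoc, hKd, Category.assoc, Category.assoc, φ.comm])
  have hpf (n : ℤ) : (cxMap p t.compat hD).f n = (t.v n).toHom ≫ (P n).roofFst.toHom := by
    rw [cxMap_f, hp, StrictHom.comp_toHom]
  have hv (n : ℤ) : IsIso (t.v n).toHom := ⟨_, t.v_toHom_u_toHom n, t.u_toHom_v_toHom n⟩
  refine ⟨D'', t.compat, p, q, ?_, ?_, ?_, ?_⟩
  · have (n : ℤ) : IsIso ((cxMap p t.compat hD).f n) := by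
      rw [hpf]
      infer_instance
    exact HomologicalComplex.Hom.isIso_of_components _
  · ext n
    rw [HomologicalComplex.comp_f, hpf, cxMap_f, hq, StrictHom.comp_toHom, Category.assoc, hroof]
  · intro U hU a b hab
    have hab' (n : ℤ) : (strict a hU hD n).toHom ≫ (P n).toHom = (strict b hU hD' n).toHom := by
      rw [hP]
      exact congr(HomologicalComplex.Hom.f $hab n)
    -- The lifts are made degree by degree. They commute with the differentials because this can be
    -- tested after the invertible projection to `D`.
    choose c hc₁ hc₂ using fun n => (P n).exists_lift_roof _ _ (hab' n)
    have hc (n : ℤ) : (c n).toHom ≫ (P n).roofFst.toHom = (cxMap a hU hD).f n := by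
      rw [← StrictHom.comp_toHom, hc₁]
      rfl
    obtain ⟨r, hr⟩ := t.exists_lift_strict hU c (fun n => by
      rw [← cancel_mono (P (n + 1)).roofFst.toHom, Category.assoc, Category.assoc, hKd, hc,
        ← Category.assoc, hc, (cxMap a hU hD).comm])
    have aux {V : Dec A} (hV : compat τ V) (m : D'' ⟶ V) (f : ∀ n, StrictHom (P n).roof _)
        (hm : ∀ n, strict m t.compat hV n = (t.v n).comp (f n)) (n : ℤ) :
        strict (r ≫ m) hU hV n = (c n).comp (f n) := by
      have h1 := congr(StrictHom.fm $(t.u_v n))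
      have h2 := congr(StrictHom.f0 $(t.u_v n))
      simp only [StrictHom.comp_fm, StrictHom.comp_f0, StrictHom.id_fm, StrictHom.id_f0] at h1 h2
      rw [strict_comp _ _ _ t.compat, hr, hm]
      apply StrictHom.ext
      · simp [reassoc_of% h1]
      · simp [reassoc_of% h2]
    refine ⟨r, hom_ext_of_strict hU hD fun n => ?_, hom_ext_of_strict hU hD' fun n => ?_⟩
    · rw [aux hD p _ hp, hc₁]
    · rw [aux hD' q _ hq, hc₂]
  · intro n h h' h''
    obtain ⟨m, rfl⟩ : ∃ m, n = m + 1 := ⟨n - 1, by ring⟩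
    rw [add_sub_cancel_right] at h''
    -- The apex in degree `m + 1` is an extension of the degree `0` part of the roof at `m` by the
    -- degree `-1` part of the roof at `m + 1`. The former involves the decoration of `D'` in degree
    -- `m`, hence the condition in degree `n - 1`.
    refine t.isZero_X m ((P m).isZero_E (isZero_tilt_X0 hD m h) (isZero_tilt_Xm hD' m h'')) ?_
    exact (biprod_isZero_iff _ _).2
      ⟨isZero_tilt_Xm hD (m + 1) h, isZero_tilt_Xm hD' (m + 1) h'⟩

/-- A complex with zero objects in some degrees comes from a decorated complex with zero objects
in the corresponding degrees. -/
lemma exists_cx_iso (K : CochainComplex (Tilt τ) ℤ) : ∃ (D : Dec A) (hD : compat τ D),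
    Nonempty (D.cx hD ≅ K) ∧
      ∀ n, IsZero (K.X n) → IsZero (K.X (n - 1)) → IsZero (D.E.X n) := by
  classical
  -- A zero object of the tilted category may have nonzero isomorphic components, which would
  -- survive in the totalization; it is replaced by the object with zero components.
  let X (n : ℤ) : Tilt τ := if IsZero (K.X n) then Tilt.zero τ else K.X n
  have e (n : ℤ) : Nonempty (X n ≅ K.X n) := by
    by_cases h : IsZero (K.X n)
    · simp only [X, if_pos h]
      exact ⟨((Tilt.zero_isStrictlyZero τ).isZero).iso h⟩
    · simp only [X, if_neg h]
      exact ⟨Iso.refl _⟩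
  replace e (n : ℤ) := (e n).some
  have hX (n : ℤ) (h : IsZero (K.X n)) : (X n).IsStrictlyZero := by
    simp only [X, if_pos h]
    exact Tilt.zero_isStrictlyZero τ
  let K' : CochainComplex (Tilt τ) ℤ :=
    { X := X
      d := fun i j => (e i).hom ≫ K.d i j ≫ (e j).inv
      shape := fun i j h => by rw [K.shape i j h]; simp
      d_comp_d' := fun i j k _ _ => by simp }
  let i : K' ≅ K := HomologicalComplex.Hom.isoOfComponents e (fun i j _ => by simp [K'])
  obtain ⟨D, ⟨t⟩⟩ := exists_totObj K'
  refine ⟨D, t.compat, ⟨t.iso.symm ≪≫ i⟩, fun n h h' => ?_⟩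
  obtain ⟨m, rfl⟩ : ∃ m, n = m + 1 := ⟨n - 1, by ring⟩
  rw [add_sub_cancel_right] at h'
  exact t.isZero_X m (hX m h').2 (hX (m + 1) h).1

end Dec

end HRS

/-! ### The derived category as a localization of decorated complexes, without and with bounds. -/

namespace HRS

section Localization

variable {C₁ C₂ C₃ : Type*} [Category C₁] [Category C₂] [Category C₃]

/-- Terminal roofs make `L₁` a localization at the maps it inverts. Localizations compose once every
map of `W₂` is isomorphic, as an arrow, to the image of a map upstairs, and the roofs provide this.
-/
lemma isLocalization_comp_of_terminal_roofs (L₁ : C₁ ⥤ C₂) [L₁.EssSurj]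
    (hfac : ∀ {X Y : C₁} (φ : L₁.obj X ⟶ L₁.obj Y), ∃ (Z : C₁) (s : Z ⟶ X) (f : Z ⟶ Y),
      IsIso (L₁.map s) ∧ L₁.map s ≫ φ = L₁.map f ∧ ∀ (U : C₁) (a : U ⟶ X) (b : U ⟶ Y),
        L₁.map a ≫ φ = L₁.map b → ∃ r : U ⟶ Z, r ≫ s = a ∧ r ≫ f = b)
    (L₂ : C₂ ⥤ C₃) (W₂ : MorphismProperty C₂) [L₂.IsLocalization W₂]
    (hW₂ : ∀ {X Y : C₂} (f : X ⟶ Y), W₂ f ↔ IsIso (L₂.map f)) :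
    (L₁ ⋙ L₂).IsLocalization (W₂.inverseImage L₁) := by
  let W₁ : MorphismProperty C₁ := (MorphismProperty.isomorphisms C₂).inverseImage L₁
  have : L₁.IsLocalization W₁ := isLocalization_of_terminal_roofs L₁ W₁ (fun _ => Iff.rfl) hfac
  refine Functor.IsLocalization.comp L₁ L₂ W₁ W₂ _ (fun _ _ f hf => (hW₂ _).1 hf)
    (fun X Y f hf => (hW₂ _).2 ?_) (fun X Y f hf => ?_)
  · have : IsIso (L₁.map f) := hf
    infer_instance
  · let e := L₁.objObjPreimageIso X
    let e' := L₁.objObjPreimageIso Y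
    obtain ⟨Z, s, q, hs, h, -⟩ := hfac (e.hom ≫ f ≫ e'.inv)
    refine ⟨Z, _, q, (hW₂ _).2 ?_, ⟨Arrow.isoMk (asIso (L₁.map s) ≪≫ e) e' ?_⟩⟩
    · have := (hW₂ f).1 hf
      rw [← h, L₂.map_comp, L₂.map_comp, L₂.map_comp]
      infer_instance
    · change (L₁.map s ≫ e.hom) ≫ f = L₁.map q ≫ e'.hom
      rw [← h]
      simp

end Localization

section Truncation

variable (C : Type*) [Category C] [Abelian C]

/-- The complexes which have zero objects far out on the respective side(s). -/
def complexBdd (b : Bdd) : ObjectProperty (CochainComplex C ℤ) :=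
  fun K => b.Holds fun n => IsZero (K.X n)

variable {C}

open CochainComplex in
/-- For any two bounded complexes there is a truncation functor which does not change them. -/
lemma exists_truncation (b : Bdd) (X Y : CochainComplex C ℤ) (hX : complexBdd C b X)
    (hY : complexBdd C b Y) :
    ∃ (S : CochainComplex C ℤ ⥤ CochainComplex C ℤ) (T : CochainComplex C ℤ ⥤ CochainComplex C ℤ)
      (α : S ⟶ 𝟭 _) (β : S ⟶ T),
      (∀ Z, complexBdd C b (T.obj Z)) ∧
      (∀ {Z Z' : CochainComplex C ℤ} (f : Z ⟶ Z'), QuasiIso f → QuasiIso (S.map f)) ∧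
      (∀ {Z Z' : CochainComplex C ℤ} (f : Z ⟶ Z'), QuasiIso f → QuasiIso (T.map f)) ∧
      IsIso (α.app X) ∧ IsIso (α.app Y) ∧ IsIso (β.app X) ∧ IsIso (β.app Y) := by
  have hXY := Bdd.Holds.mono (b := b) hX hY 0 0 (r := fun n => IsZero (X.X n) ∧ IsZero (Y.X n))
    (fun n h h' => by simpa using And.intro h h')
  let LE (n : ℤ) : CochainComplex C ℤ ⥤ CochainComplex C ℤ :=
    (ComplexShape.embeddingUpIntLE n).truncLEFunctor C
  let GE (n : ℤ) : CochainComplex C ℤ ⥤ CochainComplex C ℤ :=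
    (ComplexShape.embeddingUpIntGE n).truncGEFunctor C
  let ιLE (n : ℤ) : LE n ⟶ 𝟭 _ := (ComplexShape.embeddingUpIntLE n).ιTruncLENatTrans C
  let πGE (n : ℤ) : 𝟭 _ ⟶ GE n := (ComplexShape.embeddingUpIntGE n).πTruncGENatTrans C
  have LEqis (n : ℤ) {Z Z' : CochainComplex C ℤ} (f : Z ⟶ Z') (hf : QuasiIso f) :
      QuasiIso ((LE n).map f) := by
    refine (quasiIso_truncLEMap_iff (φ := f) (n := n)).2 fun i _ => inferInstance
  have GEqis (n : ℤ) {Z Z' : CochainComplex C ℤ} (f : Z ⟶ Z') (hf : QuasiIso f) :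
      QuasiIso ((GE n).map f) := by
    refine (quasiIso_truncGEMap_iff (φ := f) (n := n)).2 fun i _ => inferInstance
  have LEiso (n : ℤ) (K : CochainComplex C ℤ) (h : ∀ m, n < m → IsZero (K.X m)) :
      IsIso ((ιLE n).app K) := (isIso_ιTruncLE_iff K n).2 ((isStrictlyLE_iff K n).2 h)
  have GEiso (n : ℤ) (K : CochainComplex C ℤ) (h : ∀ m, m < n → IsZero (K.X m)) :
      IsIso ((πGE n).app K) := (isIso_πTruncGE_iff K n).2 ((isStrictlyGE_iff K n).2 h)
  have LEbdd (n : ℤ) (K : CochainComplex C ℤ) (m : ℤ) (hm : n < m) : IsZero (((LE n).obj K).X m) :=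
    isZero_of_isStrictlyLE (K.truncLE n) n m hm
  have GEbdd (n : ℤ) (K : CochainComplex C ℤ) (m : ℤ) (hm : m < n) : IsZero (((GE n).obj K).X m) :=
    isZero_of_isStrictlyGE (K.truncGE n) n m hm
  have below (hXY : ∃ N : ℤ, ∀ n, n < N → IsZero (X.X n) ∧ IsZero (Y.X n)) :
      ∃ N : ℤ, (∀ n, n < N → IsZero (X.X n)) ∧ ∀ n, n < N → IsZero (Y.X n) :=
    ⟨hXY.choose, fun n hn => (hXY.choose_spec n hn).1, fun n hn => (hXY.choose_spec n hn).2⟩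
  have above (hXY : ∃ N : ℤ, ∀ n, N < n → IsZero (X.X n) ∧ IsZero (Y.X n)) :
      ∃ N : ℤ, (∀ n, N < n → IsZero (X.X n)) ∧ ∀ n, N < n → IsZero (Y.X n) :=
    ⟨hXY.choose, fun n hn => (hXY.choose_spec n hn).1, fun n hn => (hXY.choose_spec n hn).2⟩
  -- The three zigzags are the inclusion of the truncation from above, the projection to the
  -- truncation from below, and one followed by the other.
  cases b with
  | minus =>
    obtain ⟨N, h1, h2⟩ := above hXY
    exact ⟨LE N, LE N, ιLE N, 𝟙 _, fun Z => ⟨N, LEbdd N Z⟩, LEqis N, LEqis N, LEiso N X h1,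
      LEiso N Y h2, inferInstance, inferInstance⟩
  | plus =>
    obtain ⟨N, h1, h2⟩ := below hXY
    exact ⟨𝟭 _, GE N, 𝟙 _, πGE N, fun Z => ⟨N, GEbdd N Z⟩, fun _ h => h, GEqis N, inferInstance,
      inferInstance, GEiso N X h1, GEiso N Y h2⟩
  | bounded =>
    obtain ⟨N, h1, h2⟩ := above hXY.1
    obtain ⟨M, h3, h4⟩ := below hXY.2
    have LEzero (K : CochainComplex C ℤ) (h1 : ∀ n, N < n → IsZero (K.X n))
        (h3 : ∀ n, n < M → IsZero (K.X n)) (n : ℤ) (hn : n < M) :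
        IsZero (((LE N).obj K).X n) := by
      have := LEiso N K h1
      exact (h3 n hn).of_iso ((HomologicalComplex.eval C _ n).mapIso (asIso ((ιLE N).app K)))
    have hLE (K : CochainComplex C ℤ) : ((LE N).obj K).IsStrictlyLE N :=
      (isStrictlyLE_iff _ N).2 (LEbdd N K)
    exact ⟨LE N, LE N ⋙ GE M, ιLE N, Functor.whiskerLeft (LE N) (πGE M),
      fun Z => ⟨⟨N, fun n hn => isZero_of_isStrictlyLE (((LE N).obj Z).truncGE M) N n hn⟩,
        M, GEbdd M _⟩, LEqis N, fun f h => GEqis M _ (LEqis N f h), LEiso N X h1,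
      LEiso N Y h2, GEiso M _ (LEzero X h1 h3), GEiso M _ (LEzero Y h2 h4)⟩

end Truncation

section Derived

variable {A : Type u} [Category.{v} A] [Abelian A] (τ : TorsionPair A) [Abelian (Tilt τ)]

namespace Dec

lemma complexBdd_cx (b : Bdd) {D : Dec A} (hD : compat τ D) (h : isBdd A b D) :
    complexBdd (Tilt τ) b (D.cx hD) :=
  -- The object in degree `n` is built from `Eⁿ` and `Eⁿ⁺¹`, whence the offsets `0` and `1`.
  Bdd.Holds.mono (b := b) h h 0 1 fun n h h' =>
    Tilt.IsStrictlyZero.isZero ⟨isZero_tilt_Xm hD n (by simpa using h), isZero_tilt_X0 hD n h'⟩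

/-- The functor from bounded decorated complexes to bounded complexes. -/
noncomputable def toCxBdd (b : Bdd) :
    (compat τ ⊓ isBdd A b).FullSubcategory ⥤ (complexBdd (Tilt τ) b).FullSubcategory :=
  (complexBdd (Tilt τ) b).lift (toCx (compat τ ⊓ isBdd A b) inf_le_left)
    fun X => complexBdd_cx τ b X.property.1 X.property.2

instance : (toCx (compat τ) le_rfl).EssSurj where
  mem_essImage K := by
    obtain ⟨D, hD, ⟨e⟩, -⟩ := exists_cx_iso K
    exact ⟨⟨D, hD⟩, ⟨e⟩⟩

instance (b : Bdd) : (toCxBdd τ b).EssSurj where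
  mem_essImage K := by
    obtain ⟨D, hD, ⟨e⟩, h⟩ := exists_cx_iso K.obj
    refine ⟨⟨D, hD, Bdd.Holds.mono (b := b) K.property K.property 0 (-1) fun n h1 h2 => ?_⟩,
      ⟨(complexBdd (Tilt τ) b).ι.preimageIso e⟩⟩
    exact h n (by simpa using h1) h2

lemma exists_roof_toCx {X Y : (compat τ).FullSubcategory}
    (φ : (toCx (compat τ) le_rfl).obj X ⟶ (toCx (compat τ) le_rfl).obj Y) :
    ∃ (Z : (compat τ).FullSubcategory) (s : Z ⟶ X) (f : Z ⟶ Y),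
      IsIso ((toCx (compat τ) le_rfl).map s) ∧
        (toCx (compat τ) le_rfl).map s ≫ φ = (toCx (compat τ) le_rfl).map f ∧
        ∀ (U : (compat τ).FullSubcategory) (a : U ⟶ X) (b : U ⟶ Y),
          (toCx (compat τ) le_rfl).map a ≫ φ = (toCx (compat τ) le_rfl).map b →
            ∃ r : U ⟶ Z, r ≫ s = a ∧ r ≫ f = b := by
  obtain ⟨D, hD, p, q, h1, h2, h3, -⟩ := exists_terminal_roof X.property Y.property φ
  refine ⟨⟨D, hD⟩, ObjectProperty.homMk p, ObjectProperty.homMk q, h1, h2, fun U a b e => ?_⟩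
  obtain ⟨r, hr, hr'⟩ := h3 U.obj U.property a.hom b.hom e
  exact ⟨ObjectProperty.homMk r, ObjectProperty.hom_ext _ hr, ObjectProperty.hom_ext _ hr'⟩

lemma exists_roof_toCxBdd (b : Bdd) {X Y : (compat τ ⊓ isBdd A b).FullSubcategory}
    (φ : (toCxBdd τ b).obj X ⟶ (toCxBdd τ b).obj Y) :
    ∃ (Z : (compat τ ⊓ isBdd A b).FullSubcategory) (s : Z ⟶ X) (f : Z ⟶ Y),
      IsIso ((toCxBdd τ b).map s) ∧ (toCxBdd τ b).map s ≫ φ = (toCxBdd τ b).map f ∧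
        ∀ (U : (compat τ ⊓ isBdd A b).FullSubcategory) (a : U ⟶ X) (c : U ⟶ Y),
          (toCxBdd τ b).map a ≫ φ = (toCxBdd τ b).map c → ∃ r : U ⟶ Z, r ≫ s = a ∧ r ≫ f = c := by
  obtain ⟨D, hD, p, q, h1, h2, h3, h4⟩ := exists_terminal_roof X.property.1 Y.property.1 φ.hom
  have h5 : isBdd A b D := by
    have := Bdd.Holds.mono (b := b) Y.property.2 Y.property.2 0 (-1)
      (r := fun n => IsZero (Y.obj.E.X n) ∧ IsZero (Y.obj.E.X (n - 1)))
      (fun n h1 h2 => ⟨by simpa using h1, h2⟩)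
    exact Bdd.Holds.mono (b := b) X.property.2 this 0 0 fun n h1 h2 =>
      h4 n (by simpa using h1) (by simpa using h2.1) (by simpa using h2.2)
  refine ⟨⟨D, hD, h5⟩, ObjectProperty.homMk p, ObjectProperty.homMk q, ?_, ?_, fun U a c e => ?_⟩
  · exact (isIso_iff_of_reflects_iso _ (complexBdd (Tilt τ) b).ι).1 h1
  · exact ObjectProperty.hom_ext _ h2
  · obtain ⟨r, hr, hr'⟩ := h3 U.obj U.property.1 a.hom c.hom congr(($e).hom)
    exact ⟨ObjectProperty.homMk r, ObjectProperty.hom_ext _ hr, ObjectProperty.hom_ext _ hr'⟩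

end Dec

variable [HasDerivedCategory.{w} (Tilt τ)]

open DerivedCategory

lemma derivedBdd_Q_obj (b : Bdd) (K : CochainComplex (Tilt τ) ℤ)
    (h : complexBdd (Tilt τ) b K) : ChSt.derivedBdd τ b (Q.obj K) := by
  have above : (∃ N : ℤ, ∀ n, N < n → IsZero (K.X n)) → TStructure.t.minus (Q.obj K) := by
    rintro ⟨N, hN⟩
    have : K.IsStrictlyLE N := (CochainComplex.isStrictlyLE_iff K N).2 hN
    exact ⟨N, inferInstanceAs ((Q.obj K).IsLE N)⟩
  have below : (∃ N : ℤ, ∀ n, n < N → IsZero (K.X n)) → TStructure.t.plus (Q.obj K) := by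
    rintro ⟨N, hN⟩
    have : K.IsStrictlyGE N := (CochainComplex.isStrictlyGE_iff K N).2 hN
    exact ⟨N, inferInstanceAs ((Q.obj K).IsGE N)⟩
  cases b with
  | minus => exact above h
  | plus => exact below h
  | bounded => exact ⟨below h.2, above h.1⟩

lemma exists_iso_Q_obj_of_derivedBdd (b : Bdd) (X : DerivedCategory (Tilt τ))
    (h : ChSt.derivedBdd τ b X) : ∃ K, complexBdd (Tilt τ) b K ∧ Nonempty (Q.obj K ≅ X) := by
  cases b with
  | minus =>
    obtain ⟨N, hN⟩ := h
    have : X.IsLE N := hN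
    obtain ⟨K, hK, ⟨e⟩⟩ := X.exists_iso_Q_obj_of_isLE N
    exact ⟨K, ⟨N, (CochainComplex.isStrictlyLE_iff K N).1 hK⟩, ⟨e.symm⟩⟩
  | plus =>
    obtain ⟨N, hN⟩ := h
    have : X.IsGE N := hN
    obtain ⟨K, hK, ⟨e⟩⟩ := X.exists_iso_Q_obj_of_isGE N
    exact ⟨K, ⟨N, fun n hn => (CochainComplex.isStrictlyGE_iff K N).1 hK n hn⟩, ⟨e.symm⟩⟩
  | bounded =>
    obtain ⟨⟨M, hM⟩, N, hN⟩ := h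
    have : X.IsLE N := hN
    have : X.IsGE M := hM
    obtain ⟨K, hK, hK', ⟨e⟩⟩ := X.exists_iso_Q_obj_of_isGE_of_isLE M N
    exact ⟨K, ⟨⟨N, (CochainComplex.isStrictlyLE_iff K N).1 hK'⟩,
      M, fun n hn => (CochainComplex.isStrictlyGE_iff K M).1 hK n hn⟩, ⟨e.symm⟩⟩

/-- The localization functor from bounded complexes to the bounded derived category. -/
noncomputable def bddQ (b : Bdd) :
    (complexBdd (Tilt τ) b).FullSubcategory ⥤ (ChSt.derivedBdd τ b).FullSubcategory :=
  (ChSt.derivedBdd τ b).lift ((complexBdd (Tilt τ) b).ι ⋙ Q)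
    fun X => derivedBdd_Q_obj τ b _ X.property

lemma exists_fraction_Q {X Y : CochainComplex (Tilt τ) ℤ} (φ : Q.obj X ⟶ Q.obj Y) :
    ∃ (Z : CochainComplex (Tilt τ) ℤ) (s : Z ⟶ X) (f : Z ⟶ Y),
      HomologicalComplex.quasiIso (Tilt τ) (ComplexShape.up ℤ) s ∧
        Q.map s ≫ φ = Q.map f := by
  obtain ⟨X', s, hs, g, rfl⟩ := right_fac φ
  exact ⟨X', s, g, (isIso_Q_map_iff_quasiIso _ s).1 hs, by simp⟩

instance (b : Bdd) : (bddQ τ b).EssSurj :=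
  essSurj_lift_of_exists_iso Q _ _ (derivedBdd_Q_obj τ b) (exists_iso_Q_obj_of_derivedBdd τ b)

lemma bddQ_isIso_iff (b : Bdd) {X Y : (complexBdd (Tilt τ) b).FullSubcategory} (f : X ⟶ Y) :
    QuasiIso f.hom ↔ IsIso ((bddQ τ b).map f) :=
  (isIso_Q_map_iff_quasiIso _ f.hom).symm.trans
    (isIso_iff_of_reflects_iso ((bddQ τ b).map f) (ChSt.derivedBdd τ b).ι)

lemma exists_fraction_bddQ (b : Bdd) {X Y : (complexBdd (Tilt τ) b).FullSubcategory}
    (φ : (bddQ τ b).obj X ⟶ (bddQ τ b).obj Y) :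
    ∃ (Z : (complexBdd (Tilt τ) b).FullSubcategory) (s : Z ⟶ X) (f : Z ⟶ Y),
      IsIso ((bddQ τ b).map s) ∧ (bddQ τ b).map s ≫ φ = (bddQ τ b).map f := by
  obtain ⟨Z, s, f, hs, h⟩ := exists_fraction_of_truncations Q
    (HomologicalComplex.quasiIso (Tilt τ) (ComplexShape.up ℤ))
    (fun f => (isIso_Q_map_iff_quasiIso _ f).symm) (exists_fraction_Q τ) _ _
    (derivedBdd_Q_obj τ b) (exists_truncation b) φ
  exact ⟨Z, s, f, (bddQ_isIso_iff τ b s).1 hs, h⟩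

instance (b : Bdd) : (bddQ τ b).IsLocalization
    ((HomologicalComplex.quasiIso (Tilt τ) (ComplexShape.up ℤ)).inverseImage
      (complexBdd (Tilt τ) b).ι) :=
  isLocalization_lift_of_truncations Q
    (HomologicalComplex.quasiIso (Tilt τ) (ComplexShape.up ℤ))
    (fun f => (isIso_Q_map_iff_quasiIso _ f).symm) (exists_fraction_Q τ) _ _
    (derivedBdd_Q_obj τ b) (exists_iso_Q_obj_of_derivedBdd τ b) (exists_truncation b)

namespace Dec

/-- The functor from decorated complexes to the derived category of the tilted category. -/
noncomputable abbrev toD : (compat τ).FullSubcategory ⥤ DerivedCategory (Tilt τ) :=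
  toCx (compat τ) le_rfl ⋙ Q

/-- The functor from bounded decorated complexes to the bounded derived category. -/
noncomputable def toDBdd (b : Bdd) :
    (compat τ ⊓ isBdd A b).FullSubcategory ⥤ (ChSt.derivedBdd τ b).FullSubcategory :=
  (ChSt.derivedBdd τ b).lift (toCx (compat τ ⊓ isBdd A b) inf_le_left ⋙ Q)
    fun X => derivedBdd_Q_obj τ b _ (complexBdd_cx τ b X.property.1 X.property.2)

/-- Two localizations are composed, and by `qis_iff` the class inverted by the composite is that of
the quasi-isomorphisms of the underlying complexes in `A`. -/
instance : (toD τ).IsLocalization (qis (compat τ)) := by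
  have := isLocalization_comp_of_terminal_roofs (toCx (compat τ) le_rfl) (exists_roof_toCx τ)
    Q (HomologicalComplex.quasiIso (Tilt τ) (ComplexShape.up ℤ))
      (fun f => (isIso_Q_map_iff_quasiIso _ f).symm)
  convert this using 1
  ext X Y f
  exact qis_iff _ le_rfl f

instance (b : Bdd) : (toDBdd τ b).IsLocalization (qis (compat τ ⊓ isBdd A b)) := by
  have := isLocalization_comp_of_terminal_roofs (toCxBdd τ b) (exists_roof_toCxBdd τ b)
    (bddQ τ b) ((HomologicalComplex.quasiIso (Tilt τ) (ComplexShape.up ℤ)).inverseImage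
      (complexBdd (Tilt τ) b).ι) (bddQ_isIso_iff τ b)
  have h : qis (compat τ ⊓ isBdd A b) =
      ((HomologicalComplex.quasiIso (Tilt τ) (ComplexShape.up ℤ)).inverseImage
        (complexBdd (Tilt τ) b).ι).inverseImage (toCxBdd τ b) := by
    ext X Y f
    exact qis_iff _ inf_le_left f
  rw [h]
  exact this

end Dec

end Derived

end HRS

/-! ### Transport of the triangulated structure. -/

namespace HRS

section Transport

variable {C D : Type*} [Category C] [Category D] [HasShift C ℤ] [HasShift D ℤ]
  [Preadditive C] [HasZeroObject C] [∀ n : ℤ, (shiftFunctor C n).Additive]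
  [Preadditive D] [HasZeroObject D] [∀ n : ℤ, (shiftFunctor D n).Additive] [Pretriangulated D]
  (F : C ⥤ D) [F.CommShift ℤ] [F.Additive] [F.IsEquivalence]

open Pretriangulated

/-- The pretriangulated structure transported along an equivalence. -/
@[reducible]
noncomputable def pretriangulatedOfEquivalence : Pretriangulated C where
  distinguishedTriangles := F.mapTriangle.obj ⁻¹' distinguishedTriangles
  isomorphic_distinguished T₁ hT₁ T₂ e :=
    isomorphic_distinguished _ hT₁ _ (F.mapTriangle.mapIso e)
  contractible_distinguished X :=
    isomorphic_distinguished _ (contractible_distinguished (F.obj X)) _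
      (Triangle.isoMk (F.mapTriangle.obj (contractibleTriangle X)) (contractibleTriangle (F.obj X))
        (Iso.refl _) (Iso.refl _) F.mapZeroObject
        ((Category.comp_id _).trans ((F.map_id X).trans (Category.id_comp _).symm))
        ((isZero_zero D).eq_of_tgt _ _)
        ((F.map_isZero (isZero_zero C)).eq_of_src _ _))
  distinguished_cocone_triangle {X Y} f := by
    obtain ⟨Z, g, h, mem⟩ := distinguished_cocone_triangle (F.map f)
    let e := F.objObjPreimageIso Z
    refine ⟨F.objPreimage Z, F.preimage (g ≫ e.inv),
      F.preimage (e.hom ≫ h ≫ (F.commShiftIso (1 : ℤ)).inv.app X),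
      isomorphic_distinguished _ mem _ (Triangle.isoMk _ _ (Iso.refl _) (Iso.refl _) e ?_ ?_ ?_)⟩
    · exact (Category.comp_id _).trans (Category.id_comp _).symm
    · change F.map (F.preimage (g ≫ e.inv)) ≫ e.hom = 𝟙 _ ≫ g
      simp
    · change (F.map (F.preimage (e.hom ≫ h ≫ (F.commShiftIso (1 : ℤ)).inv.app X)) ≫
        (F.commShiftIso (1 : ℤ)).hom.app X) ≫ (shiftFunctor D (1 : ℤ)).map (𝟙 _) = e.hom ≫ h
      simp
  rotate_distinguished_triangle T :=
    (rotate_distinguished_triangle (F.mapTriangle.obj T)).trans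
      (distinguished_iff_of_iso (F.mapTriangleRotateIso.app T))
  complete_distinguished_triangle_morphism T₁ T₂ hT₁ hT₂ a b comm := by
    obtain ⟨c, hc₁, hc₂⟩ : ∃ c : F.obj T₁.obj₃ ⟶ F.obj T₂.obj₃,
        F.map T₁.mor₂ ≫ c = F.map b ≫ F.map T₂.mor₂ ∧
        (F.map T₁.mor₃ ≫ (F.commShiftIso (1 : ℤ)).hom.app T₁.obj₁) ≫
          (shiftFunctor D (1 : ℤ)).map (F.map a) =
            c ≫ F.map T₂.mor₃ ≫ (F.commShiftIso (1 : ℤ)).hom.app T₂.obj₁ :=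
      complete_distinguished_triangle_morphism (F.mapTriangle.obj T₁)
        (F.mapTriangle.obj T₂) hT₁ hT₂ (F.map a) (F.map b)
        ((F.map_comp _ _).symm.trans (congr(F.map $comm).trans (F.map_comp _ _)))
    refine ⟨F.preimage c, F.map_injective ?_, F.map_injective ?_⟩
    · rw [F.map_comp, F.map_comp, F.map_preimage, hc₁]
    · have h := (F.commShiftIso (1 : ℤ)).hom.naturality a
      rw [F.map_comp, F.map_comp, F.map_preimage,
        ← cancel_mono ((F.commShiftIso (1 : ℤ)).hom.app T₂.obj₁), Category.assoc, Category.assoc,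
        ← hc₂, Category.assoc]
      exact congr(_ ≫ $h)

lemma isTriangulated_ofEquivalence :
    letI := pretriangulatedOfEquivalence F
    F.IsTriangulated :=
  letI := pretriangulatedOfEquivalence F
  ⟨fun _ h => h⟩

end Transport

section Localization

variable {C D : Type*} [Category C] [Category D]

/-- Needed to show that every distinguished triangle comes from a cone: the first map of a triangle
has to be isomorphic to the image of an actual map. -/
lemma essSurj_mapArrow_of_fractions (L : C ⥤ D) [L.EssSurj]
    (hfac : ∀ {X Y : C} (φ : L.obj X ⟶ L.obj Y), ∃ (Z : C) (s : Z ⟶ X) (f : Z ⟶ Y),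
      IsIso (L.map s) ∧ L.map s ≫ φ = L.map f) : L.mapArrow.EssSurj where
  mem_essImage φ := by
    let e := L.objObjPreimageIso φ.left
    let e' := L.objObjPreimageIso φ.right
    obtain ⟨Z, s, f, _, h⟩ := hfac (X := L.objPreimage φ.left) (Y := L.objPreimage φ.right)
      (e.hom ≫ φ.hom ≫ e'.inv)
    let i : L.obj Z ≅ L.obj (L.objPreimage φ.left) := asIso (L.map s)
    refine ⟨Arrow.mk f, ⟨Arrow.isoMk (i ≪≫ e) e' ?_⟩⟩
    change (L.map s ≫ e.hom) ≫ φ.hom = L.map f ≫ e'.hom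
    rw [← h]
    simp

end Localization

section Main

variable {A : Type u} [Category.{v} A] [Abelian A]
  {S D : Type*} [Category S] [Category D] [HasShift D ℤ]
  [Preadditive D] [HasZeroObject D] [∀ n : ℤ, (shiftFunctor D n).Additive] [Pretriangulated D]
  [IsTriangulated D]

open Pretriangulated ZeroObject in
/-- A localization functor to a triangulated category which sends the triangles of decorated cones
to distinguished triangles yields a triangle equivalence. -/
theorem inducesTriangleEquivalence_of_isLocalization
    (ℓ : S ⥤ D) (P : ObjectProperty (Dec A)) [P.IsStableUnderShift ℤ] [Dec.ConeClosed P]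
    (T : S ⥤ P.FullSubcategory) (G : P.FullSubcategory ⥤ D) [G.CommShift ℤ]
    [G.IsLocalization (Dec.qis P)] [G.mapArrow.EssSurj]
    (hG : ∀ {X Y : P.FullSubcategory} (f g : X ⟶ Y), Dec.Homotopic f.hom g.hom →
      G.map f = G.map g)
    (hcone : ∀ {X Y : P.FullSubcategory} (f : X ⟶ Y),
      G.mapTriangle.obj (Dec.coneTriangle P f) ∈ distinguishedTriangles)
    (e : T ⋙ G ≅ ℓ) : InducesTriangleEquivalence ℓ P T := by
  -- All structure on the localization is pulled back along `Ψ`; the required functor `Φ` is the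
  -- inverse of this equivalence.
  let E : Dec.Loc P ≌ D := Localization.equivalenceFromModel G (Dec.qis P)
  let Ψ : Dec.Loc P ⥤ D := E.functor
  let ε : Dec.locQ P ⋙ Ψ ≅ G := Localization.qCompEquivalenceFromModelFunctorIso G (Dec.qis P)
  let : Localization.Lifting (Dec.locQ P) (Dec.qis P) G Ψ := ⟨ε⟩
  let : Ψ.CommShift ℤ := Functor.commShiftOfLocalization (Dec.locQ P) (Dec.qis P) ℤ G Ψ
  have hε : NatTrans.CommShift ε.hom ℤ :=
    NatTrans.commShift_iso_hom_of_localization (Dec.locQ P) (Dec.qis P) ℤ G Ψ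
  have : Ψ.IsEquivalence := inferInstanceAs E.functor.IsEquivalence
  let : Preadditive (Dec.Loc P) :=
    Preadditive.ofFullyFaithful (Functor.FullyFaithful.ofFullyFaithful Ψ)
  have : Ψ.Additive := (Functor.FullyFaithful.ofFullyFaithful Ψ).additive_ofFullyFaithful
  have : HasZeroObject (Dec.Loc P) := by
    refine ⟨Ψ.objPreimage (0 : D), ?_⟩
    have h : IsZero (Ψ.obj (Ψ.objPreimage (0 : D))) :=
      (isZero_zero D).of_iso (Ψ.objObjPreimageIso (0 : D))
    rw [IsZero.iff_id_eq_zero]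
    exact Ψ.map_injective (h.eq_of_src _ _)
  have : ∀ n : ℤ, (shiftFunctor (Dec.Loc P) n).Additive := fun n => by
    have : (shiftFunctor (Dec.Loc P) n ⋙ Ψ).Additive :=
      Functor.additive_of_iso (Ψ.commShiftIso n).symm
    exact Functor.additive_of_comp_faithful _ Ψ
  let : Pretriangulated (Dec.Loc P) := pretriangulatedOfEquivalence Ψ
  have hΨ : Ψ.IsTriangulated := isTriangulated_ofEquivalence Ψ
  have hdist {X Y : P.FullSubcategory} (f : X ⟶ Y) :
      (Dec.locQ P).mapTriangle.obj (Dec.coneTriangle P f) ∈ distinguishedTriangles :=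
    isomorphic_distinguished _ (hcone f) _
      ((Functor.mapTriangleCompIso (Dec.locQ P) Ψ).symm.app _ ≪≫
        (Functor.mapTriangleIso ε).app _)
  refine ⟨fun {X Y} f g h => Ψ.map_injective ?_, ⟨inferInstance, inferInstance, inferInstance,
    inferInstance, IsTriangulated.of_fully_faithful_triangulated_functor Ψ, ?_⟩, E.inverse,
    inferInstance, ⟨?_⟩, ?_⟩
  · have h1 := ε.hom.naturality f
    have h2 := ε.hom.naturality g
    rw [hG f g h, ← h2] at h1
    exact (cancel_mono _).1 h1
  · ext U
    constructor
    -- A distinguished triangle is determined up to isomorphism by its first map, which is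
    -- isomorphic to the image of some `f`; compare with the cone triangle of `f`.
    · intro hU
      let a := G.mapArrow.objObjPreimageIso (Arrow.mk (Ψ.map U.mor₁))
      let f := (G.mapArrow.objPreimage (Arrow.mk (Ψ.map U.mor₁))).hom
      let ε' (X) : Ψ.obj ((Dec.locQ P).obj X) ≅ G.obj X := ε.app X
      let i₁ : Ψ.obj U.obj₁ ≅ G.obj _ := (Arrow.leftFunc.mapIso a).symm
      let i₂ : Ψ.obj U.obj₂ ≅ G.obj _ := (Arrow.rightFunc.mapIso a).symm
      have h1 : i₁.hom ≫ G.map f = Ψ.map U.mor₁ ≫ i₂.hom := Arrow.w a.inv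
      have h2 : Ψ.map ((Dec.locQ P).map f) ≫ (ε' _).hom = (ε' _).hom ≫ G.map f :=
        ε.hom.naturality f
      refine ⟨_, _, f, ⟨isoTriangleOfIso₁₂ U _ hU (hdist f) (Ψ.preimageIso (i₁ ≪≫ (ε' _).symm))
        (Ψ.preimageIso (i₂ ≪≫ (ε' _).symm)) (Ψ.map_injective ?_)⟩⟩
      rw [Ψ.map_comp, Ψ.map_comp, Functor.preimageIso_hom, Functor.preimageIso_hom,
        Ψ.map_preimage, Ψ.map_preimage]
      have h3 : Ψ.map U.mor₁ ≫ i₂.hom ≫ (ε' _).inv =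
          (i₁.hom ≫ (ε' _).inv) ≫ Ψ.map ((Dec.locQ P).map f) := by
        rw [← cancel_mono (ε' _).hom]
        simp only [Category.assoc, h2, Iso.inv_hom_id_assoc, Iso.inv_hom_id, Category.comp_id, h1]
      exact h3
    · rintro ⟨X, Y, f, ⟨i⟩⟩
      exact isomorphic_distinguished _ (hdist f) _ i
  · exact Functor.isoWhiskerRight e.symm E.inverse ≪≫ Functor.associator _ _ _ ≪≫
      Functor.isoWhiskerLeft T (Functor.isoWhiskerRight ε.symm E.inverse ≪≫
        Functor.associator _ _ _ ≪≫ Functor.isoWhiskerLeft (Dec.locQ P) E.unitIso.symm ≪≫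
        Functor.rightUnitor _)
  · let : E.functor.CommShift ℤ := inferInstanceAs (Ψ.CommShift ℤ)
    let := E.commShiftInverse ℤ
    have := E.commShift_of_functor ℤ
    have : E.functor.IsTriangulated := hΨ
    exact ⟨inferInstance, E.toAdjunction.isTriangulated_rightAdjoint⟩

end Main

end HRS

/-! ### Conclusion. -/

namespace HRS

variable {A : Type u} [Category.{v} A] [Abelian A] (τ : TorsionPair A) [Abelian (Tilt τ)]
  [HasDerivedCategory.{w} (Tilt τ)]

open DerivedCategory

namespace Dec

instance : (toD τ).mapArrow.EssSurj := by
  have h₁ : (toCx (compat τ) le_rfl).mapArrow.EssSurj :=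
    essSurj_mapArrow_of_fractions _ fun φ => by
      obtain ⟨Z, s, f, hs, h, -⟩ := exists_roof_toCx τ φ
      exact ⟨Z, s, f, hs, h⟩
  have h₂ : (Q (C := Tilt τ)).mapArrow.EssSurj :=
    essSurj_mapArrow_of_fractions _ fun φ => by
      obtain ⟨Z, s, f, hs, h⟩ := exists_fraction_Q τ φ
      exact ⟨Z, s, f, (isIso_Q_map_iff_quasiIso _ s).2 hs, h⟩
  exact inferInstanceAs ((toCx (compat τ) le_rfl).mapArrow ⋙ Q.mapArrow).EssSurj

instance (b : Bdd) : (toDBdd τ b).mapArrow.EssSurj := by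
  have h₁ : (toCxBdd τ b).mapArrow.EssSurj :=
    essSurj_mapArrow_of_fractions _ fun φ => by
      obtain ⟨Z, s, f, hs, h, -⟩ := exists_roof_toCxBdd τ b φ
      exact ⟨Z, s, f, hs, h⟩
  have h₂ : (bddQ τ b).mapArrow.EssSurj :=
    essSurj_mapArrow_of_fractions _ fun φ => exists_fraction_bddQ τ b φ
  exact inferInstanceAs ((toCxBdd τ b).mapArrow ⋙ (bddQ τ b).mapArrow).EssSurj

noncomputable instance (b : Bdd) : (toDBdd τ b).CommShift ℤ :=
  inferInstanceAs (((ChSt.derivedBdd τ b).lift (toCx (compat τ ⊓ isBdd A b) inf_le_left ⋙ Q)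
    fun X => derivedBdd_Q_obj τ b _ (complexBdd_cx τ b X.property.1 X.property.2)).CommShift ℤ)

/-- Homotopic maps of decorated complexes have the same image in the derived category. -/
lemma Q_cxMap_eq_of_homotopic {D D' : Dec A} (hD : compat τ D) (hD' : compat τ D')
    (f g : D ⟶ D') (h : Homotopic f g) : Q.map (cxMap f hD hD') = Q.map (cxMap g hD hD') := by
  obtain ⟨h, hM⟩ := h
  exact Q_map_eq_of_homotopy _ (cxHomotopy h hM hD hD')

/-- A triangle in the bounded derived category is distinguished when its image in the whole derived
category is. -/
lemma coneTriangle_toDBdd_distinguished (b : Bdd)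
    {X Y : (compat τ ⊓ isBdd A b).FullSubcategory} (f : X ⟶ Y) :
    (toDBdd τ b).mapTriangle.obj (coneTriangle _ f) ∈ Pretriangulated.distinguishedTriangles := by
  have h := coneTriangle_distinguished (compat τ ⊓ isBdd A b) inf_le_left f
  let e := (ChSt.derivedBdd τ b).liftCompιIso (toCx (compat τ ⊓ isBdd A b) inf_le_left ⋙ Q)
    fun X => derivedBdd_Q_obj τ b _ (complexBdd_cx τ b X.property.1 X.property.2)
  exact Pretriangulated.isomorphic_distinguished _ h _
    ((Functor.mapTriangleCompIso (toDBdd τ b) (ChSt.derivedBdd τ b).ι).symm.app _ ≪≫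
      (Functor.mapTriangleIso e).app _)

end Dec

variable {τ} {Tot : ChSt τ ⥤ (Dec.compat τ).FullSubcategory}

theorem TotData.inducesTriangleEquivalence (h : TotData Tot) :
    InducesTriangleEquivalence (ChSt.toDerived τ) (Dec.compat τ) Tot :=
  inducesTriangleEquivalence_of_isLocalization _ _ _ (Dec.toD τ)
    (fun f g hfg => Dec.Q_cxMap_eq_of_homotopic τ _ _ f.hom g.hom hfg)
    (fun f => Dec.coneTriangle_distinguished _ le_rfl f)
    (Functor.isoWhiskerRight h.isoToCx.symm Q)

theorem TotData.restrict_inducesTriangleEquivalence (h : TotData Tot) (b : Bdd) :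
    InducesTriangleEquivalence (ChSt.toDerivedBdd τ b) (Dec.compat τ ⊓ Dec.isBdd A b)
      (h.restrict b) :=
  inducesTriangleEquivalence_of_isLocalization _ _ _ (Dec.toDBdd τ b)
    (fun f g hfg => ObjectProperty.hom_ext _
      (Dec.Q_cxMap_eq_of_homotopic τ _ _ f.hom g.hom hfg))
    (Dec.coneTriangle_toDBdd_distinguished τ b)
    -- The isomorphism of functors exists after inclusion into the derived category and is reflected
    -- by this fully faithful inclusion.
    (((ChSt.derivedBdd τ b).fullyFaithfulι.whiskeringRight _).preimageIso
      (Functor.isoWhiskerRight (h.restrictIsoToCx b).symm Q))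

end HRS

theorem theoremT {A : Type u} [Category.{v} A] [Abelian A] (τ : TorsionPair A) :
    ∃ _ : Abelian (HRS.Tilt τ), ∀ [HasDerivedCategory.{w} (HRS.Tilt τ)],
      (∃ Tot : ChSt τ ⥤ (Dec.compat τ).FullSubcategory, Nonempty (TotData Tot)) ∧
      ∀ (Tot : ChSt τ ⥤ (Dec.compat τ).FullSubcategory) (h : TotData Tot),
        InducesTriangleEquivalence (ChSt.toDerived τ) (Dec.compat τ) Tot ∧
        ∀ b : Bdd, InducesTriangleEquivalence (ChSt.toDerivedBdd τ b)
          (Dec.compat τ ⊓ Dec.isBdd A b) (h.restrict b) := by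
  obtain ⟨_⟩ := exists_abelian_tilt τ
  refine ⟨inferInstance, ⟨exists_tot τ, fun Tot h => ⟨h.inducesTriangleEquivalence, fun b =>
    h.restrict_inducesTriangleEquivalence b⟩⟩⟩
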